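/- Let $d\in\mathbf N$ and let $s,\sigma>0$ be real numbers. Spaces. For $h>0$ and $f\in C^\infty(\mathbf R^{d};\mathbf C)$ let $$\|f\|_{\mathcal S_{s,h}^{\sigma}}=\sup_{\alpha,\beta\in\mathbf N^d,\ x\in\mathbf R^d}\frac{|x^\alpha\partial^\beta f(x)|}{h^{|\alpha+\beta|}\,\alpha!^{s}\,\beta!^{\sigma}} .$$ $\mathcal S_s^\sigma(\mathbf R^d)$ (respectively $\Sigma_s^\sigma(\mathbf R^d)$) is the space of all $f\in C^\infty(\mathbf R^d)$ for which this is finite for some $h>0$ (respectively for every $h>0$), with the locally convex inductive limit topology (respectively the projective limit topology) with respect to $h>0$. In the same way, $\mathcal S_{s,\sigma}^{\sigma,s}(\mathbf R^{2d})$ and $\Sigma_{s,\sigma}^{\sigma,s}(\mathbf R^{2d})$ are defined by $$\|\Phi\|=\sup\frac{|x^{\alpha_1}\xi^{\alpha_2}\,\partial_x^{\beta_1}\partial_\xi^{\beta_2}\Phi(x,\xi)|}{h^{|\alpha_1|+|\alpha_2|+|\beta_1|+|\beta_2|}\,\alpha_1!^{s}\,\alpha_2!^{\sigma}\,\beta_1!^{\sigma}\,\beta_2!^{s}},$$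 the supremum being taken over $\alpha_1,\alpha_2,\beta_1,\beta_2\in\mathbf N^d$ and $x,\xi\in\mathbf R^d$. A prime denotes the space of continuous linear functionals, with the strong dual topology. (This is the canonical projective limit topology for $(\mathcal S_s^\sigma)'$ and $(\mathcal S_{s,\sigma}^{\sigma,s})'$, and the canonical inductive limit topology for $(\Sigma_s^\sigma)'$ and $(\Sigma_{s,\sigma}^{\sigma,s})'$.) A function $f$ is identified with the functional $\varphi\mapsto\int f\varphi$, whenever these integrals converge absolutely and define a continuous functional. Zak transform. Let $E=(e_1,\dots,e_d)$ be an ordered basis of $\mathbf R^d$, let $(e_1',\dots,e_d')$ be the basis of $\mathbf R^d$ with $\langle e_j,e_k'\rangle=2\pi\delta_{jk}$, and let $\Lambda_E$ and $\Lambda_E'$ be the lattices of integer combinations of the $e_j$ and of the $e_j'$, respectively. For $f$ in the Schwartz space $\mathscr S(\mathbf R^d)$ let $$(Z_Ef)(x,\xi)=\sum_{j\in\Lambda_E}f(x-j)e^{i\langle j,\xi\rangle},\qquad x,\xi\in\mathbf R^d .$$ A distribution $F$ in $(\mathcal S_{s,\sigma}^{\sigma,s})'(\mathbf R^{2d})$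 or in $(\Sigma_{s,\sigma}^{\sigma,s})'(\mathbf R^{2d})$ is called quasi-periodic of order $E$ if, in the sense of distributions, $$F(x+k,\xi)=e^{i\langle k,\xi\rangle}F(x,\xi)\quad\text{and}\quad F(x,\xi+\kappa)=F(x,\xi)\qquad\text{for all }k\in\Lambda_E,\ \kappa\in\Lambda_E' .$$ Theorem. There is a linear homeomorphism from $(\mathcal S_s^\sigma)'(\mathbf R^d)$ onto the set of quasi-periodic elements of order $E$ in $(\mathcal S_{s,\sigma}^{\sigma,s})'(\mathbf R^{2d})$ (with the subspace topology) which maps $f$ to $Z_Ef$ for every $f\in\mathscr S(\mathbf R^d)$, and it is the only continuous map from $(\mathcal S_s^\sigma)'(\mathbf R^d)$ to $(\mathcal S_{s,\sigma}^{\sigma,s})'(\mathbf R^{2d})$ which maps $f$ to $Z_Ef$ for every $f\in\mathscr S(\mathbf R^d)$. The same holds with $(\Sigma_s^\sigma)'(\mathbf R^d)$ and $(\Sigma_{s,\sigma}^{\sigma,s})'(\mathbf R^{2d})$ in place of $(\mathcal S_s^\sigma)'(\mathbf R^d)$ and $(\mathcal S_{s,\sigma}^{\sigma,s})'(\mathbf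 R^{2d})$ at each occurrence. -/

import Mathlib

open MeasureTheory Filter
open scoped ContDiff SchwartzMap ENNReal NNReal RealInnerProductSpace

noncomputable section

/-! ### Gelfand-Shilov spaces

Let `V` be a real vector space with basis `b : Basis ι ℝ V`. Coordinates, partial derivatives and
multi-indices are taken with respect to `b`, and each coordinate has its own pair of
parameters `(s i, σ i)`. The isotropic spaces on `ℝ^d` and the spaces on `ℝ^{d₁} × ℝ^{d₂}` with
two pairs of parameters are the instances given further below. -/

namespace GelfandShilov

variable {ι V : Type*} [Fintype ι] [NormedAddCommGroup V] [NormedSpace ℝ V]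

/-- The list of indices in which every `i` occurs exactly `β i` times. -/
def indexList (β : ι → ℕ) : List ι :=
  Finset.univ.toList.flatMap fun i => List.replicate (β i) i

/-- The partial derivative `∂^β f (x)` along the basis `b`, for a multi-index `β`: the derivative
of order `|β|`, evaluated at the vectors `b i`, each repeated `β i` times. (The order of
these vectors does not matter, because it is only used for smooth `f`.) -/
def partialDeriv (b : Module.Basis ι ℝ V) (β : ι → ℕ) (f : V → ℂ) (x : V) : ℂ :=
  iteratedFDeriv ℝ (indexList β).length f x fun j => b ((indexList β).get j)

/-- The monomial `x^α`. -/
def monomial (b : Module.Basis ι ℝ V) (α : ι → ℕ) (x : V) : ℝ :=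
  ∏ i, b.repr x i ^ α i

/-- The weight `h^{|α+β|} ∏ i, (α i)!^{s i} (β i)!^{σ i}`. -/
def weight (s σ : ι → ℝ) (h : ℝ) (α β : ι → ℕ) : ℝ :=
  h ^ (∑ i, (α i + β i)) * ∏ i, (((α i).factorial : ℝ) ^ s i * ((β i).factorial : ℝ) ^ σ i)

/-- The extended norm `sup |x^α ∂^β f(x)| / (h^{|α+β|} α!^s β!^σ)`, the supremum being taken over
all multi-indices `α`, `β` and all points `x`. -/
def gsNorm (b : Module.Basis ι ℝ V) (s σ : ι → ℝ) (h : ℝ) (f : V → ℂ) : ℝ≥0∞ :=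
  ⨆ (α : ι → ℕ) (β : ι → ℕ) (x : V),
    ENNReal.ofReal (‖(monomial b α x : ℂ) * partialDeriv b β f x‖ / weight s σ h α β)

section basic

variable (b : Module.Basis ι ℝ V) (s σ : ι → ℝ)

theorem weight_pos {h : ℝ} (hh : 0 < h) (α β : ι → ℕ) : 0 < weight s σ h α β := by
  unfold weight
  have (n : ℕ) : (0 : ℝ) < (n.factorial : ℝ) := by exact_mod_cast n.factorial_pos
  refine mul_pos (pow_pos hh _) (Finset.prod_pos fun i _ => ?_)
  exact mul_pos (Real.rpow_pos_of_pos (this _) _) (Real.rpow_pos_of_pos (this _) _)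

theorem weight_mono {h h' : ℝ} (hh : 0 < h) (hle : h ≤ h') (α β : ι → ℕ) :
    weight s σ h α β ≤ weight s σ h' α β := by
  unfold weight
  have (n : ℕ) : (0 : ℝ) < (n.factorial : ℝ) := by exact_mod_cast n.factorial_pos
  refine mul_le_mul_of_nonneg_right (pow_le_pow_left₀ hh.le hle _) (Finset.prod_nonneg fun i _ => ?_)
  exact (mul_pos (Real.rpow_pos_of_pos (this _) _) (Real.rpow_pos_of_pos (this _) _)).le

theorem partialDeriv_add {f g : V → ℂ} (hf : ContDiff ℝ ∞ f) (hg : ContDiff ℝ ∞ g) (β : ι → ℕ)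
    (x : V) : partialDeriv b β (f + g) x = partialDeriv b β f x + partialDeriv b β g x := by
  unfold partialDeriv
  rw [iteratedFDeriv_add_apply (hf.contDiffAt.of_le (by exact_mod_cast le_top))
    (hg.contDiffAt.of_le (by exact_mod_cast le_top))]
  rfl

theorem partialDeriv_smul {f : V → ℂ} (hf : ContDiff ℝ ∞ f) (c : ℂ) (β : ι → ℕ)
    (x : V) : partialDeriv b β (c • f) x = c * partialDeriv b β f x := by
  unfold partialDeriv
  rw [iteratedFDeriv_const_smul_apply (hf.contDiffAt.of_le (by exact_mod_cast le_top))]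
  rfl

theorem gsNorm_anti {h h' : ℝ} (hh : 0 < h) (hle : h ≤ h') (f : V → ℂ) :
    gsNorm b s σ h' f ≤ gsNorm b s σ h f := by
  unfold gsNorm
  gcongr with α β x
  · exact weight_pos s σ hh α β
  · exact weight_mono s σ hh hle α β

theorem gsNorm_add_le {h : ℝ} (hh : 0 < h) {f g : V → ℂ} (hf : ContDiff ℝ ∞ f)
    (hg : ContDiff ℝ ∞ g) : gsNorm b s σ h (f + g) ≤ gsNorm b s σ h f + gsNorm b s σ h g := by
  refine iSup_le fun α => iSup_le fun β => iSup_le fun x => ?_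
  have key : ‖(monomial b α x : ℂ) * partialDeriv b β (f + g) x‖ / weight s σ h α β ≤
      ‖(monomial b α x : ℂ) * partialDeriv b β f x‖ / weight s σ h α β +
      ‖(monomial b α x : ℂ) * partialDeriv b β g x‖ / weight s σ h α β := by
    rw [partialDeriv_add b hf hg, mul_add, ← add_div]
    exact div_le_div_of_nonneg_right (norm_add_le _ _) (weight_pos s σ hh α β).le
  refine (ENNReal.ofReal_le_ofReal key).trans (ENNReal.ofReal_add_le.trans (add_le_add ?_ ?_))
  · exact le_iSup_of_le α (le_iSup_of_le β (le_iSup_of_le x le_rfl))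
  · exact le_iSup_of_le α (le_iSup_of_le β (le_iSup_of_le x le_rfl))

theorem gsNorm_smul (h : ℝ) {f : V → ℂ} (hf : ContDiff ℝ ∞ f) (c : ℂ) :
    gsNorm b s σ h (c • f) = ENNReal.ofReal ‖c‖ * gsNorm b s σ h f := by
  unfold gsNorm
  simp only [ENNReal.mul_iSup]
  congr! 6 with α β x
  rw [partialDeriv_smul b hf, ← ENNReal.ofReal_mul (norm_nonneg c), mul_left_comm, norm_mul c,
    mul_div_assoc]

theorem gsNorm_zero (h : ℝ) : gsNorm b s σ h (0 : V → ℂ) = 0 := by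
  have := gsNorm_smul b s σ h (f := (0 : V → ℂ)) contDiff_zero_fun 0
  simpa using this

theorem apply_le_gsNorm (h : ℝ) (f : V → ℂ) (x : V) :
    ENNReal.ofReal ‖f x‖ ≤ gsNorm b s σ h f := by
  refine le_iSup_of_le 0 (le_iSup_of_le 0 (le_iSup_of_le x (le_of_eq ?_)))
  have hl : (indexList (0 : ι → ℕ)).length = 0 := by simp [indexList]
  have : partialDeriv b 0 f x = f x := by
    unfold partialDeriv
    generalize indexList (0 : ι → ℕ) = l at hl
    obtain rfl := List.length_eq_zero_iff.1 hl
    simp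
  simp [this, weight, monomial]

end basic

/-- The underlying vector space of the Roumieu space: smooth functions with `gsNorm` finite for
some `h > 0`. -/
def roumieuSubmodule (b : Module.Basis ι ℝ V) (s σ : ι → ℝ) : Submodule ℂ (V → ℂ) where
  carrier := {f | ContDiff ℝ ∞ f ∧ ∃ h : ℝ, 0 < h ∧ gsNorm b s σ h f < ⊤}
  add_mem' := by
    rintro f g ⟨hf, h, hh, hfh⟩ ⟨hg, k, hk, hgk⟩
    refine ⟨hf.add hg, max h k, lt_max_of_lt_left hh, ?_⟩
    refine (gsNorm_add_le b s σ (lt_max_of_lt_left hh) hf hg).trans_lt (ENNReal.add_lt_top.2 ?_)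
    exact ⟨(gsNorm_anti b s σ hh (le_max_left h k) f).trans_lt hfh,
      (gsNorm_anti b s σ hk (le_max_right h k) g).trans_lt hgk⟩
  zero_mem' := ⟨contDiff_zero_fun, 1, one_pos, by simp [gsNorm_zero]⟩
  smul_mem' := by
    rintro c f ⟨hf, h, hh, hfh⟩
    refine ⟨hf.const_smul c, h, hh, ?_⟩
    rw [gsNorm_smul b s σ h hf]
    exact ENNReal.mul_lt_top ENNReal.ofReal_lt_top hfh

/-- The underlying vector space of the Beurling space: smooth functions with `gsNorm` finite for
every `h > 0`. -/
def beurlingSubmodule (b : Module.Basis ι ℝ V) (s σ : ι → ℝ) : Submodule ℂ (V → ℂ) where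
  carrier := {f | ContDiff ℝ ∞ f ∧ ∀ h : ℝ, 0 < h → gsNorm b s σ h f < ⊤}
  add_mem' := by
    rintro f g ⟨hf, hf'⟩ ⟨hg, hg'⟩
    exact ⟨hf.add hg, fun h hh => (gsNorm_add_le b s σ hh hf hg).trans_lt
      (ENNReal.add_lt_top.2 ⟨hf' h hh, hg' h hh⟩)⟩
  zero_mem' := ⟨contDiff_zero_fun, fun h _ => by simp [gsNorm_zero]⟩
  smul_mem' := by
    rintro c f ⟨hf, hf'⟩
    refine ⟨hf.const_smul c, fun h hh => ?_⟩
    rw [gsNorm_smul b s σ h hf]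
    exact ENNReal.mul_lt_top ENNReal.ofReal_lt_top (hf' h hh)

/-- The Gelfand-Shilov space of Roumieu type. -/
def Roumieu (b : Module.Basis ι ℝ V) (s σ : ι → ℝ) := ↥(roumieuSubmodule b s σ)

/-- The Gelfand-Shilov space of Beurling type. -/
def Beurling (b : Module.Basis ι ℝ V) (s σ : ι → ℝ) := ↥(beurlingSubmodule b s σ)

section instances

variable (b : Module.Basis ι ℝ V) (s σ : ι → ℝ)

instance : AddCommGroup (Roumieu b s σ) := inferInstanceAs (AddCommGroup ↥(roumieuSubmodule b s σ))
instance : Module ℂ (Roumieu b s σ) := inferInstanceAs (Module ℂ ↥(roumieuSubmodule b s σ))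
instance : AddCommGroup (Beurling b s σ) :=
  inferInstanceAs (AddCommGroup ↥(beurlingSubmodule b s σ))
instance : Module ℂ (Beurling b s σ) := inferInstanceAs (Module ℂ ↥(beurlingSubmodule b s σ))

instance : FunLike (Roumieu b s σ) V ℂ where
  coe f := f.1
  coe_injective _ _ h := Subtype.ext h

instance : FunLike (Beurling b s σ) V ℂ where
  coe f := f.1
  coe_injective _ _ h := Subtype.ext h

/-- The seminorms that define the locally convex inductive limit topology of the Roumieu space:
all seminorms whose restriction to the space `{f | gsNorm b s σ h f < ⊤}`, normed by
`gsNorm b s σ h`, is continuous for every `h > 0`. -/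
def roumieuSeminorms : SeminormFamily ℂ (Roumieu b s σ)
    {p : Seminorm ℂ (Roumieu b s σ) // ∀ h : ℝ, 0 < h → ∃ C : ℝ≥0, ∀ f : Roumieu b s σ,
      ENNReal.ofReal (p f) ≤ C * gsNorm b s σ h f} :=
  fun p => p.1

/-- The seminorm `gsNorm b s σ h` on the Beurling space. -/
def beurlingSeminorm (h : {h : ℝ // 0 < h}) : Seminorm ℂ (Beurling b s σ) :=
  Seminorm.of (fun f => (gsNorm b s σ h f).toReal)
    (fun f g => by
      have hf : gsNorm b s σ h f ≠ ⊤ := (f.2.2 h h.2).ne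
      have hg : gsNorm b s σ h g ≠ ⊤ := (g.2.2 h h.2).ne
      rw [← ENNReal.toReal_add hf hg]
      exact ENNReal.toReal_mono (ENNReal.add_ne_top.2 ⟨hf, hg⟩)
        (gsNorm_add_le b s σ h.2 f.2.1 g.2.1))
    (fun c f => by
      have := congrArg ENNReal.toReal (gsNorm_smul b s σ h f.2.1 c)
      rwa [ENNReal.toReal_mul, ENNReal.toReal_ofReal (norm_nonneg c)] at this)

/-- The seminorms `gsNorm b s σ h`, `h > 0`, which define the projective limit topology of the
Beurling space. -/
def beurlingSeminorms : SeminormFamily ℂ (Beurling b s σ) {h : ℝ // 0 < h} :=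
  fun h => beurlingSeminorm b s σ h

instance : TopologicalSpace (Roumieu b s σ) := (roumieuSeminorms b s σ).moduleFilterBasis.topology
instance : TopologicalSpace (Beurling b s σ) := (beurlingSeminorms b s σ).moduleFilterBasis.topology

theorem roumieu_withSeminorms : WithSeminorms (roumieuSeminorms b s σ) := ⟨rfl⟩
theorem beurling_withSeminorms : WithSeminorms (beurlingSeminorms b s σ) := ⟨rfl⟩

instance : IsTopologicalAddGroup (Roumieu b s σ) := (roumieu_withSeminorms b s σ).topologicalAddGroup
instance : ContinuousSMul ℂ (Roumieu b s σ) := (roumieu_withSeminorms b s σ).continuousSMul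
instance : IsTopologicalAddGroup (Beurling b s σ) :=
  (beurling_withSeminorms b s σ).topologicalAddGroup
instance : ContinuousSMul ℂ (Beurling b s σ) := (beurling_withSeminorms b s σ).continuousSMul

end instances

/-! ### Schwartz functions as Gelfand-Shilov distributions -/

section ofSchwartz

variable [MeasurableSpace V] [BorelSpace V] [FiniteDimensional ℝ V]

theorem integrable_schwartz_mul (μ : Measure V) [μ.IsAddHaarMeasure] (b : Module.Basis ι ℝ V)
    (s σ : ι → ℝ) {h : ℝ} (f : 𝓢(V, ℂ)) {φ : V → ℂ} (hφ : ContDiff ℝ ∞ φ)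
    (hfin : gsNorm b s σ h φ < ⊤) : Integrable (fun x => f x * φ x) μ := by
  refine (f.integrable (μ := μ)).mul_bdd (c := (gsNorm b s σ h φ).toReal)
    hφ.continuous.aestronglyMeasurable (Eventually.of_forall fun x => ?_)
  rw [← ENNReal.toReal_ofReal (norm_nonneg (φ x))]
  exact ENNReal.toReal_mono hfin.ne (apply_le_gsNorm b s σ h φ x)

theorem norm_integral_schwartz_mul_le (μ : Measure V) [μ.IsAddHaarMeasure]
    (b : Module.Basis ι ℝ V) (s σ : ι → ℝ) {h : ℝ} (f : 𝓢(V, ℂ)) {φ : V → ℂ}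
    (hfin : gsNorm b s σ h φ < ⊤) :
    ‖∫ x, f x * φ x ∂μ‖ ≤ (∫ x, ‖f x‖ ∂μ) * (gsNorm b s σ h φ).toReal := by
  rw [← integral_mul_const]
  refine norm_integral_le_of_norm_le ((f.integrable (μ := μ)).norm.mul_const _)
    (Eventually.of_forall fun x => ?_)
  rw [norm_mul]
  refine mul_le_mul_of_nonneg_left ?_ (norm_nonneg _)
  rw [← ENNReal.toReal_ofReal (norm_nonneg (φ x))]
  exact ENNReal.toReal_mono hfin.ne (apply_le_gsNorm b s σ h φ x)

/-- The Schwartz function `f` as the element `φ ↦ ∫ f φ dμ` of the dual of the Roumieu space. -/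
def Roumieu.ofSchwartz (μ : Measure V) [μ.IsAddHaarMeasure] (b : Module.Basis ι ℝ V)
    (s σ : ι → ℝ) (f : 𝓢(V, ℂ)) : StrongDual ℂ (Roumieu b s σ) :=
  let L : Roumieu b s σ →ₗ[ℂ] ℂ :=
    { toFun := fun φ => ∫ x, f x * φ x ∂μ
      map_add' := fun φ ψ => by
        obtain ⟨h, -, hφ⟩ := φ.2.2
        obtain ⟨k, -, hψ⟩ := ψ.2.2
        exact (integral_congr_ae (Eventually.of_forall fun x => mul_add (f x) (φ x) (ψ x))).trans
          (integral_add (integrable_schwartz_mul μ b s σ f φ.2.1 hφ)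
            (integrable_schwartz_mul μ b s σ f ψ.2.1 hψ))
      map_smul' := fun c φ => by
        simp only [RingHom.id_apply, smul_eq_mul]
        rw [← integral_const_mul]
        exact integral_congr_ae (Eventually.of_forall fun x => mul_left_comm (f x) c (φ x)) }
  { toLinearMap := L
    cont := by
      refine WithSeminorms.continuous_of_continuous_comp (norm_withSeminorms ℂ ℂ) L fun _ => ?_
      refine (roumieu_withSeminorms b s σ).continuous_seminorm
        ⟨(normSeminorm ℂ ℂ).comp L, fun h _ => ⟨(∫ x, ‖f x‖ ∂μ).toNNReal + 1, fun φ => ?_⟩⟩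
      by_cases hφ : gsNorm b s σ h φ < ⊤
      · have h1 := norm_integral_schwartz_mul_le μ b s σ f hφ
        refine (ENNReal.ofReal_le_ofReal h1).trans ?_
        rw [ENNReal.ofReal_mul (integral_nonneg fun _ => norm_nonneg _),
          ENNReal.ofReal_toReal hφ.ne]
        gcongr
        push_cast
        exact le_self_add
      · rw [not_lt_top_iff.1 hφ, ENNReal.mul_top (by simp)]
        exact le_top }

/-- The Schwartz function `f` as the element `φ ↦ ∫ f φ dμ` of the dual of the Beurling space. -/
def Beurling.ofSchwartz (μ : Measure V) [μ.IsAddHaarMeasure] (b : Module.Basis ι ℝ V)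
    (s σ : ι → ℝ) (f : 𝓢(V, ℂ)) : StrongDual ℂ (Beurling b s σ) :=
  let L : Beurling b s σ →ₗ[ℂ] ℂ :=
    { toFun := fun φ => ∫ x, f x * φ x ∂μ
      map_add' := fun φ ψ => by
        exact (integral_congr_ae (Eventually.of_forall fun x => mul_add (f x) (φ x) (ψ x))).trans
          (integral_add (integrable_schwartz_mul μ b s σ f φ.2.1 (φ.2.2 1 one_pos))
            (integrable_schwartz_mul μ b s σ f ψ.2.1 (ψ.2.2 1 one_pos)))
      map_smul' := fun c φ => by
        simp only [RingHom.id_apply, smul_eq_mul]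
        rw [← integral_const_mul]
        exact integral_congr_ae (Eventually.of_forall fun x => mul_left_comm (f x) c (φ x)) }
  { toLinearMap := L
    cont := by
      refine WithSeminorms.continuous_of_continuous_comp (norm_withSeminorms ℂ ℂ) L fun _ => ?_
      refine Seminorm.continuous_of_le (p := (normSeminorm ℂ ℂ).comp L)
        (q := (∫ x, ‖f x‖ ∂μ).toNNReal • beurlingSeminorm b s σ ⟨1, one_pos⟩) ?_ fun φ => ?_
      · exact ((beurling_withSeminorms b s σ).continuous_seminorm ⟨1, one_pos⟩).const_smul
          (∫ x, ‖f x‖ ∂μ).toNNReal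
      · refine (norm_integral_schwartz_mul_le μ b s σ f (φ.2.2 1 one_pos)).trans (le_of_eq ?_)
        rw [smul_apply, NNReal.smul_def, smul_eq_mul,
          Real.coe_toNNReal _ (integral_nonneg fun _ => norm_nonneg _)]
        rfl }

theorem Roumieu.ofSchwartz_apply (μ : Measure V) [μ.IsAddHaarMeasure] (b : Module.Basis ι ℝ V)
    (s σ : ι → ℝ) (f : 𝓢(V, ℂ)) (φ : Roumieu b s σ) :
    Roumieu.ofSchwartz μ b s σ f φ = ∫ x, f x * φ x ∂μ := rfl

theorem Beurling.ofSchwartz_apply (μ : Measure V) [μ.IsAddHaarMeasure] (b : Module.Basis ι ℝ V)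
    (s σ : ι → ℝ) (f : 𝓢(V, ℂ)) (φ : Beurling b s σ) :
    Beurling.ofSchwartz μ b s σ f φ = ∫ x, f x * φ x ∂μ := rfl

end ofSchwartz

/-! ### The spaces on `ℝ^d` and on `ℝ^{d₁} × ℝ^{d₂}` -/

/-- The standard basis of `ℝ^d`. -/
def stdBasis (d : ℕ) : Module.Basis (Fin d) ℝ (EuclideanSpace ℝ (Fin d)) :=
  (EuclideanSpace.basisFun (Fin d) ℝ).toBasis

/-- The space `𝒮_s^σ(ℝ^d)`. -/
abbrev Roumieu₁ (d : ℕ) (s σ : ℝ) := Roumieu (stdBasis d) (fun _ => s) (fun _ => σ)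

/-- The space `Σ_s^σ(ℝ^d)`. -/
abbrev Beurling₁ (d : ℕ) (s σ : ℝ) := Beurling (stdBasis d) (fun _ => s) (fun _ => σ)

/-- The space `𝒮_{s₁,s₂}^{σ₁,σ₂}(ℝ^{d₁} × ℝ^{d₂})`. -/
abbrev Roumieu₂ (d₁ d₂ : ℕ) (s₁ s₂ σ₁ σ₂ : ℝ) :=
  Roumieu ((stdBasis d₁).prod (stdBasis d₂))
    (Sum.elim (fun _ => s₁) (fun _ => s₂)) (Sum.elim (fun _ => σ₁) (fun _ => σ₂))

/-- The space `Σ_{s₁,s₂}^{σ₁,σ₂}(ℝ^{d₁} × ℝ^{d₂})`. -/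
abbrev Beurling₂ (d₁ d₂ : ℕ) (s₁ s₂ σ₁ σ₂ : ℝ) :=
  Beurling ((stdBasis d₁).prod (stdBasis d₂))
    (Sum.elim (fun _ => s₁) (fun _ => s₂)) (Sum.elim (fun _ => σ₁) (fun _ => σ₂))

/-- The Schwartz function `f` on `ℝ^d` as the element `φ ↦ ∫ f φ` of `(𝒮_s^σ)'(ℝ^d)`. -/
def Roumieu₁.ofSchwartz (d : ℕ) (s σ : ℝ) (f : 𝓢(EuclideanSpace ℝ (Fin d), ℂ)) :
    StrongDual ℂ (Roumieu₁ d s σ) :=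
  Roumieu.ofSchwartz volume (stdBasis d) (fun _ => s) (fun _ => σ) f

/-- The Schwartz function `f` on `ℝ^d` as the element `φ ↦ ∫ f φ` of `(Σ_s^σ)'(ℝ^d)`. -/
def Beurling₁.ofSchwartz (d : ℕ) (s σ : ℝ) (f : 𝓢(EuclideanSpace ℝ (Fin d), ℂ)) :
    StrongDual ℂ (Beurling₁ d s σ) :=
  Beurling.ofSchwartz volume (stdBasis d) (fun _ => s) (fun _ => σ) f

/-- The element `u` of the dual of a space `X` of test functions is given by the function `F`:
`⟨u, Φ⟩ = ∫ F Φ` for all `Φ` in `X`, with absolutely convergent integrals. -/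
def IsGivenBy {W X : Type*} [MeasureSpace W] [AddCommGroup X] [Module ℂ X] [TopologicalSpace X]
    [FunLike X W ℂ] (u : StrongDual ℂ X) (F : W → ℂ) : Prop :=
  ∀ Φ : X, Integrable (fun w => F w * Φ w) ∧ u Φ = ∫ w, F w * Φ w

end GelfandShilov

/-! ### Lattices, quasi-periodicity and the Zak transform -/

namespace Zak

variable {d : ℕ}

/-- The lattice of all integer combinations of the vectors `e 0, …, e (d - 1)`. -/
def lattice (e : Fin d → EuclideanSpace ℝ (Fin d)) : Submodule ℤ (EuclideanSpace ℝ (Fin d)) :=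
  Submodule.span ℤ (Set.range e)

/-- The dual basis `e'` of `e`, normalized by `⟪e j, e' k⟫ = 2π δ_{jk}`. -/
def dualVec (e : Module.Basis (Fin d) ℝ (EuclideanSpace ℝ (Fin d))) (k : Fin d) :
    EuclideanSpace ℝ (Fin d) :=
  (2 * Real.pi) • (InnerProductSpace.toDual ℝ (EuclideanSpace ℝ (Fin d))).symm
    (LinearMap.toContinuousLinearMap (e.coord k))

theorem inner_dualVec (e : Module.Basis (Fin d) ℝ (EuclideanSpace ℝ (Fin d))) (j k : Fin d) :
    ⟪e j, dualVec e k⟫ = if j = k then 2 * Real.pi else 0 := by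
  rw [real_inner_comm, dualVec, real_inner_smul_left, InnerProductSpace.toDual_symm_apply]
  simp [Finsupp.single_apply]

/-- The Zak transform `(Z_E f)(x, ξ) = ∑_{j ∈ Λ_E} f(x - j) e^{i⟪j, ξ⟫}`. -/
def zak (e : Module.Basis (Fin d) ℝ (EuclideanSpace ℝ (Fin d)))
    (f : 𝓢(EuclideanSpace ℝ (Fin d), ℂ))
    (z : EuclideanSpace ℝ (Fin d) × EuclideanSpace ℝ (Fin d)) : ℂ :=
  ∑' j : lattice e, f (z.1 - j) * Complex.exp (Complex.I * (⟪(j : EuclideanSpace ℝ (Fin d)), z.2⟫ : ℝ))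

/-- The quasi-periodic elements of order `E` in the dual of a space `X` of test functions
on `ℝ^d × ℝ^d`: the functionals `F` with `F(x + k, ξ) = e^{i⟪k, ξ⟫} F(x, ξ)` for `k ∈ Λ_E` and
`F(x, ξ + κ) = F(x, ξ)` for `κ ∈ Λ_E'`. As usual for distributions, `F(x + k, ξ)` acts on `Φ` as
`F` acts on `Φ₁(x, ξ) = Φ(x - k, ξ)`, the product `e^{i⟪k, ξ⟫} F(x, ξ)` acts on `Φ` as `F` acts on
`Φ₂(x, ξ) = e^{i⟪k, ξ⟫} Φ(x, ξ)`, and `F(x, ξ + κ)` acts on `Φ` as `F` acts on `Φ(x, ξ - κ)`. -/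
def quasiPeriodic (e : Module.Basis (Fin d) ℝ (EuclideanSpace ℝ (Fin d)))
    (X : Type*) [AddCommGroup X] [Module ℂ X] [TopologicalSpace X]
    [FunLike X (EuclideanSpace ℝ (Fin d) × EuclideanSpace ℝ (Fin d)) ℂ] :
    Submodule ℂ (StrongDual ℂ X) where
  carrier := {F |
    (∀ k ∈ lattice e, ∀ Φ Φ₁ Φ₂ : X, (∀ x ξ, Φ₁ (x, ξ) = Φ (x - k, ξ)) →
      (∀ x ξ, Φ₂ (x, ξ) = Complex.exp (Complex.I * (⟪k, ξ⟫ : ℝ)) * Φ (x, ξ)) → F Φ₁ = F Φ₂) ∧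
    (∀ κ ∈ lattice (dualVec e), ∀ Φ Φ₁ : X, (∀ x ξ, Φ₁ (x, ξ) = Φ (x, ξ - κ)) → F Φ₁ = F Φ)}
  add_mem' := by
    rintro F G ⟨hF, hF'⟩ ⟨hG, hG'⟩
    refine ⟨fun k hk Φ Φ₁ Φ₂ h₁ h₂ => ?_, fun κ hκ Φ Φ₁ h₁ => ?_⟩
    · simp [hF k hk Φ Φ₁ Φ₂ h₁ h₂, hG k hk Φ Φ₁ Φ₂ h₁ h₂]
    · simp [hF' κ hκ Φ Φ₁ h₁, hG' κ hκ Φ Φ₁ h₁]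
  zero_mem' := ⟨fun _ _ _ _ _ _ _ => rfl, fun _ _ _ _ _ => rfl⟩
  smul_mem' := by
    rintro c F ⟨hF, hF'⟩
    refine ⟨fun k hk Φ Φ₁ Φ₂ h₁ h₂ => ?_, fun κ hκ Φ Φ₁ h₁ => ?_⟩
    · simp [hF k hk Φ Φ₁ Φ₂ h₁ h₂]
    · simp [hF' κ hκ Φ Φ₁ h₁]

end Zak

end

/-! Moved onto test functions, the Zak transform becomes the operator S (`zakAdj`), S Φ(x) = ∑_j ∫
e^{i⟨j,ξ⟩} Φ(x + j, ξ) dξ, and the map of the theorem is the transpose of S. Its values are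
quasi-periodic because S does not distinguish Φ(x - k, ξ) from e^{i⟨k,ξ⟩} Φ(x, ξ), nor Φ(x, ξ - κ)
from Φ(x, ξ). It is a homeomorphism onto the quasi-periodic functionals as soon as S has a
continuous right inverse R with F(R S Φ) = F(Φ) for every quasi-periodic F: the transpose of R is
then the inverse map (`exists_equiv_quasiPeriodic`).

The right inverse is R φ(x, ξ) = v⁻¹ g(x) γ(ξ) ∑_m e^{i⟨m,ξ⟩} φ(x + m), where v is the volume of a
fundamental domain of Λ', and the translates of g by Λ and those of γ by Λ' form partitions of
unity. The identity S R = id is the orthogonality of characters (`zakAdj_zakAdjInv`). For F R S = F,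
cut Φ into the pieces g(x - k) γ(ξ - κ) Φ(x, ξ). Quasi-periodicity of F allows each piece to be
replaced by g(x) γ(ξ) e^{i⟨k,ξ⟩} Φ(x + k, ξ + κ), and by Poisson summation in ξ these add up to R S
Φ (`tsum_zakAdj_mul_char`, `apply_eq_of_mem_quasiPeriodic`).

The windows g and γ have to lie in 𝒮_s^σ and 𝒮_σ^s (or Σ_s^σ and Σ_σ^s). If the space on ℝ^d is
zero, then so is the one on ℝ^{2d}, slice by slice. Otherwise take f ≠ 0 and w = |f|². A multiple of
w, convolved with the indicator of a fundamental domain, is g. The same construction, started from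
the Fourier transform of w, gives γ. The Fourier transform exchanges s and σ if s + σ ≥ 1 (Roumieu)
or s + σ > 1 (Beurling), and for d > 0 these inequalities follow from ∫ w ≠ 0 and ∫ x_i^n ∂_i^n w =
(-1)^n n! ∫ w.

Uniqueness is the density of the Schwartz functions in the strong dual. On a bounded set,
convergence to zero against all Schwartz functions implies convergence to zero in a weaker norm.
Hence a functional is small on those elements of the set on which finitely many Schwartz functionals
are small, and a Hahn-Banach argument makes it uniformly close there to a combination of these
(`exists_schwartz_norm_sub_le`).

All estimates are expressed by the weight `growth`: the norms amount to |∂^β f(x)| ≤ C h^{|β|} β!^σ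
/ growth(x), and the behaviour of `growth` under sums and squares costs only constant factors in h,
which are harmless for both types of spaces. -/

noncomputable section

namespace GelfandShilov

/-! ### Iterated directional derivatives and weights indexed by lists -/

section lists

variable {ι V : Type*} [NormedAddCommGroup V] [NormedSpace ℝ V]

/-- The derivative in the direction of the basis vector `b i`. -/
def dirDeriv (b : Module.Basis ι ℝ V) (i : ι) (f : V → ℂ) (x : V) : ℂ := fderiv ℝ f x (b i)

/-- The iterated derivative in the directions listed in `l`. -/
def listDeriv (b : Module.Basis ι ℝ V) : List ι → (V → ℂ) → V → ℂ
  | [], f => f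
  | i :: l, f => dirDeriv b i (listDeriv b l f)

/-- The product of the coordinates of `x` listed in `l`. -/
def listMono (b : Module.Basis ι ℝ V) (l : List ι) (x : V) : ℝ :=
  (l.map fun i => b.repr x i).prod

variable (b : Module.Basis ι ℝ V)

@[simp] theorem listDeriv_nil (f : V → ℂ) : listDeriv b [] f = f := rfl

theorem listDeriv_cons (i : ι) (l : List ι) (f : V → ℂ) :
    listDeriv b (i :: l) f = dirDeriv b i (listDeriv b l f) := rfl

variable {b}

theorem contDiff_dirDeriv {f : V → ℂ} (hf : ContDiff ℝ ∞ f) (i : ι) :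
    ContDiff ℝ ∞ (dirDeriv b i f) :=
  (hf.fderiv_right (m := ∞) (by simp)).clm_apply contDiff_const

theorem contDiff_listDeriv {f : V → ℂ} (hf : ContDiff ℝ ∞ f) (l : List ι) :
    ContDiff ℝ ∞ (listDeriv b l f) := by
  induction l with
  | nil => exact hf
  | cons i l ih => exact contDiff_dirDeriv ih i

theorem dirDeriv_comm {f : V → ℂ} (hf : ContDiff ℝ ∞ f) (i j : ι) :
    dirDeriv b i (dirDeriv b j f) = dirDeriv b j (dirDeriv b i f) := by
  ext x
  have h2 : IsSymmSndFDerivAt ℝ f x :=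
    (hf.contDiffAt (x := x)).isSymmSndFDerivAt
      (by rw [minSmoothness_of_isRCLikeNormedField]; exact WithTop.coe_le_coe.2 le_top)
  have hd : DifferentiableAt ℝ (fderiv ℝ f) x :=
    ((hf.fderiv_right (m := ∞) (by simp)).differentiable (by simp)) x
  have key (k m : ι) : dirDeriv b k (dirDeriv b m f) x = fderiv ℝ (fderiv ℝ f) x (b k) (b m) := by
    unfold dirDeriv
    rw [fderiv_clm_apply hd (differentiableAt_const _)]
    simp
  rw [key, key, h2.eq]

theorem listDeriv_dirDeriv {f : V → ℂ} (hf : ContDiff ℝ ∞ f) (i : ι) (l : List ι) :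
    listDeriv b l (dirDeriv b i f) = dirDeriv b i (listDeriv b l f) := by
  induction l with
  | nil => rfl
  | cons j l ih => rw [listDeriv_cons, ih, dirDeriv_comm (contDiff_listDeriv hf l), listDeriv_cons]

theorem listDeriv_append (f : V → ℂ) (l l' : List ι) :
    listDeriv b (l ++ l') f = listDeriv b l (listDeriv b l' f) := by
  induction l with
  | nil => rfl
  | cons j l ih => rw [List.cons_append, listDeriv_cons, ih, listDeriv_cons]

/-- Second derivatives are symmetric. This makes lists a substitute for multi-indices, with the
advantage that induction can peel off one derivative at a time. -/
theorem listDeriv_perm {f : V → ℂ} (hf : ContDiff ℝ ∞ f) {l l' : List ι} (h : l.Perm l') :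
    listDeriv b l f = listDeriv b l' f := by
  induction h with
  | nil => rfl
  | cons i _ ih => rw [listDeriv_cons, ih, listDeriv_cons]
  | swap i j l =>
    simp only [listDeriv_cons]
    exact dirDeriv_comm (contDiff_listDeriv hf l) _ _
  | trans _ _ ih1 ih2 => rw [ih1, ih2]

theorem dirDeriv_add {f g : V → ℂ} (hf : ContDiff ℝ ∞ f) (hg : ContDiff ℝ ∞ g) (i : ι) :
    dirDeriv b i (f + g) = dirDeriv b i f + dirDeriv b i g := by
  ext x
  simp only [dirDeriv, Pi.add_apply]
  rw [fderiv_add (hf.differentiable (by simp) x) (hg.differentiable (by simp) x)]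
  rfl

theorem dirDeriv_smul {f : V → ℂ} (hf : ContDiff ℝ ∞ f) (c : ℂ) (i : ι) :
    dirDeriv b i (c • f) = c • dirDeriv b i f := by
  ext x
  simp only [dirDeriv, Pi.smul_apply]
  rw [fderiv_const_smul (hf.differentiable (by simp) x)]
  rfl

theorem dirDeriv_mul {f g : V → ℂ} (hf : ContDiff ℝ ∞ f) (hg : ContDiff ℝ ∞ g) (i : ι) :
    dirDeriv b i (f * g) = dirDeriv b i f * g + f * dirDeriv b i g := by
  ext x
  simp only [dirDeriv, Pi.add_apply, Pi.mul_apply]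
  rw [fderiv_mul (hf.differentiable (by simp) x) (hg.differentiable (by simp) x)]
  simp [mul_comm, add_comm]

theorem listDeriv_add {f g : V → ℂ} (hf : ContDiff ℝ ∞ f) (hg : ContDiff ℝ ∞ g) (l : List ι) :
    listDeriv b l (f + g) = listDeriv b l f + listDeriv b l g := by
  induction l with
  | nil => rfl
  | cons i l ih =>
    simp only [listDeriv_cons]
    rw [ih, dirDeriv_add (contDiff_listDeriv hf l) (contDiff_listDeriv hg l)]

theorem listDeriv_smul {f : V → ℂ} (hf : ContDiff ℝ ∞ f) (c : ℂ) (l : List ι) :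
    listDeriv b l (c • f) = c • listDeriv b l f := by
  induction l with
  | nil => rfl
  | cons i l ih =>
    simp only [listDeriv_cons]
    rw [ih, dirDeriv_smul (contDiff_listDeriv hf l)]

theorem listDeriv_comp_add_right (f : V → ℂ) (a : V) (l : List ι) :
    listDeriv b l (fun x => f (x + a)) = fun x => listDeriv b l f (x + a) := by
  induction l with
  | nil => rfl
  | cons i l ih =>
    ext x
    rw [listDeriv_cons, ih, dirDeriv, fderiv_comp_add_right]
    rfl

@[simp] theorem listMono_nil (x : V) : listMono b [] x = 1 := rfl

theorem listMono_cons (i : ι) (l : List ι) (x : V) :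
    listMono b (i :: l) x = b.repr x i * listMono b l x := by simp [listMono]

theorem listMono_append (l l' : List ι) (x : V) :
    listMono b (l ++ l') x = listMono b l x * listMono b l' x := by simp [listMono]

theorem listMono_neg (l : List ι) (x : V) : |listMono b l (-x)| = |listMono b l x| := by
  induction l with
  | nil => rfl
  | cons i l ih => simp [listMono_cons, abs_mul, ih]

theorem prod_map_eq_prod_pow_count {M : Type*} [CommMonoid M] [Fintype ι] [DecidableEq ι]
    (l : List ι) (f : ι → M) : (l.map f).prod = ∏ i, f i ^ l.count i := by
  rw [Finset.prod_list_map_count]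
  refine Finset.prod_subset (Finset.subset_univ _) fun i _ hi => ?_
  rw [List.count_eq_zero_of_not_mem (by simpa using hi), pow_zero]

section weights

variable [Fintype ι] [DecidableEq ι]

/-- The weight `∏ i, (m i)!^{s i}`, where `m i` is the multiplicity of `i` in `l`. -/
def facWeight (s : ι → ℝ) (l : List ι) : ℝ := ∏ i, ((l.count i).factorial : ℝ) ^ s i

variable {s : ι → ℝ}

theorem facWeight_pos (s : ι → ℝ) (l : List ι) : 0 < facWeight s l :=
  Finset.prod_pos fun i _ => Real.rpow_pos_of_pos (by exact_mod_cast Nat.factorial_pos _) _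

@[simp] theorem facWeight_nil (s : ι → ℝ) : facWeight s [] = 1 := by simp [facWeight]

theorem facWeight_perm {l l' : List ι} (h : l.Perm l') : facWeight s l = facWeight s l' := by
  simp only [facWeight, h.count_eq]

/-- a! c! divides (a + c)!. -/
theorem facWeight_mul_le (hs : ∀ i, 0 < s i) (l l' : List ι) :
    facWeight s l * facWeight s l' ≤ facWeight s (l ++ l') := by
  unfold facWeight
  rw [← Finset.prod_mul_distrib]
  refine Finset.prod_le_prod (fun i _ => by positivity) fun i _ => ?_
  rw [← Real.mul_rpow (by positivity) (by positivity), List.count_append]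
  refine Real.rpow_le_rpow (by positivity) ?_ (hs i).le
  exact_mod_cast Nat.le_of_dvd (Nat.factorial_pos _) (Nat.factorial_mul_factorial_dvd_factorial_add _ _)

/-- The constant `2^{∑ s i}` in `facWeight_append_le`. -/
def dbl (s : ι → ℝ) : ℝ := 2 ^ (∑ i, s i)

omit [DecidableEq ι] in
theorem one_le_dbl (hs : ∀ i, 0 < s i) : 1 ≤ dbl s :=
  Real.one_le_rpow one_le_two (Finset.sum_nonneg fun i _ => (hs i).le)

/-- (a + c)! ≤ 2^{a+c} a! c!, and each multiplicity is at most the length of the list. -/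
theorem facWeight_append_le (hs : ∀ i, 0 < s i) (l l' : List ι) :
    facWeight s (l ++ l') ≤ dbl s ^ (l.length + l'.length) * (facWeight s l * facWeight s l') := by
  have hlen : dbl s ^ (l.length + l'.length) =
      ∏ i, ((2 : ℝ) ^ (l.length + l'.length)) ^ s i := by
    unfold dbl
    rw [← Real.rpow_natCast, ← Real.rpow_mul two_pos.le, mul_comm, Real.rpow_mul two_pos.le,
      Real.rpow_natCast, Real.rpow_sum_of_pos (by positivity)]
  rw [hlen]
  unfold facWeight
  rw [← Finset.prod_mul_distrib, ← Finset.prod_mul_distrib]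
  refine Finset.prod_le_prod (fun i _ => by positivity) fun i _ => ?_
  rw [← Real.mul_rpow (by positivity) (by positivity),
    ← Real.mul_rpow (by positivity) (by positivity), List.count_append]
  refine Real.rpow_le_rpow (by positivity) ?_ (hs i).le
  have h1 : ((l.count i + l'.count i).factorial : ℝ) ≤
      2 ^ (l.count i + l'.count i) * ((l.count i).factorial * (l'.count i).factorial) := by
    rw [← Nat.add_choose_mul_factorial_mul_factorial (l.count i) (l'.count i)]
    push_cast
    rw [mul_assoc]
    gcongr
    exact_mod_cast Nat.choose_le_two_pow _ _
  refine h1.trans ?_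
  gcongr
  · exact one_le_two
  · exact List.count_le_length
  · exact List.count_le_length

end weights

end lists

/-! ### The decay weight and its submultiplicativity -/

section growth

variable {ι V : Type*} [NormedAddCommGroup V] [NormedSpace ℝ V] [Fintype ι] [DecidableEq ι]
  {b : Module.Basis ι ℝ V} {s σ : ι → ℝ} {h : ℝ}

/-- The weight function `sup |x^α| / (h^{|α|} α!^s)`, which measures the decay of the elements of
the Gelfand-Shilov spaces. -/
def growth (b : Module.Basis ι ℝ V) (s : ι → ℝ) (h : ℝ) (x : V) : ℝ :=
  ⨆ l : List ι, |listMono b l x| / (h ^ l.length * facWeight s l)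

/-- The quotient is the s-th power of (t^{1/s})^n / n!, a term of an exponential series. Hence the
supremum in `growth` is finite. -/
theorem exists_pow_div_factorial_rpow_le {s : ℝ} (hs : 0 < s) {t : ℝ} (ht : 0 ≤ t) :
    ∃ B : ℝ, ∀ n : ℕ, t ^ n / (n.factorial : ℝ) ^ s ≤ B := by
  refine ⟨Real.exp (t ^ s⁻¹) ^ s, fun n => ?_⟩
  have h1 : t ^ n / (n.factorial : ℝ) ^ s = ((t ^ s⁻¹) ^ n / n.factorial) ^ s := by
    rw [Real.div_rpow (by positivity) (by positivity), ← Real.rpow_natCast, ← Real.rpow_natCast,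
      ← Real.rpow_mul (by positivity), ← Real.rpow_mul (by positivity), mul_comm (n : ℝ), ← mul_assoc,
      inv_mul_cancel₀ hs.ne', one_mul]
  rw [h1]
  exact Real.rpow_le_rpow (by positivity) (Real.pow_div_factorial_le_exp _ (by positivity) n) hs.le

theorem bddAbove_growth (hs : ∀ i, 0 < s i) (hh : 0 < h) (x : V) :
    BddAbove (Set.range fun l : List ι => |listMono b l x| / (h ^ l.length * facWeight s l)) := by
  choose B hB using fun i => exists_pow_div_factorial_rpow_le (hs i)
    (t := |b.repr x i| / h) (by positivity)
  refine ⟨∏ i, B i, ?_⟩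
  rintro _ ⟨l, rfl⟩
  have h1 : |listMono b l x| = ∏ i, |b.repr x i| ^ l.count i := by
    rw [listMono, prod_map_eq_prod_pow_count, Finset.abs_prod]
    simp only [abs_pow]
  have h2 : h ^ l.length = ∏ i, h ^ l.count i := by
    rw [← prod_map_eq_prod_pow_count l fun _ => h]; simp
  simp only [h1, h2, facWeight]
  rw [← Finset.prod_mul_distrib, ← Finset.prod_div_distrib]
  refine Finset.prod_le_prod (fun i _ => by positivity) fun i _ => ?_
  refine le_trans (le_of_eq ?_) (hB i (l.count i))
  rw [div_pow, div_div]

theorem listMono_le (hs : ∀ i, 0 < s i) (hh : 0 < h) (l : List ι) (x : V) :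
    |listMono b l x| ≤ h ^ l.length * facWeight s l * growth b s h x := by
  have := facWeight_pos s l
  rw [← div_le_iff₀' (by positivity)]
  exact le_ciSup (bddAbove_growth hs hh x) l

theorem growth_le (hh : 0 < h) {x : V} {M : ℝ}
    (hM : ∀ l, |listMono b l x| ≤ h ^ l.length * facWeight s l * M) : growth b s h x ≤ M := by
  refine ciSup_le fun l => ?_
  have := facWeight_pos s l
  rw [div_le_iff₀' (by positivity)]
  exact hM l

theorem one_le_growth (hs : ∀ i, 0 < s i) (hh : 0 < h) (x : V) : 1 ≤ growth b s h x := by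
  simpa using listMono_le (b := b) hs hh [] x

theorem growth_pos (hs : ∀ i, 0 < s i) (hh : 0 < h) (x : V) : 0 < growth b s h x :=
  one_pos.trans_le (one_le_growth hs hh x)

theorem growth_anti (hs : ∀ i, 0 < s i) {h' : ℝ} (hh : 0 < h) (hle : h ≤ h') (x : V) :
    growth b s h' x ≤ growth b s h x := by
  refine growth_le (hh.trans_le hle) fun l => (listMono_le hs hh l x).trans ?_
  have := facWeight_pos s l
  have := growth_pos (b := b) hs hh x
  gcongr

theorem growth_neg (x : V) : growth b s h (-x) = growth b s h x := by
  simp only [growth, listMono_neg]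

/-- A product of |l| coordinates of x + y multiplies out to 2^{|l|} products of coordinates of x and
of y, whence the factor 2 in the parameter. -/
theorem growth_add_le (hs : ∀ i, 0 < s i) (hh : 0 < h) (x y : V) :
    growth b s (2 * h) (x + y) ≤ growth b s h x * growth b s h y := by
  -- The lists p and q collect the coordinates already assigned to x and to y. The multiplicities in
  -- l ++ (p ++ q) do not change when an entry of l moves to p or q, so the factorial weight is the
  -- same for all terms.
  have key (l : List ι) : ∀ p q : List ι,
      |listMono b l (x + y) * (listMono b p x * listMono b q y)| ≤
      (2 * h) ^ l.length * h ^ (p.length + q.length) * facWeight s (l ++ (p ++ q)) *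
        (growth b s h x * growth b s h y) := by
    induction l with
    | nil =>
      intro p q
      have h1 := listMono_le (b := b) hs hh p x
      have h2 := listMono_le (b := b) hs hh q y
      have hx := growth_pos (b := b) hs hh x
      have hy := growth_pos (b := b) hs hh y
      have hp := facWeight_pos s p
      rw [listMono_nil, one_mul, abs_mul]
      refine (mul_le_mul h1 h2 (abs_nonneg _) (by positivity)).trans ?_
      have h3 := facWeight_mul_le hs p q
      calc _ = h ^ (p.length + q.length) * (facWeight s p * facWeight s q) *
            (growth b s h x * growth b s h y) := by ring
        _ ≤ h ^ (p.length + q.length) * facWeight s (p ++ q) *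
            (growth b s h x * growth b s h y) := by gcongr
        _ = _ := by simp
    | cons i l ih =>
      intro p q
      have h1 := ih (i :: p) q
      have h2 := ih p (i :: q)
      have e : listMono b (i :: l) (x + y) * (listMono b p x * listMono b q y) =
          listMono b l (x + y) * (listMono b (i :: p) x * listMono b q y) +
          listMono b l (x + y) * (listMono b p x * listMono b (i :: q) y) := by
        simp only [listMono_cons, map_add, Finsupp.add_apply]; ring
      have w1 : facWeight s (l ++ (i :: p ++ q)) = facWeight s (i :: l ++ (p ++ q)) :=
        facWeight_perm (by simp)
      have w2 : facWeight s (l ++ (p ++ i :: q)) = facWeight s (i :: l ++ (p ++ q)) :=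
        facWeight_perm (by
          rw [← List.append_assoc, ← List.append_assoc, List.cons_append, List.cons_append]
          exact List.perm_middle)
      rw [e]
      refine (abs_add_le _ _).trans ((add_le_add h1 h2).trans (le_of_eq ?_))
      rw [w1, w2]
      simp only [List.length_cons]
      ring
  refine growth_le (by positivity) fun l => ?_
  simpa using key l [] []

/-- The square of x^α is x^{2α}, and (2α)!^s exceeds α!^{2s} by at most a geometric factor.
Enlarging h by `dbl s` thus provides a second copy of the weight. -/
theorem growth_sq_le (hs : ∀ i, 0 < s i) (hh : 0 < h) (x : V) :
    growth b s (dbl s * h) x * growth b s (dbl s * h) x ≤ growth b s h x := by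
  have hg := growth_pos (b := b) hs hh x
  have hK := one_le_dbl hs
  have hK0 : 0 < dbl s := one_pos.trans_le hK
  rw [← sq]
  refine (Real.le_sqrt' (growth_pos hs (by positivity) x)).1 ?_
  refine growth_le (by positivity) fun l => ?_
  have hl := facWeight_pos s l
  refine abs_le_of_sq_le_sq ?_ (by positivity)
  rw [mul_pow, Real.sq_sqrt hg.le, sq, ← listMono_append]
  refine (le_abs_self _).trans ((listMono_le hs hh (l ++ l) x).trans ?_)
  have := facWeight_append_le hs l l
  calc _ ≤ h ^ (l ++ l).length * (dbl s ^ (l.length + l.length) * (facWeight s l * facWeight s l)) *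
        growth b s h x := by gcongr
    _ = _ := by simp only [List.length_append]; ring

/-- The weight at x is split into two copies: one is combined with the weight at y into the weight
at x + y, the other remains. When one of the vectors runs through a lattice, this gives decay and
summability simultaneously. -/
theorem growth_split (hs : ∀ i, 0 < s i) (hh : 0 < h) (x y : V) :
    growth b s (dbl s * h) x * growth b s (2 * (dbl s * h)) (x + y) ≤
      growth b s h x * growth b s h y := by
  have hK := one_le_dbl hs
  have hK0 : 0 < dbl s := one_pos.trans_le hK
  have h1 := growth_add_le (b := b) hs (h := dbl s * h) (by positivity) x y
  have h2 := growth_sq_le (b := b) hs hh x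
  have h3 := growth_anti (b := b) hs hh (le_mul_of_one_le_left hh.le hK) y
  have p1 := growth_pos (b := b) hs (h := dbl s * h) (by positivity) x
  have p2 := growth_pos (b := b) hs (h := dbl s * h) (by positivity) y
  have p3 := growth_pos (b := b) hs hh x
  calc _ ≤ growth b s (dbl s * h) x * (growth b s (dbl s * h) x * growth b s (dbl s * h) y) := by
        gcongr
    _ = (growth b s (dbl s * h) x * growth b s (dbl s * h) x) * growth b s (dbl s * h) y := by ring
    _ ≤ _ := by gcongr

/-- Lists of length at most one control 1 + ‖x‖, and `growth_sq_le` converts every further power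
into a factor `dbl s` in h. -/
theorem exists_one_add_norm_pow_le (hs : ∀ i, 0 < s i) (N : ℕ) : ∀ {h : ℝ}, 0 < h →
    ∃ C : ℝ, 0 < C ∧ ∀ x : V, (1 + ‖x‖) ^ N ≤ C * growth b s h x := by
  have one {h : ℝ} (hh : 0 < h) : ∃ C : ℝ, 0 < C ∧ ∀ x : V, 1 + ‖x‖ ≤ C * growth b s h x := by
    refine ⟨1 + ∑ i, h * ‖b i‖, by positivity, fun x => ?_⟩
    have h1 : ‖x‖ ≤ ∑ i, h * ‖b i‖ * growth b s h x := by
      conv_lhs => rw [← b.sum_repr x]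
      refine (norm_sum_le _ _).trans (Finset.sum_le_sum fun i _ => ?_)
      have := listMono_le (b := b) hs hh [i] x
      have w : facWeight s [i] = 1 := by
        unfold facWeight
        refine Finset.prod_eq_one fun j _ => ?_
        rw [Nat.factorial_eq_one.2, Nat.cast_one, Real.one_rpow]
        exact List.count_le_length
      rw [w] at this
      rw [norm_smul, Real.norm_eq_abs]
      simp [listMono] at this
      calc _ ≤ h * growth b s h x * ‖b i‖ := by gcongr
        _ = _ := by ring
    rw [add_mul, one_mul, Finset.sum_mul]
    exact add_le_add (one_le_growth hs hh x) h1
  induction N with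
  | zero => exact fun hh => ⟨1, one_pos, fun x => by simpa using one_le_growth hs hh x⟩
  | succ N ih =>
    intro h hh
    have hK0 : 0 < dbl s := one_pos.trans_le (one_le_dbl hs)
    obtain ⟨C, hC, hx⟩ := ih (h := dbl s * h) (by positivity)
    obtain ⟨C', hC', hx'⟩ := one (h := dbl s * h) (by positivity)
    refine ⟨C * C', by positivity, fun x => ?_⟩
    have p1 := growth_pos (b := b) hs (h := dbl s * h) (by positivity) x
    calc _ = (1 + ‖x‖) ^ N * (1 + ‖x‖) := pow_succ _ _
      _ ≤ (C * growth b s (dbl s * h) x) * (C' * growth b s (dbl s * h) x) :=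
        mul_le_mul (hx x) (hx' x) (by positivity) (by positivity)
      _ = C * C' * (growth b s (dbl s * h) x * growth b s (dbl s * h) x) := by ring
      _ ≤ _ := by gcongr; exact growth_sq_le hs hh x

end growth

/-! ### Pointwise derivative bounds and the Gelfand-Shilov norms -/

section bounds

variable {ι V : Type*} [NormedAddCommGroup V] [NormedSpace ℝ V] [Fintype ι] [DecidableEq ι]
  {b : Module.Basis ι ℝ V} {s σ : ι → ℝ} {h h' : ℝ}

/-- The bound `|∂^β f(x)| ≤ A h^{|β|} β!^σ` for all `β`. -/
def DerivBound (b : Module.Basis ι ℝ V) (σ : ι → ℝ) (h A : ℝ) (f : V → ℂ) (x : V) : Prop :=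
  ∀ l : List ι, ‖listDeriv b l f x‖ ≤ A * (h ^ l.length * facWeight σ l)

/-- The bound `|x^α ∂^β f(x)| ≤ C h^{|α+β|} α!^s β!^σ` for all `α`, `β` and `x`. -/
def HasGSBound (b : Module.Basis ι ℝ V) (s σ : ι → ℝ) (h C : ℝ) (f : V → ℂ) : Prop :=
  ∀ x, DerivBound b σ h (C / growth b s h x) f x

theorem DerivBound.nonneg {A : ℝ} {f : V → ℂ} {x : V} (hf : DerivBound b σ h A f x) : 0 ≤ A := by
  simpa using (norm_nonneg _).trans (hf [])

theorem DerivBound.mono {A A' : ℝ} {f : V → ℂ} {x : V} (hf : DerivBound b σ h A f x) (hh : 0 ≤ h)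
    (hle : h ≤ h') (hA : A ≤ A') : DerivBound b σ h' A' f x := fun l => by
  have := facWeight_pos σ l
  have := hf.nonneg.trans hA
  exact (hf l).trans (by gcongr)

/-- By the Leibniz rule the powers of h and h' add up to the binomial expansion of (h + h')^{|β|},
and the factorials are absorbed by `facWeight_mul_le`. -/
theorem DerivBound.mul (hσ : ∀ i, 0 < σ i) {A B : ℝ} {f g : V → ℂ} {x : V}
    (hf : DerivBound b σ h A f x) (hg : DerivBound b σ h' B g x) (hh : 0 ≤ h) (hh' : 0 ≤ h')
    (hfs : ContDiff ℝ ∞ f) (hgs : ContDiff ℝ ∞ g) :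
    DerivBound b σ (h + h') (A * B) (f * g) x := by
  have hA := hf.nonneg
  have hB := hg.nonneg
  -- The lists p and q are the derivatives which have already fallen on f and on g; the
  -- multiplicities in l ++ (p ++ q) stay constant.
  have key (l : List ι) : ∀ p q : List ι,
      ‖listDeriv b l (listDeriv b p f * listDeriv b q g) x‖ ≤
      A * B * (h ^ p.length * h' ^ q.length * (h + h') ^ l.length *
        facWeight σ (l ++ (p ++ q))) := by
    induction l with
    | nil =>
      intro p q
      have hp := facWeight_pos σ p
      have h3 := facWeight_mul_le hσ p q
      rw [listDeriv_nil, Pi.mul_apply, norm_mul]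
      calc _ ≤ (A * (h ^ p.length * facWeight σ p)) * (B * (h' ^ q.length * facWeight σ q)) :=
            mul_le_mul (hf p) (hg q) (norm_nonneg _) (by positivity)
        _ = A * B * (h ^ p.length * h' ^ q.length * (facWeight σ p * facWeight σ q)) := by ring
        _ ≤ A * B * (h ^ p.length * h' ^ q.length * (facWeight σ (p ++ q))) := by gcongr
        _ = _ := by simp
    | cons i l ih =>
      intro p q
      have cp := contDiff_listDeriv (b := b) hfs p
      have cq := contDiff_listDeriv (b := b) hgs q
      have e : listDeriv b (i :: l) (listDeriv b p f * listDeriv b q g) =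
          listDeriv b l (listDeriv b (i :: p) f * listDeriv b q g) +
          listDeriv b l (listDeriv b p f * listDeriv b (i :: q) g) := by
        rw [listDeriv_cons, ← listDeriv_dirDeriv (f := listDeriv b p f * listDeriv b q g) (cp.mul cq),
          dirDeriv_mul cp cq]
        exact listDeriv_add ((contDiff_dirDeriv cp i).mul cq) (cp.mul (contDiff_dirDeriv cq i)) l
      have w1 : facWeight σ (l ++ (i :: p ++ q)) = facWeight σ (i :: l ++ (p ++ q)) :=
        facWeight_perm (by simp)
      have w2 : facWeight σ (l ++ (p ++ i :: q)) = facWeight σ (i :: l ++ (p ++ q)) :=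
        facWeight_perm (by
          rw [← List.append_assoc, ← List.append_assoc, List.cons_append, List.cons_append]
          exact List.perm_middle)
      rw [e, Pi.add_apply]
      refine (norm_add_le _ _).trans ((add_le_add (ih _ _) (ih _ _)).trans (le_of_eq ?_))
      rw [w1, w2]
      simp only [List.length_cons]
      ring
  intro l
  simpa using key l [] []

theorem DerivBound.comp_add {A : ℝ} {f : V → ℂ} {x a : V} (hf : DerivBound b σ h A f (x + a)) :
    DerivBound b σ h A (fun x => f (x + a)) x := fun l => by
  rw [listDeriv_comp_add_right]
  exact hf l

theorem perm_indexList (β : ι → ℕ) (i : ι) : (indexList β).count i = β i := by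
  unfold indexList
  rw [List.count_flatMap]
  have : (List.count i ∘ fun j => List.replicate (β j) j) = fun j => if j = i then β j else 0 := by
    ext j
    simp [List.count_replicate]
  rw [this, Finset.sum_map_toList]
  simp

theorem exists_indexList_perm (l : List ι) : (indexList fun i => l.count i).Perm l :=
  List.perm_iff_count.2 fun i => perm_indexList _ i

omit [DecidableEq ι] in
theorem partialDeriv_eq_listDeriv {f : V → ℂ} (hf : ContDiff ℝ ∞ f) (β : ι → ℕ) :
    partialDeriv b β f = listDeriv b (indexList β) f := by
  have key (l : List ι) (x : V) :
      iteratedFDeriv ℝ l.length f x (fun j => b (l.get j)) = listDeriv b l f x := by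
    induction l generalizing x with
    | nil => simp
    | cons i l ih =>
      rw [listDeriv_cons, dirDeriv]
      have hd : DifferentiableAt ℝ (iteratedFDeriv ℝ l.length f) x :=
        (hf.differentiable_iteratedFDeriv (m := l.length) (by exact_mod_cast WithTop.coe_lt_top _)) x
      have e : listDeriv b l f =
          fun y => iteratedFDeriv ℝ l.length f y (fun j => b (l.get j)) := by
        ext y; exact (ih y).symm
      rw [e]
      have := fderiv_continuousMultilinear_apply_const_apply hd (fun j => b (l.get j)) (b i)
      rw [this]
      change iteratedFDeriv ℝ (l.length + 1) f x _ = _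
      rw [iteratedFDeriv_succ_apply_left]
      rfl
  ext x
  exact key _ x

theorem norm_monomial_mul_partialDeriv {f : V → ℂ} (hf : ContDiff ℝ ∞ f) (α β : ι → ℕ) (x : V) :
    ‖(monomial b α x : ℂ) * partialDeriv b β f x‖ =
      |listMono b (indexList α) x| * ‖listDeriv b (indexList β) f x‖ := by
  rw [norm_mul, partialDeriv_eq_listDeriv hf, Complex.norm_real, Real.norm_eq_abs]
  congr 2
  simp [monomial, listMono, prod_map_eq_prod_pow_count, perm_indexList]

theorem weight_eq (α β : ι → ℕ) : weight s σ h α β =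
    h ^ (indexList α).length * facWeight s (indexList α) *
      (h ^ (indexList β).length * facWeight σ (indexList β)) := by
  have hl (β : ι → ℕ) : (indexList β).length = ∑ i, β i := by
    simp [indexList, List.length_flatMap]
  simp only [weight, facWeight, perm_indexList, hl, Finset.prod_mul_distrib, Finset.sum_add_distrib,
    pow_add]
  ring

/-- For fixed x and β the supremum over α is the weight `growth` at x. This replaces the monomials
by division by one function of x. -/
theorem gsNorm_le_iff (hs : ∀ i, 0 < s i) (hh : 0 < h) {f : V → ℂ} (hf : ContDiff ℝ ∞ f) {C : ℝ}
    (hC : 0 ≤ C) : gsNorm b s σ h f ≤ ENNReal.ofReal C ↔ HasGSBound b s σ h C f := by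
  have h1 : gsNorm b s σ h f ≤ ENNReal.ofReal C ↔ ∀ (l m : List ι) (x : V),
      |listMono b l x| * ‖listDeriv b m f x‖ ≤
        C * (h ^ l.length * facWeight s l * (h ^ m.length * facWeight σ m)) := by
    simp only [gsNorm, iSup_le_iff]
    have e (α β : ι → ℕ) (x : V) : (ENNReal.ofReal (‖(monomial b α x : ℂ) * partialDeriv b β f x‖ /
        weight s σ h α β) ≤ ENNReal.ofReal C) ↔
        |listMono b (indexList α) x| * ‖listDeriv b (indexList β) f x‖ ≤
        C * (h ^ (indexList α).length * facWeight s (indexList α) *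
          (h ^ (indexList β).length * facWeight σ (indexList β))) := by
      rw [ENNReal.ofReal_le_ofReal_iff hC, div_le_iff₀ (weight_pos s σ hh α β),
        norm_monomial_mul_partialDeriv hf, weight_eq]
    simp only [e]
    refine ⟨fun H l m x => ?_, fun H α β x => H _ _ x⟩
    have := H (fun i => l.count i) (fun i => m.count i) x
    have p1 := exists_indexList_perm l
    have p2 := exists_indexList_perm m
    rw [listDeriv_perm hf p2, facWeight_perm p1, facWeight_perm p2, p1.length_eq, p2.length_eq] at this
    rwa [show listMono b (indexList fun i => l.count i) x = listMono b l x from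
      (p1.map _).prod_eq] at this
  rw [h1]
  constructor
  · intro H x m
    have hg := growth_pos (b := b) hs hh x
    have hm := facWeight_pos σ m
    rw [div_mul_eq_mul_div, le_div_iff₀ hg]
    rcases (norm_nonneg (listDeriv b m f x)).eq_or_lt with h0 | h0
    · rw [← h0, zero_mul]; positivity
    rw [← le_div_iff₀' h0]
    refine growth_le hh fun l => ?_
    rw [← mul_div_assoc, le_div_iff₀ h0]
    exact (H l m x).trans (le_of_eq (by ring))
  · intro H l m x
    have hg := growth_pos (b := b) hs hh x
    have hm := facWeight_pos σ m
    have hl := facWeight_pos s l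
    calc _ ≤ (h ^ l.length * facWeight s l * growth b s h x) *
          (C / growth b s h x * (h ^ m.length * facWeight σ m)) :=
          mul_le_mul (listMono_le hs hh l x) (H x m) (norm_nonneg _) (by positivity)
      _ = _ := by field_simp

theorem gsNorm_lt_top_iff (hs : ∀ i, 0 < s i) (hh : 0 < h) {f : V → ℂ} (hf : ContDiff ℝ ∞ f) :
    gsNorm b s σ h f < ⊤ ↔ ∃ C, 0 ≤ C ∧ HasGSBound b s σ h C f := by
  constructor
  · intro H
    refine ⟨(gsNorm b s σ h f).toReal, ENNReal.toReal_nonneg, ?_⟩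
    rw [← gsNorm_le_iff hs hh hf ENNReal.toReal_nonneg, ENNReal.ofReal_toReal H.ne]
  · rintro ⟨C, hC, H⟩
    exact ((gsNorm_le_iff hs hh hf hC).2 H).trans_lt ENNReal.ofReal_lt_top

theorem HasGSBound.mono (hs : ∀ i, 0 < s i) {C C' : ℝ} {f : V → ℂ} (hf : HasGSBound b s σ h C f)
    (hh : 0 < h) (hle : h ≤ h') (hC : C ≤ C') (hC0 : 0 ≤ C) : HasGSBound b s σ h' C' f := fun x => by
  have h1 := growth_anti (b := b) hs hh hle x
  have h2 := growth_pos (b := b) hs (hh.trans_le hle) x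
  have h3 := hC0.trans hC
  exact (hf x).mono hh.le hle (by gcongr)

theorem HasGSBound.norm_le {C : ℝ} {f : V → ℂ} (hf : HasGSBound b s σ h C f)
    (x : V) : ‖f x‖ ≤ C / growth b s h x := by
  simpa using hf x []

end bounds

/-! ### Integrals and series of smooth functions with derivative bounds -/

section superposition

variable {ι V : Type*} [NormedAddCommGroup V] [NormedSpace ℝ V] [Fintype ι]
  {b : Module.Basis ι ℝ V}

theorem fderiv_eq_sum_dirDeriv [FiniteDimensional ℝ V] (f : V → ℂ) (x : V) :
    fderiv ℝ f x = ∑ i, (LinearMap.toContinuousLinearMap (b.coord i)).smulRight (dirDeriv b i f x) := by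
  ext v
  conv_lhs => rw [← b.sum_repr v, map_sum]
  simp [dirDeriv]

/-- Differentiation under the integral sign, to all orders. -/
theorem contDiff_integral_and_listDeriv [FiniteDimensional ℝ V] {T : Type*} [MeasurableSpace T]
    {μ : Measure T} {F : T → V → ℂ} (hF : ∀ t, ContDiff ℝ ∞ (F t)) {k : List ι → T → ℝ}
    (hk : ∀ l, Integrable (k l) μ) (hle : ∀ l t x, ‖listDeriv b l (F t) x‖ ≤ k l t)
    (hm : ∀ l x, AEStronglyMeasurable (fun t => listDeriv b l (F t) x) μ) :
    ContDiff ℝ ∞ (fun x => ∫ t, F t x ∂μ) ∧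
      ∀ l x, listDeriv b l (fun x => ∫ t, F t x ∂μ) x = ∫ t, listDeriv b l (F t) x ∂μ := by
  -- The family G is arbitrary, so that the statement can be applied again to the derivatives of F.
  have step (G : T → V → ℂ) (hG : ∀ t, ContDiff ℝ ∞ (G t)) (k : List ι → T → ℝ)
      (hk : ∀ l, Integrable (k l) μ) (hle : ∀ l t x, ‖listDeriv b l (G t) x‖ ≤ k l t)
      (hm : ∀ l x, AEStronglyMeasurable (fun t => listDeriv b l (G t) x) μ) (x : V) :
      HasFDerivAt (fun x => ∫ t, G t x ∂μ)
        (∑ i, (LinearMap.toContinuousLinearMap (b.coord i)).smulRight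
          (∫ t, dirDeriv b i (G t) x ∂μ)) x := by
    have hi (i : ι) (x : V) : Integrable (fun t => dirDeriv b i (G t) x) μ :=
      (hk [i]).mono' (hm [i] x) (Eventually.of_forall fun t => hle [i] t x)
    have e : (∑ i, (LinearMap.toContinuousLinearMap (b.coord i)).smulRight
          (∫ t, dirDeriv b i (G t) x ∂μ)) = ∫ t, fderiv ℝ (G t) x ∂μ := by
      simp only [fderiv_eq_sum_dirDeriv (b := b)]
      have hi' (i : ι) : Integrable (fun t => (LinearMap.toContinuousLinearMap (b.coord i)).smulRight
          (dirDeriv b i (G t) x)) μ :=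
        (ContinuousLinearMap.smulRightL ℝ V ℂ
          (LinearMap.toContinuousLinearMap (b.coord i))).integrable_comp (hi i x)
      rw [integral_finsetSum _ fun i _ => hi' i]
      refine Finset.sum_congr rfl fun i _ => ?_
      exact ((ContinuousLinearMap.smulRightL ℝ V ℂ
          (LinearMap.toContinuousLinearMap (b.coord i))).integral_comp_comm (hi i x)).symm
    rw [e]
    refine hasFDerivAt_integral_of_dominated_of_fderiv_le (s := Set.univ)
      (bound := fun t => ∑ i, ‖LinearMap.toContinuousLinearMap (b.coord i)‖ * k [i] t)
      univ_mem (Eventually.of_forall fun x => hm [] x) ?_ ?_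
      (Eventually.of_forall fun t x _ => ?_) ?_
      (Eventually.of_forall fun t x _ => ((hG t).differentiable (by simp) x).hasFDerivAt)
    · exact (hk []).mono' (hm [] x) (Eventually.of_forall fun t => hle [] t x)
    · simp only [fderiv_eq_sum_dirDeriv (b := b)]
      refine Finset.aestronglyMeasurable_fun_sum _ fun i _ => ?_
      exact ((ContinuousLinearMap.smulRightL ℝ V ℂ
          (LinearMap.toContinuousLinearMap (b.coord i))).continuous.comp_aestronglyMeasurable
          (hm [i] x))
    · rw [fderiv_eq_sum_dirDeriv (b := b)]
      refine (norm_sum_le _ _).trans (Finset.sum_le_sum fun i _ => ?_)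
      rw [ContinuousLinearMap.norm_smulRight_apply]
      gcongr
      exact hle [i] t x
    · exact integrable_finsetSum _ fun i _ => (hk [i]).const_mul _
  have stepD (G : T → V → ℂ) (hG : ∀ t, ContDiff ℝ ∞ (G t)) (k : List ι → T → ℝ)
      (hk : ∀ l, Integrable (k l) μ) (hle : ∀ l t x, ‖listDeriv b l (G t) x‖ ≤ k l t)
      (hm : ∀ l x, AEStronglyMeasurable (fun t => listDeriv b l (G t) x) μ) (i : ι) :
      dirDeriv b i (fun x => ∫ t, G t x ∂μ) = fun x => ∫ t, dirDeriv b i (G t) x ∂μ := by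
    classical
    ext x
    rw [dirDeriv, (step G hG k hk hle hm x).fderiv]
    simp [Finsupp.single_apply]
  have smooth (n : ℕ) : ∀ (G : T → V → ℂ) (hG : ∀ t, ContDiff ℝ ∞ (G t)) (k : List ι → T → ℝ)
      (hk : ∀ l, Integrable (k l) μ) (hle : ∀ l t x, ‖listDeriv b l (G t) x‖ ≤ k l t)
      (hm : ∀ l x, AEStronglyMeasurable (fun t => listDeriv b l (G t) x) μ),
      ContDiff ℝ n (fun x => ∫ t, G t x ∂μ) := by
    induction n with
    | zero =>
      intro G hG k hk hle hm
      exact contDiff_zero.2 (continuous_iff_continuousAt.2 fun x =>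
        (step G hG k hk hle hm x).continuousAt)
    | succ n ih =>
      intro G hG k hk hle hm
      push_cast
      refine contDiff_succ_iff_fderiv_apply.2
        ⟨fun x => (step G hG k hk hle hm x).differentiableAt, by simp, fun y => ?_⟩
      have e : (fun x => fderiv ℝ (fun x => ∫ t, G t x ∂μ) x y) =
          fun x => ∑ i, b.repr y i • ∫ t, dirDeriv b i (G t) x ∂μ := by
        ext x
        rw [(step G hG k hk hle hm x).fderiv]
        simp
      rw [e]
      refine ContDiff.sum fun i _ => ContDiff.const_smul _
        (ih (fun t => dirDeriv b i (G t)) (fun t => contDiff_dirDeriv (hG t) i)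
          (fun l => k (l ++ [i])) (fun l => hk _) (fun l t x => ?_) (fun l x => ?_))
      · have := hle (l ++ [i]) t x
        rwa [listDeriv_append] at this
      · have := hm (l ++ [i]) x
        simp only [listDeriv_append] at this
        exact this
  refine ⟨contDiff_infty.2 fun n => smooth n F hF k hk hle hm, fun l => ?_⟩
  induction l with
  | nil => intro x; rfl
  | cons i l ih =>
    intro x
    rw [listDeriv_cons, funext ih, stepD (fun t => listDeriv b l (F t))
      (fun t => contDiff_listDeriv (hF t) l) (fun m => k (m ++ l)) (fun m => hk _)
      (fun m t x => by rw [← listDeriv_append]; exact hle _ t x)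
      (fun m x => by simpa only [← listDeriv_append] using hm (m ++ l) x)]
    rfl

variable [DecidableEq ι]

theorem contDiff_integral_of_derivBound [FiniteDimensional ℝ V] {σ : ι → ℝ} {h : ℝ} (hh : 0 ≤ h)
    {T : Type*} [MeasurableSpace T]
    {μ : Measure T} {F : T → V → ℂ} (hF : ∀ t, ContDiff ℝ ∞ (F t)) {A : T → V → ℝ} {k : T → ℝ}
    (hk : Integrable k μ) (hA : ∀ t x, A t x ≤ k t) (hle : ∀ t x, DerivBound b σ h (A t x) (F t) x)
    (hm : ∀ l x, AEStronglyMeasurable (fun t => listDeriv b l (F t) x) μ) :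
    ContDiff ℝ ∞ (fun x => ∫ t, F t x ∂μ) ∧
      ∀ l x, listDeriv b l (fun x => ∫ t, F t x ∂μ) x = ∫ t, listDeriv b l (F t) x ∂μ := by
  refine contDiff_integral_and_listDeriv hF
    (k := fun l t => k t * (h ^ l.length * facWeight σ l)) (fun l => hk.mul_const _)
    (fun l t x => (hle t x l).trans ?_) hm
  have := facWeight_pos σ l
  gcongr
  exact hA t x

/-- Differentiation under the integral needs the majorant k, uniform in x; the resulting bound at
the point x comes from the finer majorant k', which may retain the decay in x. -/
theorem derivBound_integral [FiniteDimensional ℝ V] {σ : ι → ℝ} {h : ℝ} (hh : 0 ≤ h)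
    {T : Type*} [MeasurableSpace T]
    {μ : Measure T} {F : T → V → ℂ} (hF : ∀ t, ContDiff ℝ ∞ (F t)) {A : T → V → ℝ} {k : T → ℝ}
    (hk : Integrable k μ) (hA : ∀ t x, A t x ≤ k t) (hle : ∀ t x, DerivBound b σ h (A t x) (F t) x)
    (hm : ∀ l x, AEStronglyMeasurable (fun t => listDeriv b l (F t) x) μ) (x : V)
    {k' : T → ℝ} (hk' : Integrable k' μ) (hA' : ∀ t, A t x ≤ k' t) :
    DerivBound b σ h (∫ t, k' t ∂μ) (fun x => ∫ t, F t x ∂μ) x := fun l => by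
  rw [(contDiff_integral_of_derivBound hh hF hk hA hle hm).2, ← integral_mul_const]
  refine norm_integral_le_of_norm_le (hk'.mul_const _) (Eventually.of_forall fun t => ?_)
  have := facWeight_pos σ l
  refine (hle t x l).trans ?_
  gcongr
  exact hA' t

/-- Series over lattices are treated as integrals with respect to the counting measure, so that they
are covered by the results for integrals. -/
theorem integral_count_eq_tsum {T : Type*} [Countable T] (f : T → ℂ) (hf : Summable fun t => ‖f t‖) :
    ∫ t, f t ∂(@Measure.count T ⊤) = ∑' t, f t := by
  let _ : MeasurableSpace T := ⊤
  rw [integral_countable (integrable_count_iff.2 hf)]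
  simp [Measure.real]

theorem integral_count_eq_tsum_real {T : Type*} [Countable T] (f : T → ℝ) (hf : Summable fun t => ‖f t‖) :
    ∫ t, f t ∂(@Measure.count T ⊤) = ∑' t, f t := by
  let _ : MeasurableSpace T := ⊤
  rw [integral_countable (integrable_count_iff.2 hf)]
  simp [Measure.real]

theorem contDiff_tsum_of_derivBound [FiniteDimensional ℝ V] {σ : ι → ℝ} {h : ℝ} (hh : 0 ≤ h)
    {T : Type*} [Countable T] {F : T → V → ℂ} (hF : ∀ t, ContDiff ℝ ∞ (F t)) {A : T → V → ℝ}
    {k : T → ℝ} (hk : Summable k) (hA : ∀ t x, A t x ≤ k t)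
    (hle : ∀ t x, DerivBound b σ h (A t x) (F t) x) :
    ContDiff ℝ ∞ (fun x => ∑' t, F t x) := by
  let _ : MeasurableSpace T := ⊤
  have hn : Summable fun t => ‖k t‖ := hk.congr fun t => by
    rw [Real.norm_of_nonneg ((hle t 0).nonneg.trans (hA t 0))]
  have hs (x : V) : Summable fun t => ‖F t x‖ := Summable.of_nonneg_of_le (fun _ => norm_nonneg _)
    (fun t => (by simpa using hle t x [] : ‖F t x‖ ≤ A t x).trans (hA t x)) hk
  simp only [fun x => (integral_count_eq_tsum (fun t => F t x) (hs x)).symm]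
  exact (contDiff_integral_of_derivBound hh hF (integrable_count_iff.2 hn) hA hle
    fun l x => (measurable_of_countable _).aestronglyMeasurable).1

theorem derivBound_tsum [FiniteDimensional ℝ V] {σ : ι → ℝ} {h : ℝ} (hh : 0 ≤ h)
    {T : Type*} [Countable T] {F : T → V → ℂ} (hF : ∀ t, ContDiff ℝ ∞ (F t)) {A : T → V → ℝ}
    {k : T → ℝ} (hk : Summable k) (hA : ∀ t x, A t x ≤ k t)
    (hle : ∀ t x, DerivBound b σ h (A t x) (F t) x) (x : V) {k' : T → ℝ} (hk' : Summable k')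
    (hA' : ∀ t, A t x ≤ k' t) :
    DerivBound b σ h (∑' t, k' t) (fun x => ∑' t, F t x) x := by
  let _ : MeasurableSpace T := ⊤
  have hn : Summable fun t => ‖k t‖ := hk.congr fun t => by
    rw [Real.norm_of_nonneg ((hle t 0).nonneg.trans (hA t 0))]
  have hn' : Summable fun t => ‖k' t‖ := hk'.congr fun t => by
    rw [Real.norm_of_nonneg ((hle t x).nonneg.trans (hA' t))]
  have hs (x : V) : Summable fun t => ‖F t x‖ := Summable.of_nonneg_of_le (fun _ => norm_nonneg _)
    (fun t => (by simpa using hle t x [] : ‖F t x‖ ≤ A t x).trans (hA t x)) hk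
  simp only [fun x => (integral_count_eq_tsum (fun t => F t x) (hs x)).symm]
  rw [← integral_count_eq_tsum_real _ hn']
  exact derivBound_integral hh hF (integrable_count_iff.2 hn) hA hle
    (fun l x => (measurable_of_countable _).aestronglyMeasurable) x (integrable_count_iff.2 hn') hA'

end superposition

/-! ### An integrable majorant which is summable over lattices -/

section decay

variable {ι V : Type*} [NormedAddCommGroup V] [NormedSpace ℝ V]

/-- An integrable negative power of `1 + ‖x‖`. -/
def decay (x : V) : ℝ := ((1 + ‖x‖) ^ (Module.finrank ℝ V + 1))⁻¹

theorem decay_pos (x : V) : 0 < decay x := by unfold decay; positivity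

theorem decay_le_one (x : V) : decay x ≤ 1 :=
  inv_le_one_of_one_le₀ (one_le_pow₀ (by linarith [norm_nonneg x]))

theorem integrable_decay [FiniteDimensional ℝ V] [MeasurableSpace V] [BorelSpace V] (μ : Measure V)
    [μ.IsAddHaarMeasure] : Integrable (decay (V := V)) μ := by
  have := integrable_one_add_norm (E := V) (μ := μ) (r := (Module.finrank ℝ V + 1 : ℕ))
    (by push_cast; linarith)
  refine this.congr (Eventually.of_forall fun x => ?_)
  simp only [decay]
  rw [Real.rpow_neg (by positivity), Real.rpow_natCast]

theorem summable_decay [FiniteDimensional ℝ V] (L : Submodule ℤ V) [DiscreteTopology L]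
    [IsZLattice ℝ L] : Summable fun z : L => decay (z : V) := by
  classical
  have h1 : Summable fun z : L => ‖z‖⁻¹ ^ (Module.finrank ℝ V + 1) :=
    ZLattice.summable_norm_pow_inv L _ (by rw [ZLattice.rank ℝ]; omega)
  have h2 : Summable fun z : L => if z = 0 then (1 : ℝ) else 0 :=
    summable_of_ne_finset_zero (s := {0}) fun z hz => by simpa using hz
  refine Summable.of_nonneg_of_le (fun z => (decay_pos _).le) (fun z => ?_) (h1.add h2)
  by_cases hz : z = 0
  · subst hz
    simp [decay]
  · have : 0 < ‖(z : V)‖ := by simpa using hz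
    simp only [hz, if_false, add_zero, decay]
    rw [← inv_pow]
    change _ ≤ ‖(z : V)‖⁻¹ ^ _
    gcongr
    linarith

variable [Fintype ι] [DecidableEq ι] {b : Module.Basis ι ℝ V} {s : ι → ℝ} {h : ℝ}

theorem exists_inv_growth_le (hs : ∀ i, 0 < s i) (hh : 0 < h) :
    ∃ C : ℝ, 0 < C ∧ ∀ x : V, (growth b s h x)⁻¹ ≤ C * decay x := by
  obtain ⟨C, hC, hx⟩ := exists_one_add_norm_pow_le (b := b) hs (Module.finrank ℝ V + 1) hh
  refine ⟨C, hC, fun x => ?_⟩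
  have := growth_pos (b := b) hs hh x
  rw [decay, ← div_eq_mul_inv, le_div_iff₀ (by positivity), inv_mul_le_iff₀ this, mul_comm _ C]
  exact hx x

theorem growth_le_of_abs_repr_le (hs : ∀ i, 0 < s i) (hh : 0 < h) {x y : V}
    (hxy : ∀ i, |b.repr x i| ≤ |b.repr y i|) : growth b s h x ≤ growth b s h y := by
  refine growth_le hh fun l => le_trans ?_ (listMono_le hs hh l y)
  simp only [listMono]
  induction l with
  | nil => simp
  | cons i l ih =>
    simp only [List.map_cons, List.prod_cons, abs_mul]
    exact mul_le_mul (hxy i) ih (abs_nonneg _) (abs_nonneg _)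

theorem exists_growth_le_of_isBounded [FiniteDimensional ℝ V] (hs : ∀ i, 0 < s i) (hh : 0 < h) {Q : Set V}
    (hQ : Bornology.IsBounded Q) : ∃ M : ℝ, 0 < M ∧ ∀ x ∈ Q, growth b s h x ≤ M := by
  obtain ⟨r, hr⟩ := hQ.exists_norm_le
  let c (i : ι) := ‖LinearMap.toContinuousLinearMap (b.coord i)‖
  -- A point whose coordinates dominate in absolute value those of all points of Q; the weight is
  -- monotone in these absolute values.
  let y : V := ∑ i, (c i * |r|) • b i
  refine ⟨growth b s h y, growth_pos hs hh y, fun x hx => growth_le_of_abs_repr_le hs hh fun i => ?_⟩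
  have h1 : |b.repr x i| ≤ c i * ‖x‖ := (LinearMap.toContinuousLinearMap (b.coord i)).le_opNorm x
  have h2 : b.repr y i = c i * |r| := by simp [y, Finsupp.single_apply]
  have h3 : 0 ≤ c i := norm_nonneg _
  rw [h2, abs_of_nonneg (mul_nonneg h3 (abs_nonneg r))]
  refine h1.trans ?_
  gcongr
  exact (hr x hx).trans (le_abs_self r)

variable {σ : ι → ℝ} {C : ℝ} {f : V → ℂ}

theorem HasGSBound.exists_norm_le_decay (hs : ∀ i, 0 < s i) (hh : 0 < h)
    (hf : HasGSBound b s σ h C f) : ∃ C', 0 < C' ∧ ∀ l x, ‖listDeriv b l f x‖ ≤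
      C' * (h ^ l.length * facWeight σ l) * decay x := by
  obtain ⟨D, hD, hx⟩ := exists_inv_growth_le (b := b) hs hh
  have hC : 0 ≤ C := by
    have := (hf 0).nonneg
    rwa [le_div_iff₀ (growth_pos hs hh 0), zero_mul] at this
  refine ⟨C * D + 1, by positivity, fun l x => (hf x l).trans ?_⟩
  have := facWeight_pos σ l
  have := decay_pos x
  calc _ = C * (growth b s h x)⁻¹ * (h ^ l.length * facWeight σ l) := by rw [div_eq_mul_inv]
    _ ≤ C * (D * decay x) * (h ^ l.length * facWeight σ l) := by gcongr; exact hx x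
    _ = (C * D) * (h ^ l.length * facWeight σ l) * decay x := by ring
    _ ≤ _ := by gcongr; linarith

theorem HasGSBound.integrable [FiniteDimensional ℝ V] [MeasurableSpace V] [BorelSpace V] (μ : Measure V)
    [μ.IsAddHaarMeasure] (hs : ∀ i, 0 < s i) (hh : 0 < h) (hf : HasGSBound b s σ h C f)
    (hc : ContDiff ℝ ∞ f) (l : List ι) : Integrable (listDeriv b l f) μ := by
  obtain ⟨D, hD, hx⟩ := hf.exists_norm_le_decay hs hh
  exact ((integrable_decay μ).const_mul _).mono' (contDiff_listDeriv hc l).continuous.aestronglyMeasurable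
    (Eventually.of_forall fun x => hx l x)

end decay

/-! ### Product spaces -/

section product

variable {ι κ V W : Type*} [NormedAddCommGroup V] [NormedSpace ℝ V]
  [NormedAddCommGroup W] [NormedSpace ℝ W] {b : Module.Basis ι ℝ V} {b' : Module.Basis κ ℝ W}

theorem listDeriv_zero (l : List ι) : listDeriv b l (0 : V → ℂ) = 0 := by
  simpa using listDeriv_smul (b := b) (f := (0 : V → ℂ)) contDiff_const 0 l

theorem listDeriv_map_inl {F : V × W → ℂ} (hF : ContDiff ℝ ∞ F) (l : List ι) (x : V) (ξ : W) :
    listDeriv (b.prod b') (l.map Sum.inl) F (x, ξ) = listDeriv b l (fun x => F (x, ξ)) x := by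
  induction l generalizing x with
  | nil => rfl
  | cons i l ih =>
    rw [List.map_cons, listDeriv_cons, listDeriv_cons, dirDeriv, dirDeriv, ← funext ih]
    have hd : HasFDerivAt (listDeriv (b.prod b') (l.map Sum.inl) F)
      (fderiv ℝ (listDeriv (b.prod b') (l.map Sum.inl) F) (x, ξ)) (x, ξ) :=
      ((contDiff_listDeriv hF _).differentiable (by simp) _).hasFDerivAt
    have := hd.comp x (hasFDerivAt_prodMk_left (𝕜 := ℝ) x ξ)
    rw [show (fun x => listDeriv (b.prod b') (l.map Sum.inl) F (x, ξ)) =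
      listDeriv (b.prod b') (l.map Sum.inl) F ∘ fun x => (x, ξ) from rfl, this.fderiv]
    simp [Module.Basis.prod_apply]

theorem listDeriv_map_inr {F : V × W → ℂ} (hF : ContDiff ℝ ∞ F) (l : List κ) (x : V) (ξ : W) :
    listDeriv (b.prod b') (l.map Sum.inr) F (x, ξ) = listDeriv b' l (fun ξ => F (x, ξ)) ξ := by
  induction l generalizing ξ with
  | nil => rfl
  | cons i l ih =>
    rw [List.map_cons, listDeriv_cons, listDeriv_cons, dirDeriv, dirDeriv, ← funext ih]
    have hd : HasFDerivAt (listDeriv (b.prod b') (l.map Sum.inr) F)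
      (fderiv ℝ (listDeriv (b.prod b') (l.map Sum.inr) F) (x, ξ)) (x, ξ) :=
      ((contDiff_listDeriv hF _).differentiable (by simp) _).hasFDerivAt
    have := hd.comp ξ (hasFDerivAt_prodMk_right (𝕜 := ℝ) x ξ)
    rw [show (fun ξ => listDeriv (b.prod b') (l.map Sum.inr) F (x, ξ)) =
      listDeriv (b.prod b') (l.map Sum.inr) F ∘ fun ξ => (x, ξ) from rfl, this.fderiv]
    simp [Module.Basis.prod_apply]

/-- A single derivative in the second variable annihilates the function, so only lists of directions
in the first variable contribute. -/
theorem listDeriv_comp_fst {f : V → ℂ} (hf : ContDiff ℝ ∞ f) (l : List (ι ⊕ κ)) :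
    listDeriv (b.prod b') l (fun z => f z.1) = 0 ∨ ∃ l', l = l'.map Sum.inl ∧
      listDeriv (b.prod b') l (fun z => f z.1) = fun z => listDeriv b l' f z.1 := by
  have h1 (g : V → ℂ) (hg : ContDiff ℝ ∞ g) (z : V × W) (v : V × W) :
      fderiv ℝ (fun z : V × W => g z.1) z v = fderiv ℝ g z.1 v.1 := by
    have := ((hg.differentiable (by simp) z.1).hasFDerivAt).comp z
      (hasFDerivAt_fst (𝕜 := ℝ) (p := z))
    rw [show (fun z : V × W => g z.1) = g ∘ Prod.fst from rfl, this.fderiv]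
    rfl
  induction l with
  | nil => exact Or.inr ⟨[], rfl, rfl⟩
  | cons i l ih =>
    rcases ih with ih | ⟨l', rfl, ih⟩
    · left
      rw [listDeriv_cons, ih]
      exact listDeriv_zero [i]
    · rcases i with i | i
      · right
        refine ⟨i :: l', rfl, ?_⟩
        ext z
        rw [listDeriv_cons, ih, dirDeriv, h1 _ (contDiff_listDeriv hf l')]
        simp [listDeriv_cons, dirDeriv, Module.Basis.prod_apply]
      · left
        ext z
        rw [listDeriv_cons, ih, dirDeriv, h1 _ (contDiff_listDeriv hf l')]
        simp [Module.Basis.prod_apply]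

theorem listDeriv_comp_snd {f : W → ℂ} (hf : ContDiff ℝ ∞ f) (l : List (ι ⊕ κ)) :
    listDeriv (b.prod b') l (fun z => f z.2) = 0 ∨ ∃ l', l = l'.map Sum.inr ∧
      listDeriv (b.prod b') l (fun z => f z.2) = fun z => listDeriv b' l' f z.2 := by
  have h1 (g : W → ℂ) (hg : ContDiff ℝ ∞ g) (z : V × W) (v : V × W) :
      fderiv ℝ (fun z : V × W => g z.2) z v = fderiv ℝ g z.2 v.2 := by
    have := ((hg.differentiable (by simp) z.2).hasFDerivAt).comp z
      (hasFDerivAt_snd (𝕜 := ℝ) (p := z))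
    rw [show (fun z : V × W => g z.2) = g ∘ Prod.snd from rfl, this.fderiv]
    rfl
  induction l with
  | nil => exact Or.inr ⟨[], rfl, rfl⟩
  | cons i l ih =>
    rcases ih with ih | ⟨l', rfl, ih⟩
    · left
      rw [listDeriv_cons, ih]
      exact listDeriv_zero [i]
    · rcases i with i | i
      · left
        ext z
        rw [listDeriv_cons, ih, dirDeriv, h1 _ (contDiff_listDeriv hf l')]
        simp [Module.Basis.prod_apply]
      · right
        refine ⟨i :: l', rfl, ?_⟩
        ext z
        rw [listDeriv_cons, ih, dirDeriv, h1 _ (contDiff_listDeriv hf l')]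
        simp [listDeriv_cons, dirDeriv, Module.Basis.prod_apply]

theorem exists_perm_map_inl_append_map_inr (l : List (ι ⊕ κ)) :
    ∃ (l₁ : List ι) (l₂ : List κ), l.Perm (l₁.map Sum.inl ++ l₂.map Sum.inr) := by
  induction l with
  | nil => exact ⟨[], [], List.Perm.refl _⟩
  | cons i l ih =>
    obtain ⟨l₁, l₂, h⟩ := ih
    rcases i with i | i
    · exact ⟨i :: l₁, l₂, h.cons _⟩
    · exact ⟨l₁, i :: l₂, (h.cons _).trans List.perm_middle.symm⟩

theorem listMono_prod (l₁ : List ι) (l₂ : List κ) (x : V) (ξ : W) :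
    listMono (b.prod b') (l₁.map Sum.inl ++ l₂.map Sum.inr) (x, ξ) =
      listMono b l₁ x * listMono b' l₂ ξ := by
  simp [listMono, Function.comp_def]

variable [Fintype ι] [DecidableEq ι] [Fintype κ] [DecidableEq κ]

omit [Fintype ι] in
theorem count_map_injective {K : Type*} [DecidableEq K] {f : ι → K} (hf : f.Injective) (l : List ι)
    (i : ι) : (l.map f).count (f i) = l.count i :=
  List.count_map_of_injective _ _ hf _

omit [Fintype ι] [DecidableEq ι] in
theorem count_map_eq_zero {K : Type*} [DecidableEq K] {f : ι → K} {l : List ι} {a : K}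
    (ha : ∀ i, f i ≠ a) : (l.map f).count a = 0 :=
  List.count_eq_zero_of_not_mem (by simp [ha])

theorem facWeight_prod (s : ι → ℝ) (s' : κ → ℝ) (l₁ : List ι) (l₂ : List κ) :
    facWeight (Sum.elim s s') (l₁.map Sum.inl ++ l₂.map Sum.inr) = facWeight s l₁ * facWeight s' l₂ := by
  have h1 (i : ι) := count_map_injective (Sum.inl_injective (α := ι) (β := κ)) l₁ i
  have h2 (i : κ) := count_map_injective (Sum.inr_injective (α := ι) (β := κ)) l₂ i
  have h3 (i : κ) := count_map_eq_zero (f := (Sum.inl : ι → ι ⊕ κ)) (l := l₁) (a := Sum.inr i) (by simp)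
  have h4 (i : ι) := count_map_eq_zero (f := (Sum.inr : κ → ι ⊕ κ)) (l := l₂) (a := Sum.inl i) (by simp)
  simp [facWeight, Fintype.prod_sum_type, h1, h2, h3, h4]

variable {s σ : ι → ℝ} {s' σ' : κ → ℝ} {h : ℝ}

omit [Fintype ι] [DecidableEq ι] [Fintype κ] [DecidableEq κ] in
theorem sumElim_pos (hs : ∀ i, 0 < s i) (hs' : ∀ i, 0 < s' i) : ∀ i, 0 < Sum.elim s s' i := by
  rintro (i | i)
  exacts [hs i, hs' i]

/-- Up to a permutation a list is a list for x followed by a list for ξ. Monomials and factorial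
weights factorize accordingly, and the two suprema are independent. -/
theorem growth_prod (hs : ∀ i, 0 < s i) (hs' : ∀ i, 0 < s' i) (hh : 0 < h) (x : V) (ξ : W) :
    growth (b.prod b') (Sum.elim s s') h (x, ξ) = growth b s h x * growth b' s' h ξ := by
  have hx := growth_pos (b := b) hs hh x
  have hξ := growth_pos (b := b') hs' hh ξ
  apply le_antisymm
  · refine growth_le hh fun l => ?_
    obtain ⟨l₁, l₂, hl⟩ := exists_perm_map_inl_append_map_inr l
    have e : listMono (b.prod b') l (x, ξ) =
      listMono (b.prod b') (l₁.map Sum.inl ++ l₂.map Sum.inr) (x, ξ) := (hl.map _).prod_eq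
    rw [e, facWeight_perm hl, hl.length_eq, listMono_prod, facWeight_prod, abs_mul]
    have p1 := facWeight_pos s l₁
    refine (mul_le_mul (listMono_le hs hh l₁ x) (listMono_le hs' hh l₂ ξ) (abs_nonneg _)
      (by positivity)).trans (le_of_eq ?_)
    simp only [List.length_append, List.length_map]
    ring
  · have key := listMono_le (b := b.prod b') (sumElim_pos hs hs') hh
    rw [← le_div_iff₀ hξ]
    refine growth_le hh fun l₁ => ?_
    rw [← mul_div_assoc, le_div_iff₀ hξ]
    rcases (abs_nonneg (listMono b l₁ x)).eq_or_lt with h0 | h0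
    · rw [← h0, zero_mul]
      have := facWeight_pos s l₁
      have := growth_pos (b := b.prod b') (sumElim_pos hs hs') hh (x, ξ)
      positivity
    rw [← le_div_iff₀' h0]
    refine growth_le hh fun l₂ => ?_
    rw [← mul_div_assoc, le_div_iff₀' h0, ← abs_mul, ← listMono_prod]
    refine (key _ _).trans (le_of_eq ?_)
    rw [facWeight_prod]
    simp only [List.length_append, List.length_map]
    ring

theorem facWeight_map_inl (s : ι → ℝ) (s' : κ → ℝ) (l : List ι) :
    facWeight (Sum.elim s s') (l.map Sum.inl) = facWeight s l := by
  simpa using facWeight_prod s s' l []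

theorem facWeight_map_inr (s : ι → ℝ) (s' : κ → ℝ) (l : List κ) :
    facWeight (Sum.elim s s') (l.map Sum.inr) = facWeight s' l := by
  simpa using facWeight_prod s s' [] l

theorem DerivBound.comp_fst {A : ℝ} {f : V → ℂ} (hfs : ContDiff ℝ ∞ f) {z : V × W}
    (hf : DerivBound b σ h A f z.1) (hh : 0 ≤ h) :
    DerivBound (b.prod b') (Sum.elim σ σ') h A (fun z => f z.1) z := fun l => by
  rcases listDeriv_comp_fst (b := b) (b' := b') hfs l with h0 | ⟨l', rfl, hl⟩
  · have := hf.nonneg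
    have := facWeight_pos (Sum.elim σ σ') l
    rw [h0, Pi.zero_apply, norm_zero]
    positivity
  · rw [hl, facWeight_map_inl, List.length_map]
    exact hf l'

theorem DerivBound.comp_snd {A : ℝ} {f : W → ℂ} (hfs : ContDiff ℝ ∞ f) {z : V × W}
    (hf : DerivBound b' σ' h A f z.2) (hh : 0 ≤ h) :
    DerivBound (b.prod b') (Sum.elim σ σ') h A (fun z => f z.2) z := fun l => by
  rcases listDeriv_comp_snd (b := b) (b' := b') hfs l with h0 | ⟨l', rfl, hl⟩
  · have := hf.nonneg
    have := facWeight_pos (Sum.elim σ σ') l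
    rw [h0, Pi.zero_apply, norm_zero]
    positivity
  · rw [hl, facWeight_map_inr, List.length_map]
    exact hf l'

theorem DerivBound.slice_left {A : ℝ} {F : V × W → ℂ} (hF : ContDiff ℝ ∞ F) {x : V} {ξ : W}
    (hf : DerivBound (b.prod b') (Sum.elim σ σ') h A F (x, ξ)) :
    DerivBound b σ h A (fun x => F (x, ξ)) x := fun l => by
  have := hf (l.map Sum.inl)
  rwa [listDeriv_map_inl hF, facWeight_map_inl, List.length_map] at this

end product

/-! ### Characters and integration by parts -/

section char

variable {d : ℕ}

/-- The character `ξ ↦ e^{i⟪j, ξ⟫}`. -/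
def char (j ξ : EuclideanSpace ℝ (Fin d)) : ℂ := Complex.exp (Complex.I * (⟪j, ξ⟫ : ℝ))

theorem norm_char (j ξ : EuclideanSpace ℝ (Fin d)) : ‖char j ξ‖ = 1 := by
  rw [char, mul_comm, Complex.norm_exp_ofReal_mul_I]

theorem char_add_left (j k ξ : EuclideanSpace ℝ (Fin d)) : char (j + k) ξ = char j ξ * char k ξ := by
  simp only [char, inner_add_left, Complex.ofReal_add, mul_add, Complex.exp_add]

theorem char_add_right (j ξ η : EuclideanSpace ℝ (Fin d)) : char j (ξ + η) = char j ξ * char j η := by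
  simp only [char, inner_add_right, Complex.ofReal_add, mul_add, Complex.exp_add]

theorem char_comm (j ξ : EuclideanSpace ℝ (Fin d)) : char j ξ = char ξ j := by
  simp only [char, real_inner_comm]

theorem contDiff_char (j : EuclideanSpace ℝ (Fin d)) : ContDiff ℝ ∞ (char j) := by
  unfold char
  exact (contDiff_const.mul (Complex.ofRealCLM.contDiff.comp (contDiff_const.inner ℝ contDiff_id))).cexp

theorem dirDeriv_char (j : EuclideanSpace ℝ (Fin d)) (i : Fin d) :
    dirDeriv (stdBasis d) i (char j) = (Complex.I * ((stdBasis d).repr j i : ℝ)) • char j := by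
  ext ξ
  have h1 : HasFDerivAt (fun ξ : EuclideanSpace ℝ (Fin d) => ((⟪j, ξ⟫ : ℝ) : ℂ))
      (Complex.ofRealCLM.comp (innerSL ℝ j)) ξ :=
    Complex.ofRealCLM.hasFDerivAt.comp ξ (innerSL ℝ j).hasFDerivAt
  have h2 := (h1.const_mul Complex.I).cexp
  have h3 : HasFDerivAt (char j) _ ξ := h2
  rw [dirDeriv, h3.fderiv]
  have h4 : ⟪j, stdBasis d i⟫ = (stdBasis d).repr j i := by
    rw [real_inner_comm]
    simp [stdBasis, EuclideanSpace.inner_single_left]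
  simp only [smul_apply, ContinuousLinearMap.comp_apply, innerSL_apply_apply,
    Complex.ofRealCLM_apply, h4, smul_eq_mul, Pi.smul_apply, char]
  ring

theorem norm_listDeriv_char (l : List (Fin d)) (j ξ : EuclideanSpace ℝ (Fin d)) :
    ‖listDeriv (stdBasis d) l (char j) ξ‖ = |listMono (stdBasis d) l j| := by
  have key : ∃ c : ℂ, ‖c‖ = |listMono (stdBasis d) l j| ∧
      listDeriv (stdBasis d) l (char j) = c • char j := by
    induction l with
    | nil => exact ⟨1, by simp, by simp⟩
    | cons i l ih =>
      obtain ⟨c, hc, he⟩ := ih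
      refine ⟨c * (Complex.I * ((stdBasis d).repr j i : ℝ)), ?_, ?_⟩
      · simp [hc, listMono_cons, abs_mul, mul_comm]
      · rw [listDeriv_cons, he, dirDeriv_smul (contDiff_char j), dirDeriv_char]
        ext ξ
        simp only [Pi.smul_apply, smul_eq_mul]
        ring
  obtain ⟨c, hc, he⟩ := key
  rw [he, Pi.smul_apply, norm_smul, hc, norm_char, mul_one]

/-- The derivative ∂^l of e^{i⟨j,ξ⟩} has modulus |j^l|. The weight at j is therefore the price of
modulation by this character. -/
theorem derivBound_char {s : Fin d → ℝ} (hs : ∀ i, 0 < s i) {h : ℝ} (hh : 0 < h)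
    (j ξ : EuclideanSpace ℝ (Fin d)) :
    DerivBound (stdBasis d) s h (growth (stdBasis d) s h j) (char j) ξ := fun l => by
  rw [norm_listDeriv_char, mul_comm]
  exact listMono_le hs hh l j

/-- Every derivative of the character yields a coordinate of j, up to a factor of modulus one.
Integration by parts thus trades powers of j for derivatives of H. -/
theorem listMono_mul_norm_integral_char (j : EuclideanSpace ℝ (Fin d))
    {H : EuclideanSpace ℝ (Fin d) → ℂ} (hH : ContDiff ℝ ∞ H)
    (hi : ∀ l, Integrable (listDeriv (stdBasis d) l H)) (m : List (Fin d)) :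
    |listMono (stdBasis d) m j| * ‖∫ ξ, char j ξ * H ξ‖ =
      ‖∫ ξ, char j ξ * listDeriv (stdBasis d) m H ξ‖ := by
  have hint (G : EuclideanSpace ℝ (Fin d) → ℂ) (hG : Integrable G) :
      Integrable fun ξ => char j ξ * G ξ :=
    hG.bdd_mul (contDiff_char j).continuous.aestronglyMeasurable
      (Eventually.of_forall fun ξ => (norm_char j ξ).le)
  induction m with
  | nil => simp
  | cons i m ih =>
    have e (ξ) : fderiv ℝ (char j) ξ (stdBasis d i) =
        (Complex.I * ((stdBasis d).repr j i : ℝ)) * char j ξ := congrFun (dirDeriv_char j i) ξ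
    have := integral_mul_fderiv_eq_neg_fderiv_mul_of_integrable (μ := volume) (f := char j)
      (g := listDeriv (stdBasis d) m H) (v := stdBasis d i) ?_ (hint _ (hi (i :: m))) (hint _ (hi m))
      (fun ξ _ => (contDiff_char j).differentiable (by simp) ξ)
      (fun ξ _ => (contDiff_listDeriv hH m).differentiable (by simp) ξ)
    · change ∫ ξ, char j ξ * listDeriv (stdBasis d) (i :: m) H ξ = _ at this
      rw [this]
      simp only [e, mul_assoc]
      rw [norm_neg, integral_const_mul, norm_mul, integral_const_mul, norm_mul, ← ih,
        listMono_cons, abs_mul]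
      simp
      ring
    · simp only [e, mul_assoc]
      exact ((hint _ (hi m)).const_mul _).const_mul _

end char

/-! ### The transpose of the Zak transform on test functions -/

section zakAdj

variable {d : ℕ}

/-- The basis of `ℝ^d × ℝ^d` with respect to which the spaces on `ℝ^{2d}` are defined. -/
abbrev stdBasis₂ (d : ℕ) := (stdBasis d).prod (stdBasis d)

/-- The term with index `j` of `zakAdj`. -/
def zakAdjTerm (Φ : EuclideanSpace ℝ (Fin d) × EuclideanSpace ℝ (Fin d) → ℂ)
    (j x : EuclideanSpace ℝ (Fin d)) : ℂ := ∫ ξ, char j ξ * Φ (x + j, ξ)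

/-- The transpose `Φ ↦ ∑_j ∫ e^{i⟪j, ξ⟫} Φ(x + j, ξ) dξ` of the Zak transform. -/
def zakAdj (L : Submodule ℤ (EuclideanSpace ℝ (Fin d)))
    (Φ : EuclideanSpace ℝ (Fin d) × EuclideanSpace ℝ (Fin d) → ℂ)
    (x : EuclideanSpace ℝ (Fin d)) : ℂ := ∑' j : L, zakAdjTerm Φ j x

variable {s σ : Fin d → ℝ} {h C : ℝ} {Φ : EuclideanSpace ℝ (Fin d) × EuclideanSpace ℝ (Fin d) → ℂ}

theorem HasGSBound.norm_mixed_le (hs : ∀ i, 0 < s i) (hσ : ∀ i, 0 < σ i) (hh : 0 < h)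
    (hΦ : HasGSBound (stdBasis₂ d) (Sum.elim s σ) (Sum.elim σ s) h C Φ) (l m : List (Fin d))
    (x ξ : EuclideanSpace ℝ (Fin d)) :
    ‖listDeriv (stdBasis₂ d) (m.map Sum.inr ++ l.map Sum.inl) Φ (x, ξ)‖ ≤
      C / (growth (stdBasis d) s h x * growth (stdBasis d) σ h ξ) *
      ((h ^ l.length * facWeight σ l) * (h ^ m.length * facWeight s m)) := by
  refine (hΦ (x, ξ) _).trans (le_of_eq ?_)
  rw [growth_prod hs hσ hh, facWeight_perm List.perm_append_comm, facWeight_prod]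
  simp only [List.length_append, List.length_map]
  ring

theorem contDiff_mixed (hΦs : ContDiff ℝ ∞ Φ) (l : List (Fin d)) (x : EuclideanSpace ℝ (Fin d)) :
    ContDiff ℝ ∞ fun ξ => listDeriv (stdBasis₂ d) (l.map Sum.inl) Φ (x, ξ) :=
  (contDiff_listDeriv hΦs _).comp (contDiff_const.prodMk contDiff_id)

theorem listDeriv_mixed (hΦs : ContDiff ℝ ∞ Φ) (l m : List (Fin d))
    (x ξ : EuclideanSpace ℝ (Fin d)) :
    listDeriv (stdBasis d) m (fun ξ => listDeriv (stdBasis₂ d) (l.map Sum.inl) Φ (x, ξ)) ξ =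
      listDeriv (stdBasis₂ d) (m.map Sum.inr ++ l.map Sum.inl) Φ (x, ξ) := by
  rw [listDeriv_append, listDeriv_map_inr (contDiff_listDeriv hΦs _)]

theorem HasGSBound.nonneg {ι V : Type*} [Fintype ι] [DecidableEq ι] [NormedAddCommGroup V]
    [NormedSpace ℝ V] {b : Module.Basis ι ℝ V} {s σ : ι → ℝ} {f : V → ℂ}
    (hs : ∀ i, 0 < s i) (hh : 0 < h) (hf : HasGSBound b s σ h C f) : 0 ≤ C := by
  have := (hf 0).nonneg
  rwa [le_div_iff₀ (growth_pos hs hh 0), zero_mul] at this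

/-- The derivatives of Φ in ξ are governed by s, so integration by parts against e^{i⟨j,ξ⟩} gives
decay in j with the same weight as the decay of Φ in x. This matching is the reason for the
exchanged parameters in the second variable. -/
theorem zakAdjTerm_bound (hs : ∀ i, 0 < s i) (hσ : ∀ i, 0 < σ i) (hh : 0 < h)
    (hΦs : ContDiff ℝ ∞ Φ)
    (hΦ : HasGSBound (stdBasis₂ d) (Sum.elim s σ) (Sum.elim σ s) h C Φ) {D : ℝ}
    (hD : ∀ ξ, (growth (stdBasis d) σ h ξ)⁻¹ ≤ D * decay ξ) (j : EuclideanSpace ℝ (Fin d)) :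
    ContDiff ℝ ∞ (zakAdjTerm Φ j) ∧ ∀ x, DerivBound (stdBasis d) σ h
      (C * (∫ ξ : EuclideanSpace ℝ (Fin d), D * decay ξ) /
        (growth (stdBasis d) s h (x + j) * growth (stdBasis d) s h j)) (zakAdjTerm Φ j) x := by
  have hC := hΦ.nonneg (sumElim_pos hs hσ) hh
  have gx (x) := growth_pos (b := stdBasis d) hs hh x
  have gξ (x) := growth_pos (b := stdBasis d) hσ hh x
  have hDd : Integrable fun ξ : EuclideanSpace ℝ (Fin d) => D * decay ξ :=
    (integrable_decay volume).const_mul D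
  have bound (l m : List (Fin d)) (x ξ) :
      ‖listDeriv (stdBasis₂ d) (m.map Sum.inr ++ l.map Sum.inl) Φ (x, ξ)‖ ≤
      C / growth (stdBasis d) s h x *
      ((h ^ l.length * facWeight σ l) * (h ^ m.length * facWeight s m)) * (D * decay ξ) := by
    refine (hΦ.norm_mixed_le hs hσ hh l m x ξ).trans ?_
    have := gx x
    have := gξ ξ
    have := facWeight_pos σ l
    have := facWeight_pos s m
    calc _ = C / growth (stdBasis d) s h x *
          ((h ^ l.length * facWeight σ l) * (h ^ m.length * facWeight s m)) *
          (growth (stdBasis d) σ h ξ)⁻¹ := by field_simp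
      _ ≤ _ := by gcongr; exact hD ξ
  have hint (l m : List (Fin d)) (x) : Integrable (listDeriv (stdBasis d) m
      (fun ξ => listDeriv (stdBasis₂ d) (l.map Sum.inl) Φ (x, ξ))) := by
    refine (hDd.const_mul (C / growth (stdBasis d) s h x *
      ((h ^ l.length * facWeight σ l) * (h ^ m.length * facWeight s m)))).mono'
      (contDiff_listDeriv (contDiff_mixed hΦs l x) m).continuous.aestronglyMeasurable
      (Eventually.of_forall fun ξ => ?_)
    rw [listDeriv_mixed hΦs]
    exact bound l m x ξ
  have hder (l : List (Fin d)) (x ξ) : listDeriv (stdBasis d) l (fun x => char j ξ * Φ (x + j, ξ)) x =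
      char j ξ * listDeriv (stdBasis₂ d) (l.map Sum.inl) Φ (x + j, ξ) := by
    have h1 : (fun x => char j ξ * Φ (x + j, ξ)) = char j ξ • fun x => Φ (x + j, ξ) := rfl
    have h2 : ContDiff ℝ ∞ fun x => Φ (x, ξ) := hΦs.comp (contDiff_id.prodMk contDiff_const)
    have h3 : ContDiff ℝ ∞ fun x => Φ (x + j, ξ) := h2.comp (contDiff_id.add contDiff_const)
    rw [h1, listDeriv_smul h3, Pi.smul_apply, smul_eq_mul,
      listDeriv_comp_add_right (fun x => Φ (x, ξ)), listDeriv_map_inl hΦs]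
  have hsm (ξ) : ContDiff ℝ ∞ fun x => char j ξ * Φ (x + j, ξ) :=
    contDiff_const.mul (hΦs.comp ((contDiff_id.add contDiff_const).prodMk contDiff_const))
  have main := contDiff_integral_of_derivBound (b := stdBasis d) (σ := σ) (μ := volume) hh.le hsm
    (A := fun ξ x => C / growth (stdBasis d) s h (x + j) * (D * decay ξ))
    (k := fun ξ => C * (D * decay ξ)) (hDd.const_mul C) (fun ξ x => ?_) (fun ξ x l => ?_)
    (fun l x => ?_)
  · refine ⟨main.1, fun x l => ?_⟩
    have hl := facWeight_pos σ l
    have e : listDeriv (stdBasis d) l (zakAdjTerm Φ j) x =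
        ∫ ξ, char j ξ * listDeriv (stdBasis₂ d) (l.map Sum.inl) Φ (x + j, ξ) := by
      rw [show zakAdjTerm Φ j = fun x => ∫ ξ, char j ξ * Φ (x + j, ξ) from rfl, main.2]
      simp only [hder]
    rw [e]
    have g1 := gx (x + j)
    have g2 := gx j
    have hI : 0 ≤ ∫ ξ : EuclideanSpace ℝ (Fin d), D * decay ξ :=
      integral_nonneg fun ξ => (inv_pos.2 (gξ ξ)).le.trans (hD ξ)
    rcases (norm_nonneg (∫ ξ, char j ξ * listDeriv (stdBasis₂ d) (l.map Sum.inl) Φ (x + j, ξ))).eq_or_lt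
      with h0 | h0
    · rw [← h0]
      positivity
    -- After division by the norm of the integral the claim is an upper bound for the supremum
    -- `growth` at j, which can be checked for one monomial j^m at a time.
    suffices key : growth (stdBasis d) s h j ≤ C * (∫ ξ : EuclideanSpace ℝ (Fin d), D * decay ξ) *
        (h ^ l.length * facWeight σ l) / growth (stdBasis d) s h (x + j) /
        ‖∫ ξ, char j ξ * listDeriv (stdBasis₂ d) (l.map Sum.inl) Φ (x + j, ξ)‖ by
      rw [le_div_iff₀ h0, le_div_iff₀ g1] at key
      rw [div_mul_eq_mul_div, le_div_iff₀ (by positivity)]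
      refine le_trans (le_of_eq ?_) key
      ring
    refine growth_le hh fun m => ?_
    have hm := facWeight_pos s m
    rw [← mul_div_assoc, le_div_iff₀ h0,
      listMono_mul_norm_integral_char j (contDiff_mixed hΦs l (x + j)) (fun m => hint l m (x + j))]
    have h5 : ‖∫ ξ, char j ξ * listDeriv (stdBasis d) m
        (fun ξ => listDeriv (stdBasis₂ d) (l.map Sum.inl) Φ (x + j, ξ)) ξ‖ ≤
        ∫ ξ : EuclideanSpace ℝ (Fin d), C / growth (stdBasis d) s h (x + j) *
          ((h ^ l.length * facWeight σ l) * (h ^ m.length * facWeight s m)) * (D * decay ξ) := by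
      refine norm_integral_le_of_norm_le (hDd.const_mul _) (Eventually.of_forall fun ξ => ?_)
      rw [norm_mul, norm_char, one_mul, listDeriv_mixed hΦs]
      exact bound l m _ ξ
    rw [integral_const_mul] at h5
    refine h5.trans (le_of_eq ?_)
    field_simp
  · have h1 := one_le_growth (b := stdBasis d) hs hh (x + j)
    have h2 : 0 ≤ D * decay ξ := (inv_pos.2 (gξ ξ)).le.trans (hD ξ)
    exact mul_le_mul_of_nonneg_right (div_le_self hC h1) h2
  · rw [hder, norm_mul, norm_char, one_mul]
    refine (bound l [] (x + j) ξ).trans (le_of_eq ?_)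
    simp
    ring
  · simp only [hder]
    exact ((contDiff_char j).continuous.mul (contDiff_mixed hΦs l _).continuous).aestronglyMeasurable

/-- This is `growth_split` for -j and x + j, whose sum is x: one copy of the weight at j remains for
the summation over j. -/
theorem div_growth_mul_le (hs : ∀ i, 0 < s i) (hh : 0 < h) {A : ℝ} (hA : 0 ≤ A) {D : ℝ}
    (hD : ∀ x, (growth (stdBasis d) s (dbl s * h) x)⁻¹ ≤ D * decay x)
    (j x : EuclideanSpace ℝ (Fin d)) :
    A / (growth (stdBasis d) s h (x + j) * growth (stdBasis d) s h j) ≤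
      A * D * decay j / growth (stdBasis d) s (2 * (dbl s * h)) x := by
  have hK0 : 0 < dbl s := one_pos.trans_le (one_le_dbl hs)
  have h1 := growth_split (b := stdBasis d) hs hh (-j) (x + j)
  rw [growth_neg, growth_neg, neg_add_cancel_comm_assoc, mul_comm (growth _ _ h j)] at h1
  have p1 := growth_pos (b := stdBasis d) hs (h := dbl s * h) (by positivity) j
  have p2 := growth_pos (b := stdBasis d) hs (h := 2 * (dbl s * h)) (by positivity) x
  calc _ ≤ A / (growth (stdBasis d) s (dbl s * h) j * growth (stdBasis d) s (2 * (dbl s * h)) x) := by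
        gcongr
    _ = A * (growth (stdBasis d) s (dbl s * h) j)⁻¹ / growth (stdBasis d) s (2 * (dbl s * h)) x := by
        field_simp
    _ ≤ A * (D * decay j) / growth (stdBasis d) s (2 * (dbl s * h)) x := by
        gcongr
        exact hD j
    _ = _ := by ring

variable (L : Submodule ℤ (EuclideanSpace ℝ (Fin d))) [DiscreteTopology L] [IsZLattice ℝ L]

/-- The factor M is the same for all Φ, so this contains the continuity of S, with a loss of 2 ·
`dbl s` in h. -/
theorem zakAdj_bound (hs : ∀ i, 0 < s i) (hσ : ∀ i, 0 < σ i) (hh : 0 < h) :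
    ∃ M, 0 ≤ M ∧ ∀ {C} {Φ}, ContDiff ℝ ∞ Φ →
      HasGSBound (stdBasis₂ d) (Sum.elim s σ) (Sum.elim σ s) h C Φ →
      ContDiff ℝ ∞ (zakAdj L Φ) ∧
        HasGSBound (stdBasis d) s σ (2 * (dbl s * h)) (M * C) (zakAdj L Φ) ∧
        ∀ x, Summable fun j : L => zakAdjTerm Φ j x := by
  have hK := one_le_dbl hs
  have hK0 : 0 < dbl s := one_pos.trans_le hK
  obtain ⟨D, hD0, hD⟩ := exists_inv_growth_le (b := stdBasis d) hσ hh
  obtain ⟨D', hD'0, hD'⟩ := exists_inv_growth_le (b := stdBasis d) hs (h := dbl s * h) (by positivity)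
  obtain ⟨J, hJdef⟩ : ∃ J, J = ∫ ξ : EuclideanSpace ℝ (Fin d), D * decay ξ := ⟨_, rfl⟩
  have hJ : 0 ≤ J := hJdef ▸ integral_nonneg fun ξ => mul_nonneg hD0.le (decay_pos ξ).le
  have hsd := summable_decay L
  refine ⟨J * D' * ∑' j : L, decay (j : EuclideanSpace ℝ (Fin d)), mul_nonneg (by positivity)
    (tsum_nonneg fun j => (decay_pos _).le), fun {C} {Φ} hΦs hΦ => ?_⟩
  have hC := hΦ.nonneg (sumElim_pos hs hσ) hh
  have ht (j : L) := zakAdjTerm_bound hs hσ hh hΦs hΦ hD j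
  rw [← hJdef] at ht
  have hb (j : L) (x) : DerivBound (stdBasis d) σ h
      (C * J * D' * decay (j : EuclideanSpace ℝ (Fin d)) /
        growth (stdBasis d) s (2 * (dbl s * h)) x) (zakAdjTerm Φ j) x :=
    ((ht j).2 x).mono hh.le le_rfl (div_growth_mul_le hs hh (by positivity) hD' _ _)
  have hk : Summable fun j : L => C * J * D' * decay (j : EuclideanSpace ℝ (Fin d)) :=
    hsd.mul_left _
  have hle (j : L) (x) : C * J * D' * decay (j : EuclideanSpace ℝ (Fin d)) /
        growth (stdBasis d) s (2 * (dbl s * h)) x ≤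
        C * J * D' * decay (j : EuclideanSpace ℝ (Fin d)) := by
    have := decay_pos (j : EuclideanSpace ℝ (Fin d))
    exact div_le_self (by positivity) (one_le_growth hs (by positivity) x)
  have hF (j : L) : ContDiff ℝ ∞ (zakAdjTerm Φ j) := (ht j).1
  have h1 := contDiff_tsum_of_derivBound (T := L) (F := fun j : L => zakAdjTerm Φ j) (A := fun j x =>
    C * J * D' * decay (j : EuclideanSpace ℝ (Fin d)) / growth (stdBasis d) s (2 * (dbl s * h)) x)
    hh.le hF hk hle hb
  refine ⟨h1, fun x => ?_, fun x => ?_⟩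
  · have := derivBound_tsum (T := L) (F := fun j : L => zakAdjTerm Φ j) (A := fun j x =>
      C * J * D' * decay (j : EuclideanSpace ℝ (Fin d)) / growth (stdBasis d) s (2 * (dbl s * h)) x)
      hh.le hF hk hle hb x
      (hk.div_const (growth (stdBasis d) s (2 * (dbl s * h)) x)) fun j => le_rfl
    refine this.mono hh.le ?_ (le_of_eq ?_)
    · calc h ≤ dbl s * h := le_mul_of_one_le_left hh.le hK
        _ ≤ 2 * (dbl s * h) := le_mul_of_one_le_left (by positivity) one_le_two
    · rw [tsum_div_const, tsum_mul_left]
      ring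
  · refine Summable.of_norm_bounded hk fun j => ?_
    have := hb j x []
    simp only [List.length_nil, pow_zero, facWeight_nil, mul_one, listDeriv_nil] at this
    exact this.trans (hle j x)

end zakAdj

/-! ### Estimates for the right inverse and for the pieces of a test function -/

section window

variable {d : ℕ} {s σ : Fin d → ℝ} {h : ℝ}

/-- The factor by which the parameter `h` increases in the estimates below. -/
def loss (s σ : Fin d → ℝ) : ℝ := 3 + 2 * dbl s ^ 2 + 2 * dbl σ

theorem one_le_loss (hs : ∀ i, 0 < s i) (hσ : ∀ i, 0 < σ i) : 1 ≤ loss s σ := by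
  have h1 := one_le_dbl hs
  have h2 := one_le_dbl hσ
  have h3 : 0 ≤ dbl s ^ 2 := sq_nonneg _
  unfold loss
  linarith

/-- This is `growth_split` for x and -(x + m), whose sum is -m: functions concentrated at 0 and at
-m have a product which decays in m as well as in x. -/
theorem inv_growth_mul_le (hs : ∀ i, 0 < s i) (hh : 0 < h) {D : ℝ}
    (hD : ∀ x, (growth (stdBasis d) s (2 * (dbl s * h)) x)⁻¹ ≤ D * decay x) {h' : ℝ}
    (hle : dbl s * h ≤ h') (x m : EuclideanSpace ℝ (Fin d)) :
    (growth (stdBasis d) s h x * growth (stdBasis d) s h (x + m))⁻¹ ≤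
      D * decay m * (growth (stdBasis d) s h' x)⁻¹ := by
  have hK0 : 0 < dbl s := one_pos.trans_le (one_le_dbl hs)
  have h1 := growth_split (b := stdBasis d) hs hh x (-(x + m))
  rw [growth_neg, neg_add, add_neg_cancel_left, growth_neg] at h1
  have h2 := growth_anti (b := stdBasis d) hs (by positivity) hle x
  have p1 := growth_pos (b := stdBasis d) hs (h := 2 * (dbl s * h)) (by positivity) m
  have p2 := growth_pos (b := stdBasis d) hs (h := dbl s * h) (by positivity) x
  have p3 := growth_pos (b := stdBasis d) hs (h := h') (lt_of_lt_of_le (by positivity) hle) x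
  calc _ ≤ (growth (stdBasis d) s h' x * growth (stdBasis d) s (2 * (dbl s * h)) m)⁻¹ := by
        refine inv_anti₀ (by positivity) (le_trans ?_ h1)
        gcongr
    _ = (growth (stdBasis d) s (2 * (dbl s * h)) m)⁻¹ * (growth (stdBasis d) s h' x)⁻¹ := by
        rw [mul_inv, mul_comm]
    _ ≤ _ := by gcongr; exact hD m

/-- The weight at m on the left is the cost of the derivatives of e^{i⟨m,ξ⟩}. Since 2 (dbl s)² h =
dbl s · (2 dbl s h), the weight at m supplied by `growth_split` contains two copies of it: one pays
for the character, the other one makes the sum over m converge. -/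
theorem growth_mul_inv_growth_mul_le (hs : ∀ i, 0 < s i) (hh : 0 < h) {D : ℝ}
    (hD : ∀ x, (growth (stdBasis d) s (2 * dbl s ^ 2 * h) x)⁻¹ ≤ D * decay x) {h' : ℝ}
    (hle : dbl s * h ≤ h') (x m : EuclideanSpace ℝ (Fin d)) :
    growth (stdBasis d) s (2 * dbl s ^ 2 * h) m *
      (growth (stdBasis d) s h x * growth (stdBasis d) s h (x + m))⁻¹ ≤
      D * decay m * (growth (stdBasis d) s h' x)⁻¹ := by
  have hK0 : 0 < dbl s := one_pos.trans_le (one_le_dbl hs)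
  have h1 := growth_split (b := stdBasis d) hs hh x (-(x + m))
  rw [growth_neg, neg_add, add_neg_cancel_left, growth_neg] at h1
  have h2 := growth_anti (b := stdBasis d) hs (by positivity) hle x
  have h3 := growth_sq_le (b := stdBasis d) hs (h := 2 * (dbl s * h)) (by positivity) m
  rw [show dbl s * (2 * (dbl s * h)) = 2 * dbl s ^ 2 * h by ring] at h3
  have p1 := growth_pos (b := stdBasis d) hs (h := 2 * dbl s ^ 2 * h) (by positivity) m
  have p2 := growth_pos (b := stdBasis d) hs (h := dbl s * h) (by positivity) x
  have p3 := growth_pos (b := stdBasis d) hs (h := h') (lt_of_lt_of_le (by positivity) hle) x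
  have p4 := growth_pos (b := stdBasis d) hs (h := 2 * (dbl s * h)) (by positivity) m
  calc _ ≤ growth (stdBasis d) s (2 * dbl s ^ 2 * h) m * (growth (stdBasis d) s h' x *
        (growth (stdBasis d) s (2 * dbl s ^ 2 * h) m * growth (stdBasis d) s (2 * dbl s ^ 2 * h) m))⁻¹ := by
        refine mul_le_mul_of_nonneg_left (inv_anti₀ (by positivity) (le_trans ?_ h1)) p1.le
        gcongr
    _ = (growth (stdBasis d) s (2 * dbl s ^ 2 * h) m)⁻¹ * (growth (stdBasis d) s h' x)⁻¹ := by
        field_simp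
    _ ≤ _ := by gcongr; exact hD m

variable {g γ : EuclideanSpace ℝ (Fin d) → ℂ}
  {H : EuclideanSpace ℝ (Fin d) × EuclideanSpace ℝ (Fin d) → ℂ}

/-- The function `(x, ξ) ↦ g(x) γ(ξ) e^{i⟪m, ξ⟫} H(x, ξ)`. -/
def windowed (g γ : EuclideanSpace ℝ (Fin d) → ℂ)
    (H : EuclideanSpace ℝ (Fin d) × EuclideanSpace ℝ (Fin d) → ℂ) (m : EuclideanSpace ℝ (Fin d))
    (z : EuclideanSpace ℝ (Fin d) × EuclideanSpace ℝ (Fin d)) : ℂ :=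
  g z.1 * (γ z.2 * char m z.2) * H z

theorem contDiff_windowed (hg : ContDiff ℝ ∞ g) (hγ : ContDiff ℝ ∞ γ) (hH : ContDiff ℝ ∞ H)
    (m : EuclideanSpace ℝ (Fin d)) : ContDiff ℝ ∞ (windowed g γ H m) := by
  unfold windowed
  exact ((hg.comp contDiff_fst).mul
    ((hγ.comp contDiff_snd).mul ((contDiff_char m).comp contDiff_snd))).mul hH

/-- Leibniz rule for four factors: g, γ and H contribute h each, the character contributes h₂. -/
theorem derivBound_windowed (hs : ∀ i, 0 < s i) (hσ : ∀ i, 0 < σ i) (hh : 0 < h) {h₂ : ℝ} (hh₂ : 0 < h₂)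
    (hgs : ContDiff ℝ ∞ g) (hγs : ContDiff ℝ ∞ γ) (hHs : ContDiff ℝ ∞ H) {Cg Cγ A : ℝ}
    (hg : HasGSBound (stdBasis d) s σ h Cg g) (hγ : HasGSBound (stdBasis d) σ s h Cγ γ)
    (m x ξ : EuclideanSpace ℝ (Fin d))
    (hH : DerivBound (stdBasis₂ d) (Sum.elim σ s) h A H (x, ξ)) :
    DerivBound (stdBasis₂ d) (Sum.elim σ s) (3 * h + h₂)
      (Cg / growth (stdBasis d) s h x * (Cγ / growth (stdBasis d) σ h ξ * growth (stdBasis d) s h₂ m) * A)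
      (windowed g γ H m) (x, ξ) := by
  have hp := sumElim_pos hσ hs
  have h1 : DerivBound (stdBasis d) s (h + h₂) _ (γ * char m) ξ :=
    (hγ ξ).mul hs (derivBound_char hs hh₂ m ξ) hh.le hh₂.le hγs (contDiff_char m)
  have h2 := DerivBound.comp_snd (b := stdBasis d) (σ := σ) (z := (x, ξ)) (hγs.mul (contDiff_char m)) h1
    (by positivity)
  have h3 := DerivBound.comp_fst (b' := stdBasis d) (σ' := s) (z := (x, ξ)) hgs (hg x) hh.le
  have h4 := (h3.mul hp h2 hh.le (by positivity) (hgs.comp contDiff_fst)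
    ((hγs.mul (contDiff_char m)).comp contDiff_snd)).mul hp hH (by positivity) hh.le
    ((hgs.comp contDiff_fst).mul ((hγs.mul (contDiff_char m)).comp contDiff_snd)) hHs
  exact h4.mono (by positivity) (by linarith) le_rfl

/-- A right inverse of `zakAdj`, for suitable windows `g` and `γ`. -/
def zakAdjInv (L : Submodule ℤ (EuclideanSpace ℝ (Fin d))) (g γ : EuclideanSpace ℝ (Fin d) → ℂ)
    (φ : EuclideanSpace ℝ (Fin d) → ℂ) (z : EuclideanSpace ℝ (Fin d) × EuclideanSpace ℝ (Fin d)) : ℂ :=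
  ∑' m : L, windowed g γ (fun z => φ (z.1 + m)) m z

variable (L L' : Submodule ℤ (EuclideanSpace ℝ (Fin d))) [DiscreteTopology L] [IsZLattice ℝ L]
  [DiscreteTopology L'] [IsZLattice ℝ L']

/-- The product g(x) φ(x + m) decays in m fast enough to outweigh the derivatives of the character
e^{i⟨m,ξ⟩}. -/
theorem zakAdjInv_bound (hs : ∀ i, 0 < s i) (hσ : ∀ i, 0 < σ i) (hh : 0 < h)
    (hgs : ContDiff ℝ ∞ g) (hγs : ContDiff ℝ ∞ γ) {Cg Cγ : ℝ}
    (hg : HasGSBound (stdBasis d) s σ h Cg g) (hγ : HasGSBound (stdBasis d) σ s h Cγ γ) :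
    ∃ M, 0 ≤ M ∧ ∀ {C} {φ}, ContDiff ℝ ∞ φ → HasGSBound (stdBasis d) s σ h C φ →
      ContDiff ℝ ∞ (zakAdjInv L g γ φ) ∧
      HasGSBound (stdBasis₂ d) (Sum.elim s σ) (Sum.elim σ s) (loss s σ * h) (M * C) (zakAdjInv L g γ φ) ∧
      ∀ z, Summable fun m : L => windowed g γ (fun z => φ (z.1 + m)) m z := by
  have hK := one_le_dbl hs
  have hK0 : 0 < dbl s := one_pos.trans_le hK
  have hKσ := one_le_dbl hσ
  have hl := one_le_loss hs hσ
  have hl0 : 0 < loss s σ := one_pos.trans_le hl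
  have hle1 : dbl s * h ≤ loss s σ * h := by
    refine mul_le_mul_of_nonneg_right ?_ hh.le
    unfold loss
    nlinarith
  -- The left side is the derivative parameter of `derivBound_windowed` with h₂ = 2 (dbl s)² h.
  have hle2 : 3 * h + 2 * dbl s ^ 2 * h ≤ loss s σ * h := by
    rw [← add_mul]
    refine mul_le_mul_of_nonneg_right ?_ hh.le
    unfold loss
    nlinarith
  have hle3 : h ≤ loss s σ * h := le_mul_of_one_le_left hh.le hl
  obtain ⟨D, hD0, hD⟩ := exists_inv_growth_le (b := stdBasis d) hs (h := 2 * dbl s ^ 2 * h) (by positivity)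
  have hCg := hg.nonneg hs hh
  have hCγ := hγ.nonneg hσ hh
  have hsd := summable_decay L
  refine ⟨Cg * Cγ * D * ∑' j : L, decay (j : EuclideanSpace ℝ (Fin d)), mul_nonneg (by positivity)
    (tsum_nonneg fun j => (decay_pos _).le), fun {C} {φ} hφs hφ => ?_⟩
  have hC := hφ.nonneg hs hh
  have hshift (m : EuclideanSpace ℝ (Fin d)) : ContDiff ℝ ∞ fun x => φ (x + m) :=
    hφs.comp (contDiff_id.add contDiff_const)
  have hF (m : L) : ContDiff ℝ ∞ (windowed g γ (fun z => φ (z.1 + m)) m) :=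
    contDiff_windowed hgs hγs ((hshift m).comp contDiff_fst) m
  have hb (m : L) (z) : DerivBound (stdBasis₂ d) (Sum.elim σ s) (loss s σ * h)
      (Cg * Cγ * D * C * decay (m : EuclideanSpace ℝ (Fin d)) *
        (growth (stdBasis₂ d) (Sum.elim s σ) (loss s σ * h) z)⁻¹)
      (windowed g γ (fun z => φ (z.1 + m)) m) z := by
    obtain ⟨x, ξ⟩ := z
    have h1 := DerivBound.comp_fst (b' := stdBasis d) (σ' := s) (z := (x, ξ)) (hshift m)
      (DerivBound.comp_add (hφ (x + m))) hh.le
    have h2 := derivBound_windowed hs hσ hh (h₂ := 2 * dbl s ^ 2 * h) (by positivity) hgs hγs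
      ((hshift m).comp contDiff_fst) hg hγ m x ξ h1
    refine h2.mono (by positivity) hle2 ?_
    have h3 := growth_mul_inv_growth_mul_le hs hh hD hle1 x m
    have h4 := growth_anti (b := stdBasis d) hσ hh hle3 ξ
    have p1 := growth_pos (b := stdBasis d) hσ hh ξ
    have p2 := growth_pos (b := stdBasis d) hσ (h := loss s σ * h) (by positivity) ξ
    rw [growth_prod hs hσ (by positivity), mul_inv]
    calc _ = Cg * Cγ * C * (growth (stdBasis d) s (2 * dbl s ^ 2 * h) m *
        (growth (stdBasis d) s h x * growth (stdBasis d) s h (x + m))⁻¹) *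
        (growth (stdBasis d) σ h ξ)⁻¹ := by
          rw [mul_inv]; simp only [div_eq_mul_inv]; ring
      _ ≤ Cg * Cγ * C * (D * decay (m : EuclideanSpace ℝ (Fin d)) *
          (growth (stdBasis d) s (loss s σ * h) x)⁻¹) * (growth (stdBasis d) σ (loss s σ * h) ξ)⁻¹ := by
          have := growth_pos (b := stdBasis d) hs (h := loss s σ * h) (by positivity) x
          have := decay_pos (m : EuclideanSpace ℝ (Fin d))
          gcongr
      _ = _ := by ring
  have hk : Summable fun m : L => Cg * Cγ * D * C * decay (m : EuclideanSpace ℝ (Fin d)) :=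
    hsd.mul_left _
  have hlek (m : L) (z) : Cg * Cγ * D * C * decay (m : EuclideanSpace ℝ (Fin d)) *
        (growth (stdBasis₂ d) (Sum.elim s σ) (loss s σ * h) z)⁻¹ ≤
        Cg * Cγ * D * C * decay (m : EuclideanSpace ℝ (Fin d)) := by
    have := decay_pos (m : EuclideanSpace ℝ (Fin d))
    exact mul_le_of_le_one_right (by positivity)
      (inv_le_one_of_one_le₀ (one_le_growth (sumElim_pos hs hσ) (by positivity) z))
  have h1 := contDiff_tsum_of_derivBound (T := L)
    (F := fun m : L => windowed g γ (fun z => φ (z.1 + m)) m)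
    (A := fun m z => Cg * Cγ * D * C * decay (m : EuclideanSpace ℝ (Fin d)) *
        (growth (stdBasis₂ d) (Sum.elim s σ) (loss s σ * h) z)⁻¹)
    (by positivity) hF hk hlek hb
  refine ⟨h1, fun z => ?_, fun z => ?_⟩
  · have := derivBound_tsum (T := L)
      (F := fun m : L => windowed g γ (fun z => φ (z.1 + m)) m)
      (A := fun m z => Cg * Cγ * D * C * decay (m : EuclideanSpace ℝ (Fin d)) *
        (growth (stdBasis₂ d) (Sum.elim s σ) (loss s σ * h) z)⁻¹)
      (by positivity) hF hk hlek hb z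
      (hk.mul_right (growth (stdBasis₂ d) (Sum.elim s σ) (loss s σ * h) z)⁻¹) fun j => le_rfl
    refine this.mono (by positivity) le_rfl (le_of_eq ?_)
    rw [tsum_mul_right, tsum_mul_left, div_eq_mul_inv]
    ring
  · refine Summable.of_norm_bounded hk fun m => ?_
    have := hb m z []
    simp only [List.length_nil, pow_zero, facWeight_nil, mul_one, listDeriv_nil] at this
    exact this.trans (hlek m z)

variable {Φ : EuclideanSpace ℝ (Fin d) × EuclideanSpace ℝ (Fin d) → ℂ}

/-- The piece `g(x - k) γ(ξ - κ) Φ(x, ξ)` of `Φ`. -/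
def piece (g γ : EuclideanSpace ℝ (Fin d) → ℂ)
    (Φ : EuclideanSpace ℝ (Fin d) × EuclideanSpace ℝ (Fin d) → ℂ) (k κ : EuclideanSpace ℝ (Fin d))
    (z : EuclideanSpace ℝ (Fin d) × EuclideanSpace ℝ (Fin d)) : ℂ :=
  g (z.1 - k) * γ (z.2 - κ) * Φ z

theorem contDiff_piece (hg : ContDiff ℝ ∞ g) (hγ : ContDiff ℝ ∞ γ) (hΦ : ContDiff ℝ ∞ Φ)
    (k κ : EuclideanSpace ℝ (Fin d)) : ContDiff ℝ ∞ (piece g γ Φ k κ) := by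
  unfold piece
  exact ((hg.comp (contDiff_fst.sub contDiff_const)).mul (hγ.comp (contDiff_snd.sub contDiff_const))).mul hΦ

theorem decay_neg {V : Type*} [NormedAddCommGroup V] [NormedSpace ℝ V] (x : V) :
    decay (-x) = decay x := by simp [decay]

/-- Bounds for `piece` and for its image under the translations by `-k` and `-κ`, modulated by
`e^{i⟪k, ξ⟫}`. -/
theorem piece_bound (hs : ∀ i, 0 < s i) (hσ : ∀ i, 0 < σ i) (hh : 0 < h)
    (hgs : ContDiff ℝ ∞ g) (hγs : ContDiff ℝ ∞ γ) (hΦs : ContDiff ℝ ∞ Φ) {Cg Cγ C : ℝ}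
    (hg : HasGSBound (stdBasis d) s σ h Cg g) (hγ : HasGSBound (stdBasis d) σ s h Cγ γ)
    (hΦ : HasGSBound (stdBasis₂ d) (Sum.elim s σ) (Sum.elim σ s) h C Φ) :
    ∃ M, 0 ≤ M ∧ ∀ (k κ : EuclideanSpace ℝ (Fin d)),
      HasGSBound (stdBasis₂ d) (Sum.elim s σ) (Sum.elim σ s) (loss s σ * h) (M * (decay k * decay κ))
        (piece g γ Φ k κ) ∧
      HasGSBound (stdBasis₂ d) (Sum.elim s σ) (Sum.elim σ s) (loss s σ * h) (M * (decay k * decay κ))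
        (windowed g γ (fun z => Φ (z + (k, κ))) k) := by
  have hK := one_le_dbl hs
  have hK0 : 0 < dbl s := one_pos.trans_le hK
  have hKσ := one_le_dbl hσ
  have hl := one_le_loss hs hσ
  have hl0 : 0 < loss s σ := one_pos.trans_le hl
  have hle1 : dbl s * h ≤ loss s σ * h := by
    refine mul_le_mul_of_nonneg_right ?_ hh.le
    unfold loss
    nlinarith
  have hle1' : dbl σ * h ≤ loss s σ * h := by
    refine mul_le_mul_of_nonneg_right ?_ hh.le
    unfold loss
    nlinarith
  have hle2 : 3 * h + 2 * dbl s ^ 2 * h ≤ loss s σ * h := by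
    rw [← add_mul]
    refine mul_le_mul_of_nonneg_right ?_ hh.le
    unfold loss
    nlinarith
  obtain ⟨D, hD0, hD⟩ := exists_inv_growth_le (b := stdBasis d) hs (h := 2 * dbl s ^ 2 * h) (by positivity)
  obtain ⟨D₁, hD₁0, hD₁⟩ := exists_inv_growth_le (b := stdBasis d) hs (h := 2 * (dbl s * h)) (by positivity)
  obtain ⟨D', hD'0, hD'⟩ := exists_inv_growth_le (b := stdBasis d) hσ (h := 2 * (dbl σ * h)) (by positivity)
  have hCg := hg.nonneg hs hh
  have hCγ := hγ.nonneg hσ hh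
  have hC := hΦ.nonneg (sumElim_pos hs hσ) hh
  have hp := sumElim_pos hσ hs
  have g1 (x) := growth_pos (b := stdBasis d) hs (h := loss s σ * h) (by positivity) x
  have g2 (x) := growth_pos (b := stdBasis d) hσ (h := loss s σ * h) (by positivity) x
  have g3 (x) := growth_pos (b := stdBasis d) hs hh x
  have g4 (x) := growth_pos (b := stdBasis d) hσ hh x
  have hshift (k κ : EuclideanSpace ℝ (Fin d)) : ContDiff ℝ ∞ fun z => Φ (z + (k, κ)) :=
    hΦs.comp (contDiff_id.add contDiff_const)
  have hmod (k κ x ξ) := derivBound_windowed hs hσ hh (h₂ := 2 * dbl s ^ 2 * h) (by positivity) hgs hγs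
      (hshift k κ) hg hγ k x ξ (DerivBound.comp_add (hΦ ((x, ξ) + (k, κ))))
  -- D₁ belongs to the piece itself and D to its modulated translate, where the character has to be
  -- paid for; their sum serves for both. D' accounts for the variable ξ.
  refine ⟨Cg * Cγ * C * (D + D₁) * D', by positivity, fun k κ => ⟨?_, ?_⟩⟩ <;> rintro ⟨x, ξ⟩
  · have h1 : DerivBound (stdBasis d) σ h (Cg / growth (stdBasis d) s h (x + -k)) (fun x => g (x + -k)) x :=
      DerivBound.comp_add (hg (x + -k))
    have h2 : DerivBound (stdBasis d) s h (Cγ / growth (stdBasis d) σ h (ξ + -κ)) (fun x => γ (x + -κ)) ξ :=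
      DerivBound.comp_add (hγ (ξ + -κ))
    have c1 : ContDiff ℝ ∞ fun x => g (x + -k) := hgs.comp (contDiff_id.add contDiff_const)
    have c2 : ContDiff ℝ ∞ fun x => γ (x + -κ) := hγs.comp (contDiff_id.add contDiff_const)
    have h3 := ((DerivBound.comp_fst (b' := stdBasis d) (σ' := s) (z := (x, ξ)) c1 h1 hh.le).mul hp
      (DerivBound.comp_snd (b := stdBasis d) (σ := σ) (z := (x, ξ)) c2 h2 hh.le) hh.le hh.le
      (c1.comp contDiff_fst) (c2.comp contDiff_snd)).mul hp (hΦ (x, ξ)) (by positivity) hh.le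
      ((c1.comp contDiff_fst).mul (c2.comp contDiff_snd)) hΦs
    have e : piece g γ Φ k κ = ((fun z : EuclideanSpace ℝ (Fin d) × EuclideanSpace ℝ (Fin d) =>
        g (z.1 + -k)) * fun z => γ (z.2 + -κ)) * Φ := by
      ext z
      simp [piece, sub_eq_add_neg]
    rw [e]
    refine h3.mono (by positivity) (by nlinarith) ?_
    have i1 := inv_growth_mul_le hs hh hD₁ hle1 x (-k)
    have i2 := inv_growth_mul_le hσ hh hD' hle1' ξ (-κ)
    rw [decay_neg] at i1 i2
    have := decay_pos k
    have := decay_pos κ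
    rw [growth_prod hs hσ (h := loss s σ * h) (by positivity), growth_prod hs hσ hh]
    calc _ = Cg * Cγ * C * (growth (stdBasis d) s h x * growth (stdBasis d) s h (x + -k))⁻¹ *
        (growth (stdBasis d) σ h ξ * growth (stdBasis d) σ h (ξ + -κ))⁻¹ := by
          have := g3 x
          have := g3 (x + -k)
          have := g4 ξ
          have := g4 (ξ + -κ)
          field_simp
      _ ≤ Cg * Cγ * C * (D₁ * decay k * (growth (stdBasis d) s (loss s σ * h) x)⁻¹) *
          (D' * decay κ * (growth (stdBasis d) σ (loss s σ * h) ξ)⁻¹) := by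
          have := g1 x
          have := g3 x
          have := g3 (x + -k)
          have := g4 ξ
          have := g4 (ξ + -κ)
          gcongr
      _ = Cg * Cγ * C * D₁ * D' * (decay k * decay κ) / (growth (stdBasis d) s (loss s σ * h) x *
          growth (stdBasis d) σ (loss s σ * h) ξ) := by
          have := g1 x
          have := g2 ξ
          field_simp
      _ ≤ _ := by
          have := g1 x
          have := g2 ξ
          gcongr
          linarith
  · refine (hmod k κ x ξ).mono (by positivity) hle2 ?_
    have i1 := growth_mul_inv_growth_mul_le hs hh hD hle1 x k
    have i2 := inv_growth_mul_le hσ hh hD' hle1' ξ κ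
    have := decay_pos k
    have := decay_pos κ
    rw [growth_prod hs hσ (h := loss s σ * h) (by positivity), Prod.mk_add_mk, growth_prod hs hσ hh]
    calc _ = Cg * Cγ * C * (growth (stdBasis d) s (2 * dbl s ^ 2 * h) k *
        (growth (stdBasis d) s h x * growth (stdBasis d) s h (x + k))⁻¹) *
        (growth (stdBasis d) σ h ξ * growth (stdBasis d) σ h (ξ + κ))⁻¹ := by
          have := g3 x
          have := g3 (x + k)
          have := g4 ξ
          have := g4 (ξ + κ)
          field_simp
      _ ≤ Cg * Cγ * C * (D * decay k * (growth (stdBasis d) s (loss s σ * h) x)⁻¹) *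
          (D' * decay κ * (growth (stdBasis d) σ (loss s σ * h) ξ)⁻¹) := by
          have := g1 x
          have := g3 x
          have := g3 (x + k)
          have := g4 ξ
          have := g4 (ξ + κ)
          gcongr
      _ = Cg * Cγ * C * D * D' * (decay k * decay κ) / (growth (stdBasis d) s (loss s σ * h) x *
          growth (stdBasis d) σ (loss s σ * h) ξ) := by
          have := g1 x
          have := g2 ξ
          field_simp
      _ ≤ _ := by
          have := g1 x
          have := g2 ξ
          gcongr
          linarith

end window

/-! ### Characters of the lattice and Fourier series -/

section lattice

variable {d : ℕ} (e : Module.Basis (Fin d) ℝ (EuclideanSpace ℝ (Fin d)))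

instance : DiscreteTopology (Zak.lattice e) :=
  inferInstanceAs (DiscreteTopology (Submodule.span ℤ (Set.range e)))

instance : IsZLattice ℝ (Zak.lattice e) :=
  inferInstanceAs (IsZLattice ℝ (Submodule.span ℤ (Set.range e)))

theorem linearIndependent_dualVec : LinearIndependent ℝ (Zak.dualVec e) := by
  refine Fintype.linearIndependent_iff.2 fun c hc j => ?_
  have h1 : ⟪e j, ∑ i, c i • Zak.dualVec e i⟫ = c j * (2 * Real.pi) := by
    simp [inner_sum, inner_smul_right, Zak.inner_dualVec]
  rw [hc, inner_zero_right] at h1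
  have := Real.pi_pos
  rcases mul_eq_zero.1 h1.symm with h | h
  · exact h
  · linarith

/-- The vectors `Zak.dualVec e k` as a basis. -/
def dualBasis : Module.Basis (Fin d) ℝ (EuclideanSpace ℝ (Fin d)) :=
  basisOfLinearIndependentOfCardEqFinrank' _ (linearIndependent_dualVec e) (by simp)

@[simp] theorem coe_dualBasis : ⇑(dualBasis e) = Zak.dualVec e :=
  coe_basisOfLinearIndependentOfCardEqFinrank' _ _ _

instance : DiscreteTopology (Zak.lattice (Zak.dualVec e)) := by
  rw [← coe_dualBasis]; infer_instance

instance : IsZLattice ℝ (Zak.lattice (Zak.dualVec e)) := by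
  constructor
  rw [← coe_dualBasis]
  exact IsZLattice.span_top

theorem inner_sum_dualVec (c t : Fin d → ℝ) :
    ⟪∑ i, c i • e i, ∑ i, t i • Zak.dualVec e i⟫ = 2 * Real.pi * ∑ i, c i * t i := by
  simp only [sum_inner, inner_sum, inner_smul_left, inner_smul_right, Zak.inner_dualVec]
  simp [Finset.mul_sum]
  exact Finset.sum_congr rfl fun i _ => by ring

/-- In the coordinates of the dual basis, which contains the factor 2π, the characters given by Λ
are the exponential monomials of the standard torus ℝ^d / ℤ^d. -/
theorem char_sum_dualVec (n : Fin d → ℤ) (t : Fin d → ℝ) :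
    char (∑ i, n i • e i) (∑ i, t i • Zak.dualVec e i) =
      UnitAddTorus.mFourier n (fun i => (t i : UnitAddCircle)) := by
  have h1 : ∑ i, n i • e i = ∑ i, (n i : ℝ) • e i :=
    Finset.sum_congr rfl fun i _ => (Int.cast_smul_eq_zsmul ℝ (n i) (e i)).symm
  rw [char, h1, inner_sum_dualVec]
  simp only [UnitAddTorus.mFourier, ContinuousMap.coe_mk, fourier_coe_apply, ← Complex.exp_sum]
  congr 1
  push_cast
  simp only [Finset.mul_sum]
  exact Finset.sum_congr rfl fun i _ => by ring

theorem exists_of_mem_lattice {v : Fin d → EuclideanSpace ℝ (Fin d)} {j : EuclideanSpace ℝ (Fin d)}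
    (hj : j ∈ Zak.lattice v) : ∃ n : Fin d → ℤ, j = ∑ i, n i • v i := by
  obtain ⟨n, hn⟩ := (Submodule.mem_span_range_iff_exists_fun ℤ).1 hj
  exact ⟨n, hn.symm⟩

theorem char_eq_one {j κ : EuclideanSpace ℝ (Fin d)} (hj : j ∈ Zak.lattice e)
    (hκ : κ ∈ Zak.lattice (Zak.dualVec e)) : char j κ = 1 := by
  obtain ⟨n, rfl⟩ := exists_of_mem_lattice hj
  obtain ⟨m, rfl⟩ := exists_of_mem_lattice hκ
  have h1 : ∑ i, m i • Zak.dualVec e i = ∑ i, (m i : ℝ) • Zak.dualVec e i :=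
    Finset.sum_congr rfl fun i _ => (Int.cast_smul_eq_zsmul ℝ (m i) (Zak.dualVec e i)).symm
  rw [h1, char_sum_dualVec]
  have h2 : (fun i => ((m i : ℝ) : UnitAddCircle)) = 0 := by
    ext i
    exact (AddCircle.coe_eq_zero_iff 1).2 ⟨m i, by simp⟩
  rw [h2]
  simp [UnitAddTorus.mFourier]

theorem isAddFundamentalDomain_dual :
    IsAddFundamentalDomain (Zak.lattice (Zak.dualVec e)) (ZSpan.fundamentalDomain (dualBasis e)) := by
  have := ZSpan.isAddFundamentalDomain (dualBasis e) (volume : Measure (EuclideanSpace ℝ (Fin d)))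
  rw [coe_dualBasis] at this
  exact this

theorem isAddFundamentalDomain_lattice :
    IsAddFundamentalDomain (Zak.lattice e) (ZSpan.fundamentalDomain e) :=
  ZSpan.isAddFundamentalDomain e (volume : Measure (EuclideanSpace ℝ (Fin d)))

/-- Half a period, η = e'_k / (2 n_k), in a direction k in which the integer coordinate n_k of j is
nonzero. -/
theorem exists_char_eq_neg_one {j : EuclideanSpace ℝ (Fin d)} (hj : j ∈ Zak.lattice e) (h0 : j ≠ 0) :
    ∃ η, char j η = -1 := by
  obtain ⟨n, rfl⟩ := exists_of_mem_lattice hj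
  have h1 : ∑ i, n i • e i = ∑ i, (n i : ℝ) • e i :=
    Finset.sum_congr rfl fun i _ => (Int.cast_smul_eq_zsmul ℝ (n i) (e i)).symm
  obtain ⟨k, hk⟩ : ∃ k, n k ≠ 0 := by
    by_contra! h
    exact h0 (by simp [h])
  have hk' : (n k : ℝ) ≠ 0 := by exact_mod_cast hk
  refine ⟨∑ i, (if i = k then (2 * (n k : ℝ))⁻¹ else 0) • Zak.dualVec e i, ?_⟩
  rw [char, h1, inner_sum_dualVec]
  have : 2 * Real.pi * ∑ i, (n i : ℝ) * (if i = k then (2 * (n k : ℝ))⁻¹ else 0) = Real.pi := by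
    simp
    field_simp
  rw [this, mul_comm, Complex.exp_pi_mul_I]

instance (L : Submodule ℤ (EuclideanSpace ℝ (Fin d))) :
    VAddInvariantMeasure L (EuclideanSpace ℝ (Fin d)) volume :=
  inferInstanceAs (VAddInvariantMeasure L.toAddSubgroup (EuclideanSpace ℝ (Fin d)) volume)

open scoped Pointwise in
-- The character is periodic, so translation by η does not change its integral over a fundamental
-- domain; if the character is -1 at η, the translation also changes the sign.
theorem setIntegral_char_eq_zero {j : EuclideanSpace ℝ (Fin d)} (hj : j ∈ Zak.lattice e)
    (h0 : j ≠ 0) : ∫ ξ in ZSpan.fundamentalDomain (dualBasis e), char j ξ = 0 := by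
  obtain ⟨η, hη⟩ := exists_char_eq_neg_one e hj h0
  have hQ := isAddFundamentalDomain_dual e
  have h1 := hQ.setIntegral_eq (hQ.vadd_of_comm η) (f := char j) fun κ ξ => by
    change char j ((κ : EuclideanSpace ℝ (Fin d)) + ξ) = _
    rw [char_add_right, char_eq_one e hj κ.2, one_mul]
  have h2 : ∫ ξ in η +ᵥ ZSpan.fundamentalDomain (dualBasis e), char j ξ =
      ∫ ξ in ZSpan.fundamentalDomain (dualBasis e), char j (η + ξ) := by
    rw [← Set.image_vadd]
    exact (measurePreserving_add_left volume η).setIntegral_image_emb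
      (MeasurableEquiv.addLeft η).measurableEmbedding _ _
  rw [h2] at h1
  simp only [char_add_right, hη, neg_mul, one_mul, integral_neg] at h1
  exact self_eq_neg.1 h1

/-- The function descends to a continuous function on the torus. Its Fourier coefficients vanish,
hence are summable, and so the Fourier series represents the function. -/
theorem eq_zero_of_fourierCoeff_eq_zero {q : EuclideanSpace ℝ (Fin d) → ℂ} (hq : Continuous q)
    (hper : ∀ κ ∈ Zak.lattice (Zak.dualVec e), ∀ ξ, q (ξ + κ) = q ξ)
    (h0 : ∀ j ∈ Zak.lattice e,
      ∫ ξ in ZSpan.fundamentalDomain (dualBasis e), char j ξ * q ξ = 0) : q = 0 := by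
  let A : (Fin d → ℝ) ≃L[ℝ] EuclideanSpace ℝ (Fin d) :=
    (dualBasis e).equivFun.symm.toContinuousLinearEquiv
  have hA (t : Fin d → ℝ) : A t = ∑ i, t i • Zak.dualVec e i := by
    simp [A, Module.Basis.equivFun_symm_apply]
  let π : C(Fin d → ℝ, UnitAddTorus (Fin d)) :=
    ⟨fun t i => (t i : UnitAddCircle), continuous_pi fun i =>
      (AddCircle.continuous_mk' 1).comp (continuous_apply i)⟩
  have hπ : IsOpenQuotientMap π :=
    IsOpenQuotientMap.piMap fun _ => QuotientAddGroup.isOpenQuotientMap_mk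
  let q' : C(Fin d → ℝ, ℂ) := ⟨fun t => q (A t), hq.comp A.continuous⟩
  have hq' (s t : Fin d → ℝ) (hst : π s = π t) : q' s = q' t := by
    have h1 (i : Fin d) : ∃ m : ℤ, s i - t i = m := by
      have := congrFun hst i
      obtain ⟨m, hm⟩ := (AddCircle.coe_eq_zero_iff 1 (x := s i - t i)).1 (by
        rw [AddCircle.coe_sub]; exact sub_eq_zero.2 this)
      exact ⟨m, by simpa using hm.symm⟩
    choose m hm using h1
    have h2 : A s = A t + ∑ i, m i • Zak.dualVec e i := by
      rw [hA, hA, ← Finset.sum_add_distrib]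
      refine Finset.sum_congr rfl fun i _ => ?_
      rw [← Int.cast_smul_eq_zsmul ℝ, ← add_smul, ← hm i]
      congr 1
      ring
    change q (A s) = q (A t)
    rw [h2, hper _ (Submodule.sum_mem _ fun i _ => Submodule.smul_mem _ _
      (Submodule.subset_span ⟨i, rfl⟩))]
  let f : C(UnitAddTorus (Fin d), ℂ) := hπ.isQuotientMap.lift q' (fun s t => hq' s t)
  have hf (t : Fin d → ℝ) : f (π t) = q (A t) :=
    DFunLike.congr_fun (hπ.isQuotientMap.lift_comp q' (fun s t => hq' s t)) t
  have hcoef (n : Fin d → ℤ) : UnitAddTorus.mFourierCoeff f n = 0 := by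
    rw [UnitAddTorus.mFourierCoeff_eq_integral _ _ 0]
    -- The cubes (0,1]^d and [0,1)^d differ by a null set.
    have hset : ({x : Fin d → ℝ | ∀ i, x i ∈ Set.Ioc ((0 : Fin d → ℝ) i) ((0 : Fin d → ℝ) i + 1)} : Set _)
        =ᵐ[volume] A ⁻¹' ZSpan.fundamentalDomain (dualBasis e) := by
      have h1 : A ⁻¹' ZSpan.fundamentalDomain (dualBasis e) =
          Set.univ.pi fun i => Set.Ico ((0 : Fin d → ℝ) i) ((1 : Fin d → ℝ) i) := by
        ext t
        have h3 (i : Fin d) : (dualBasis e).repr (A t) i = t i := by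
          change (dualBasis e).equivFun ((dualBasis e).equivFun.symm t) i = t i
          rw [LinearEquiv.apply_symm_apply]
        simp [ZSpan.mem_fundamentalDomain, h3]
      have h2 : ({x : Fin d → ℝ | ∀ i, x i ∈ Set.Ioc ((0 : Fin d → ℝ) i) ((0 : Fin d → ℝ) i + 1)} : Set _)
          = Set.univ.pi fun i => Set.Ioc ((0 : Fin d → ℝ) i) ((1 : Fin d → ℝ) i) := by
        ext t
        simp
      rw [h1, h2]
      exact Measure.univ_pi_Ioc_ae_eq_Icc.trans Measure.univ_pi_Ico_ae_eq_Icc.symm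
    rw [setIntegral_congr_set hset]
    have h3 (t : Fin d → ℝ) : UnitAddTorus.mFourier (-n) (fun i => (t i : UnitAddCircle)) •
        f (fun i => (t i : UnitAddCircle)) =
        char (∑ i, (-n) i • e i) (A t) * q (A t) := by
      rw [hA, char_sum_dualVec, ← hA, ← hf, smul_eq_mul]
      rfl
    simp only [h3]
    have h4 := A.toHomeomorph.measurableEmbedding.setIntegral_map (μ := volume)
      (fun ξ => char (∑ i, (-n) i • e i) ξ * q ξ) (ZSpan.fundamentalDomain (dualBasis e))
    refine h4.symm.trans ?_
    have hH : (Measure.map A.toHomeomorph volume).IsAddHaarMeasure :=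
      A.isAddHaarMeasure_map volume
    -- The image of Lebesgue measure under A is a multiple of Lebesgue measure; the factor is
    -- irrelevant because the integral vanishes.
    rw [Measure.isAddLeftInvariant_eq_smul (Measure.map A.toHomeomorph volume)
      (volume : Measure (EuclideanSpace ℝ (Fin d))), Measure.restrict_smul]
    rw [integral_smul_nnreal_measure, h0 _ (Submodule.sum_mem _ fun i _ => Submodule.smul_mem _ _
      (Submodule.subset_span ⟨i, rfl⟩)), smul_zero]
  have hsum : Summable (UnitAddTorus.mFourierCoeff f) := by
    rw [funext hcoef]; exact summable_zero
  ext ξ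
  have h5 := UnitAddTorus.hasSum_mFourier_series_apply_of_summable hsum (π (A.symm ξ))
  simp only [hcoef, zero_smul] at h5
  have h6 := h5.unique hasSum_zero
  rwa [hf, A.apply_symm_apply] at h6

end lattice

/-! ### Unfolding of integrals over fundamental domains -/

section unfolding

variable {V : Type*} [NormedAddCommGroup V] [NormedSpace ℝ V]

/-- Peetre's inequality 1 + ‖x‖ ≤ (1 + ‖x + y‖)(1 + ‖y‖). -/
theorem decay_add_le (x y : V) :
    decay (x + y) ≤ (1 + ‖y‖) ^ (Module.finrank ℝ V + 1) * decay x := by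
  unfold decay
  rw [← div_eq_mul_inv, le_div_iff₀ (by positivity), inv_mul_le_iff₀ (by positivity), ← mul_pow]
  gcongr
  have h1 : ‖x‖ ≤ ‖x + y‖ + ‖y‖ := by simpa using norm_sub_le (x + y) y
  nlinarith [norm_nonneg (x + y), norm_nonneg y]

variable [FiniteDimensional ℝ V] (L : Submodule ℤ V) [DiscreteTopology L] [IsZLattice ℝ L]

theorem summable_decay_add (x : V) : Summable fun k : L => decay (x + k) :=
  Summable.of_nonneg_of_le (fun _ => (decay_pos _).le)
    (fun k => by rw [add_comm]; exact decay_add_le _ _) ((summable_decay L).mul_left _)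

theorem tsum_decay_add_le (x : V) : ∑' k : L, decay (x + k) ≤
    (1 + ‖x‖) ^ (Module.finrank ℝ V + 1) * ∑' k : L, decay (k : V) := by
  rw [← tsum_mul_left]
  exact (summable_decay_add L x).tsum_le_tsum (fun k => by rw [add_comm]; exact decay_add_le _ _)
    ((summable_decay L).mul_left _)

/-- The translates of Q tile the space. On the bounded set Q, Peetre's inequality gives a summable
majorant, which permits the interchange of sum and integral. -/
theorem integral_eq_setIntegral_tsum [MeasurableSpace V] [BorelSpace V] {μ : Measure V}
    [μ.IsAddHaarMeasure] [VAddInvariantMeasure L V μ] {Q : Set V} (hQ : IsAddFundamentalDomain L Q μ)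
    (hQb : Bornology.IsBounded Q) {f : V → ℂ} (hf : Continuous f) {C : ℝ}
    (hfC : ∀ x, ‖f x‖ ≤ C * decay x) :
    ∫ x, f x ∂μ = ∫ x in Q, ∑' k : L, f (x + k) ∂μ ∧
      ∫ x, f x ∂μ = ∑' k : L, ∫ x in Q, f (x + k) ∂μ := by
  have hint : Integrable f μ := ((integrable_decay μ).const_mul C).mono' hf.aestronglyMeasurable
    (Eventually.of_forall hfC)
  have h1 := hQ.integral_eq_tsum'' f hint
  have h2 : ∫ x, f x ∂μ = ∑' k : L, ∫ x in Q, f (x + k) ∂μ := by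
    rw [h1]
    refine tsum_congr fun k => ?_
    congr 1
    ext x
    rw [add_comm]
    rfl
  refine ⟨?_, h2⟩
  rw [h2]
  obtain ⟨r, hr⟩ := hQb.exists_norm_le
  have hC : 0 ≤ C := by
    have := (norm_nonneg _).trans (hfC 0)
    exact nonneg_of_mul_nonneg_left this (decay_pos 0)
  have hi (k : L) : Integrable (fun x => f (x + k)) μ := hint.comp_add_right (k : V)
  refine (integral_tsum_of_summable_integral_norm (fun k => (hi k).restrict) ?_)
  have hfin : μ Q ≠ ⊤ := ((measure_mono (subset_closure)).trans_lt hQb.isCompact_closure.measure_lt_top).ne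
  refine Summable.of_nonneg_of_le (fun k => integral_nonneg fun _ => norm_nonneg _) (fun k => ?_)
    ((summable_decay L).mul_left (C * (1 + |r|) ^ (Module.finrank ℝ V + 1) * μ.real Q))
  have hk : ∀ x ∈ Q, ‖f (x + k)‖ ≤ C * (1 + |r|) ^ (Module.finrank ℝ V + 1) * decay (k : V) := by
    intro x hx
    rw [mul_assoc]
    refine (hfC _).trans (mul_le_mul_of_nonneg_left ?_ hC)
    rw [add_comm]
    refine (decay_add_le _ _).trans ?_
    have := decay_pos (k : V)
    gcongr
    exact (hr x hx).trans (le_abs_self r)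
  have h3 := norm_setIntegral_le_of_norm_le_const (f := fun x => ‖f (x + k)‖) (μ := μ) (s := Q)
    hfin.lt_top (C := C * (1 + |r|) ^ (Module.finrank ℝ V + 1) * decay (k : V))
    (fun x hx => by rw [norm_norm]; exact hk x hx)
  refine (le_abs_self _).trans (h3.trans (le_of_eq ?_))
  ring

end unfolding

/-! ### The compositions of the transpose with its right inverse -/

section identities

variable {d : ℕ} (e : Module.Basis (Fin d) ℝ (EuclideanSpace ℝ (Fin d))) {s σ : Fin d → ℝ} {h C : ℝ}
  {Φ : EuclideanSpace ℝ (Fin d) × EuclideanSpace ℝ (Fin d) → ℂ} {g γ φ : EuclideanSpace ℝ (Fin d) → ℂ}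

/-- The volume of the fundamental domain of the dual lattice. -/
def dualVol : ℝ := volume.real (ZSpan.fundamentalDomain (dualBasis e))

theorem dualVol_pos : 0 < dualVol e := by
  refine ENNReal.toReal_pos (ZSpan.measure_fundamentalDomain_ne_zero _) ?_
  exact ((measure_mono (subset_closure)).trans_lt
    (ZSpan.fundamentalDomain_isBounded _).isCompact_closure.measure_lt_top).ne

theorem HasGSBound.exists_norm_le_decay_mul (hs : ∀ i, 0 < s i) (hσ : ∀ i, 0 < σ i) (hh : 0 < h)
    (hΦ : HasGSBound (stdBasis₂ d) (Sum.elim s σ) (Sum.elim σ s) h C Φ) :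
    ∃ D, 0 ≤ D ∧ ∀ x ξ, ‖Φ (x, ξ)‖ ≤ D * (decay x * decay ξ) := by
  have hC := hΦ.nonneg (sumElim_pos hs hσ) hh
  obtain ⟨A, hA, hA'⟩ := exists_inv_growth_le (b := stdBasis d) hs hh
  obtain ⟨B, hB, hB'⟩ := exists_inv_growth_le (b := stdBasis d) hσ hh
  refine ⟨C * (A * B), by positivity, fun x ξ => (hΦ.norm_le (x, ξ)).trans ?_⟩
  have := growth_pos (b := stdBasis d) hσ hh ξ
  have := decay_pos x
  rw [growth_prod hs hσ hh, div_eq_mul_inv, mul_inv]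
  calc _ ≤ C * ((A * decay x) * (B * decay ξ)) := by
        gcongr
        · exact hA' x
        · exact hB' ξ
    _ = _ := by ring

theorem HasGSBound.exists_norm_le_decay' {ι V : Type*} [NormedAddCommGroup V] [NormedSpace ℝ V]
    [Fintype ι] [DecidableEq ι] {b : Module.Basis ι ℝ V} {s σ : ι → ℝ} {f : V → ℂ}
    (hs : ∀ i, 0 < s i) (hh : 0 < h) (hf : HasGSBound b s σ h C f) :
    ∃ D, 0 < D ∧ ∀ x, ‖f x‖ ≤ D * decay x := by
  obtain ⟨D, hD, h1⟩ := hf.exists_norm_le_decay hs hh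
  exact ⟨D, hD, fun x => by simpa using h1 [] x⟩

/-- By unfolding, the integral is that of the Λ'-periodization over a fundamental domain. The
translates of γ add up to 1, so the periodization is the character itself, and orthogonality
applies. -/
theorem integral_window_mul_char (hγs : Continuous γ) {D : ℝ} (hD : ∀ ξ, ‖γ ξ‖ ≤ D * decay ξ)
    (hγ1 : ∀ ξ, ∑' κ : Zak.lattice (Zak.dualVec e), γ (ξ - κ) = 1) {n : EuclideanSpace ℝ (Fin d)}
    (hn : n ∈ Zak.lattice e) :
    ∫ ξ, γ ξ * char n ξ = if n = 0 then (dualVol e : ℂ) else 0 := by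
  have h1 := (integral_eq_setIntegral_tsum (Zak.lattice (Zak.dualVec e)) (isAddFundamentalDomain_dual e)
    (ZSpan.fundamentalDomain_isBounded _) (f := fun ξ => γ ξ * char n ξ)
    (hγs.mul (contDiff_char n).continuous) (C := D)
    (fun ξ => by rw [norm_mul, norm_char, mul_one]; exact hD ξ)).1
  rw [h1]
  have h2 (ξ : EuclideanSpace ℝ (Fin d)) : ∑' κ : Zak.lattice (Zak.dualVec e),
      γ (ξ + κ) * char n (ξ + κ) = char n ξ := by
    have : ∀ κ : Zak.lattice (Zak.dualVec e), γ (ξ + κ) * char n (ξ + κ) = γ (ξ + κ) * char n ξ := by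
      intro κ
      rw [char_add_right, char_eq_one e hn κ.2, mul_one]
    simp only [this]
    rw [tsum_mul_right]
    have h3 := hγ1 ξ
    rw [← (Equiv.neg (Zak.lattice (Zak.dualVec e))).tsum_eq] at h3
    simp only [Equiv.neg_apply, NegMemClass.coe_neg, sub_neg_eq_add] at h3
    rw [h3, one_mul]
  simp only [h2]
  split_ifs with h0
  · subst h0
    simp [char, dualVol]
  · exact setIntegral_char_eq_zero e hn h0

/-- `zakAdjInv` is a right inverse of `zakAdj`, up to the factor `dualVol e`. -/
theorem zakAdj_zakAdjInv (hγs : Continuous γ) {D : ℝ} (hD : ∀ ξ, ‖γ ξ‖ ≤ D * decay ξ)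
    (hγ1 : ∀ ξ, ∑' κ : Zak.lattice (Zak.dualVec e), γ (ξ - κ) = 1)
    (hg1 : ∀ x, ∑' k : Zak.lattice e, g (x - k) = 1) {D' : ℝ} (hD' : ∀ x, ‖φ x‖ ≤ D' * decay x)
    (x : EuclideanSpace ℝ (Fin d)) :
    zakAdj (Zak.lattice e) (zakAdjInv (Zak.lattice e) g γ φ) x = dualVol e * φ x := by
  have hD'0 : 0 ≤ D' := nonneg_of_mul_nonneg_left ((norm_nonneg _).trans (hD' 0)) (decay_pos 0)
  have hD0 : 0 ≤ D := nonneg_of_mul_nonneg_left ((norm_nonneg _).trans (hD 0)) (decay_pos 0)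
  have hint (n : EuclideanSpace ℝ (Fin d)) : Integrable fun ξ => γ ξ * char n ξ :=
    ((integrable_decay volume).const_mul D).mono'
      (hγs.mul (contDiff_char n).continuous).aestronglyMeasurable
      (Eventually.of_forall fun ξ => by rw [norm_mul, norm_char, mul_one]; exact hD ξ)
  have hterm (j : Zak.lattice e) : zakAdjTerm (zakAdjInv (Zak.lattice e) g γ φ) j x =
      dualVol e * φ x * g (x + j) := by
    have h1 (ξ : EuclideanSpace ℝ (Fin d)) :
        char (j : EuclideanSpace ℝ (Fin d)) ξ * zakAdjInv (Zak.lattice e) g γ φ (x + j, ξ) =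
        ∑' m : Zak.lattice e, g (x + j) * φ (x + j + m) * (γ ξ * char (j + m : EuclideanSpace ℝ (Fin d)) ξ) := by
      rw [zakAdjInv, ← tsum_mul_left]
      refine tsum_congr fun m => ?_
      rw [windowed, char_add_left]
      ring
    rw [zakAdjTerm]
    simp only [h1]
    have h2 := integral_tsum_of_summable_integral_norm (μ := volume) (F := fun (m : Zak.lattice e) ξ =>
        g (x + j) * φ (x + j + m) * (γ ξ * char (j + m : EuclideanSpace ℝ (Fin d)) ξ))
      (fun m => (hint _).const_mul _) ?_
    · rw [← h2]
      simp only [integral_const_mul]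
      -- Orthogonality leaves only m = -j, for which φ(x + j + m) = φ(x). The remaining sum of g(x +
      -- j) over j is 1.
      rw [tsum_eq_single (-j)]
      · rw [integral_window_mul_char e hγs hD hγ1 (by simp)]
        simp
        ring
      · intro m hm
        have hm' : (j + m : EuclideanSpace ℝ (Fin d)) ≠ 0 := by
          intro h0
          apply hm
          ext1
          exact (neg_eq_of_add_eq_zero_right h0).symm
        rw [integral_window_mul_char e hγs hD hγ1 ((Zak.lattice e).add_mem j.2 m.2), if_neg hm',
          mul_zero]
    · simp only [norm_mul, norm_char, mul_one]
      simp only [integral_const_mul]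
      refine Summable.mul_right _ (Summable.mul_left _ ?_)
      exact Summable.of_nonneg_of_le (fun _ => norm_nonneg _) (fun m => hD' _)
        ((summable_decay_add _ (x + j : EuclideanSpace ℝ (Fin d))).mul_left D')
  rw [zakAdj]
  simp only [hterm]
  rw [tsum_mul_left]
  have h3 := hg1 x
  rw [← (Equiv.neg (Zak.lattice e)).tsum_eq] at h3
  simp only [Equiv.neg_apply, NegMemClass.coe_neg, sub_neg_eq_add] at h3
  rw [h3, mul_one]

theorem tsum_piece {Dg Dγ : ℝ} (hg : ∀ x, ‖g x‖ ≤ Dg * decay x) (hγ : ∀ x, ‖γ x‖ ≤ Dγ * decay x)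
    (hγ1 : ∀ ξ, ∑' κ : Zak.lattice (Zak.dualVec e), γ (ξ - κ) = 1)
    (hg1 : ∀ x, ∑' k : Zak.lattice e, g (x - k) = 1)
    (z : EuclideanSpace ℝ (Fin d) × EuclideanSpace ℝ (Fin d)) :
    ∑' p : Zak.lattice e × Zak.lattice (Zak.dualVec e), piece g γ Φ p.1 p.2 z = Φ z := by
  have key {L : Submodule ℤ (EuclideanSpace ℝ (Fin d))} [DiscreteTopology L] [IsZLattice ℝ L]
      {f : EuclideanSpace ℝ (Fin d) → ℂ} {D : ℝ} (hf : ∀ x, ‖f x‖ ≤ D * decay x)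
      (x : EuclideanSpace ℝ (Fin d)) : Summable fun k : L => ‖f (x - k)‖ := by
    have h1 := (Equiv.neg L).summable_iff.2 (summable_decay_add L x)
    refine Summable.of_nonneg_of_le (fun _ => norm_nonneg _) (fun m => hf _) ((h1.congr ?_).mul_left D)
    intro k
    simp [sub_eq_add_neg]
  have h2 := tsum_mul_tsum_of_summable_norm (key (L := Zak.lattice e) hg z.1)
    (key (L := Zak.lattice (Zak.dualVec e)) hγ z.2)
  rw [hg1, hγ1, one_mul] at h2
  simp only [piece]
  rw [tsum_mul_right, ← h2, one_mul]

/-- The shift j ↦ j + k of the summation index. Together with the next lemma, this makes all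
functionals u ∘ S quasi-periodic. -/
theorem zakAdj_translate {k : EuclideanSpace ℝ (Fin d)} (hk : k ∈ Zak.lattice e)
    {Φ₁ Φ₂ : EuclideanSpace ℝ (Fin d) × EuclideanSpace ℝ (Fin d) → ℂ}
    (h1 : ∀ x ξ, Φ₁ (x, ξ) = Φ (x - k, ξ)) (h2 : ∀ x ξ, Φ₂ (x, ξ) = char k ξ * Φ (x, ξ)) :
    zakAdj (Zak.lattice e) Φ₁ = zakAdj (Zak.lattice e) Φ₂ := by
  ext x
  rw [zakAdj, zakAdj, ← (Equiv.addRight (⟨k, hk⟩ : Zak.lattice e)).tsum_eq]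
  refine tsum_congr fun j => ?_
  simp only [zakAdjTerm, h1, h2, Equiv.coe_addRight, Submodule.coe_add, char_add_left]
  congr 1
  ext ξ
  rw [show x + ((j : EuclideanSpace ℝ (Fin d)) + k) - k = x + j by abel]
  ring

/-- Substitution ξ ↦ ξ + κ in the integrals, using e^{i⟨j,κ⟩} = 1. -/
theorem zakAdj_translate_right {κ : EuclideanSpace ℝ (Fin d)} (hκ : κ ∈ Zak.lattice (Zak.dualVec e))
    {Φ₁ : EuclideanSpace ℝ (Fin d) × EuclideanSpace ℝ (Fin d) → ℂ}
    (h1 : ∀ x ξ, Φ₁ (x, ξ) = Φ (x, ξ - κ)) :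
    zakAdj (Zak.lattice e) Φ₁ = zakAdj (Zak.lattice e) Φ := by
  ext x
  refine tsum_congr fun j => ?_
  simp only [zakAdjTerm, h1]
  rw [← integral_add_right_eq_self _ κ]
  simp only [add_sub_cancel_right, char_add_right, char_eq_one e j.2 hκ, mul_one]

theorem setIntegral_char_mul_tsum_char {a : Zak.lattice e → ℂ} (ha : Summable fun m => ‖a m‖)
    {n : EuclideanSpace ℝ (Fin d)} (hn : n ∈ Zak.lattice e) :
    ∫ ξ in ZSpan.fundamentalDomain (dualBasis e), char n ξ *
      ∑' m : Zak.lattice e, a m * char (m : EuclideanSpace ℝ (Fin d)) ξ =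
    dualVol e * a ⟨-n, (Zak.lattice e).neg_mem hn⟩ := by
  have hQb := ZSpan.fundamentalDomain_isBounded (dualBasis e)
  have h1 (ξ) : char n ξ * ∑' m : Zak.lattice e, a m * char (m : EuclideanSpace ℝ (Fin d)) ξ =
      ∑' m : Zak.lattice e, a m * char (n + m : EuclideanSpace ℝ (Fin d)) ξ := by
    rw [← tsum_mul_left]
    refine tsum_congr fun m => ?_
    rw [char_add_left]; ring
  simp only [h1]
  have hi (m : Zak.lattice e) : IntegrableOn (fun ξ => a m *
      char (n + m : EuclideanSpace ℝ (Fin d)) ξ) (ZSpan.fundamentalDomain (dualBasis e)) :=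
    ((continuous_const.mul (contDiff_char _).continuous).continuousOn.integrableOn_compact
      hQb.isCompact_closure).mono_set subset_closure
  rw [← integral_tsum_of_summable_integral_norm hi]
  · simp only [integral_const_mul]
    rw [tsum_eq_single (⟨-n, (Zak.lattice e).neg_mem hn⟩ : Zak.lattice e)]
    · simp [char, dualVol]
      ring
    · intro m hm
      have hm' : (n + m : EuclideanSpace ℝ (Fin d)) ≠ 0 := by
        intro h0
        apply hm
        ext1
        exact (neg_eq_of_add_eq_zero_right h0).symm
      rw [setIntegral_char_eq_zero e ((Zak.lattice e).add_mem hn m.2) hm', mul_zero]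
  · simp only [norm_mul, norm_char, mul_one]
    simp only [integral_const]
    exact Summable.mul_left _ ha

/-! ### Poisson summation -/

section poisson

variable {D : ℝ}

/-- By Peetre's inequality the bound is uniform for ξ in a ball; it makes the quasi-periodization
converge locally uniformly. -/
theorem norm_char_mul_le (hD : ∀ x ξ, ‖Φ (x, ξ)‖ ≤ D * (decay x * decay ξ))
    (j x ξ κ : EuclideanSpace ℝ (Fin d)) {R : ℝ} (hξ : ‖ξ‖ ≤ R) :
    ‖char j ξ * Φ (x + j, ξ + κ)‖ ≤ D *
      (1 + R) ^ (Module.finrank ℝ (EuclideanSpace ℝ (Fin d)) + 1) * (decay (x + j) * decay κ) := by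
  have hD0 : 0 ≤ D := nonneg_of_mul_nonneg_left ((norm_nonneg _).trans (hD 0 0))
    (mul_pos (decay_pos 0) (decay_pos 0))
  rw [norm_mul, norm_char, one_mul]
  refine (hD _ _).trans ?_
  have h1 : decay (ξ + κ) ≤
      (1 + ‖ξ‖) ^ (Module.finrank ℝ (EuclideanSpace ℝ (Fin d)) + 1) * decay κ := by
    rw [add_comm]; exact decay_add_le _ _
  have p1 := decay_pos (x + j)
  have p2 := decay_pos κ
  rw [mul_assoc, mul_left_comm (_ ^ _) (decay (x + j))]
  refine mul_le_mul_of_nonneg_left (mul_le_mul_of_nonneg_left ?_ p1.le) hD0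
  exact h1.trans (by gcongr)

theorem summable_decay_mul_decay (x : EuclideanSpace ℝ (Fin d)) :
    Summable fun p : Zak.lattice e × Zak.lattice (Zak.dualVec e) =>
      decay (x + p.1) * decay (p.2 : EuclideanSpace ℝ (Fin d)) :=
  Summable.mul_of_nonneg (f := fun k : Zak.lattice e => decay (x + k))
    (g := fun κ : Zak.lattice (Zak.dualVec e) => decay (κ : EuclideanSpace ℝ (Fin d)))
    (summable_decay_add _ x) (summable_decay _) (fun _ => (decay_pos _).le)
    (fun _ => (decay_pos _).le)

theorem summable_char_mul (hD : ∀ x ξ, ‖Φ (x, ξ)‖ ≤ D * (decay x * decay ξ))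
    (x ξ : EuclideanSpace ℝ (Fin d)) :
    Summable fun p : Zak.lattice e × Zak.lattice (Zak.dualVec e) =>
      char (p.1 : EuclideanSpace ℝ (Fin d)) ξ * Φ (x + p.1, ξ + p.2) :=
  Summable.of_norm_bounded ((summable_decay_mul_decay e x).mul_left _)
    fun p => norm_char_mul_le hD p.1 x ξ p.2 le_rfl

theorem continuous_tsum_char_mul (hΦs : Continuous Φ)
    (hD : ∀ x ξ, ‖Φ (x, ξ)‖ ≤ D * (decay x * decay ξ)) (x : EuclideanSpace ℝ (Fin d)) :
    Continuous fun ξ => ∑' p : Zak.lattice e × Zak.lattice (Zak.dualVec e),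
      char (p.1 : EuclideanSpace ℝ (Fin d)) ξ * Φ (x + p.1, ξ + p.2) := by
  refine continuous_iff_continuousAt.2 fun ξ₀ => ?_
  have h1 : ContinuousOn (fun ξ => ∑' p : Zak.lattice e × Zak.lattice (Zak.dualVec e),
      char (p.1 : EuclideanSpace ℝ (Fin d)) ξ * Φ (x + p.1, ξ + p.2))
      (Metric.ball 0 (‖ξ₀‖ + 1)) := by
    refine continuousOn_tsum (fun p => Continuous.continuousOn ?_)
      ((summable_decay_mul_decay e x).mul_left (D * (1 + (‖ξ₀‖ + 1)) ^
        (Module.finrank ℝ (EuclideanSpace ℝ (Fin d)) + 1)))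
      (fun p ξ hξ => norm_char_mul_le hD p.1 x ξ p.2 ?_)
    · exact (contDiff_char _).continuous.mul
        (hΦs.comp (continuous_const.prodMk (continuous_id.add continuous_const)))
    · rw [Metric.mem_ball, dist_zero_right] at hξ
      exact hξ.le
  exact h1.continuousAt (Metric.isOpen_ball.mem_nhds (by simp))

/-- The character with index n + k is Λ'-periodic, so the sum over κ unfolds the integral over the
fundamental domain to an integral over the whole space. What remains is the sum defining S Φ(x - n),
with summation index k + n. -/
theorem setIntegral_char_mul_tsum (hΦs : Continuous Φ)
    (hD : ∀ x ξ, ‖Φ (x, ξ)‖ ≤ D * (decay x * decay ξ)) (x : EuclideanSpace ℝ (Fin d))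
    {n : EuclideanSpace ℝ (Fin d)} (hn : n ∈ Zak.lattice e) :
    ∫ ξ in ZSpan.fundamentalDomain (dualBasis e), char n ξ *
      ∑' p : Zak.lattice e × Zak.lattice (Zak.dualVec e),
        char (p.1 : EuclideanSpace ℝ (Fin d)) ξ * Φ (x + p.1, ξ + p.2) =
    zakAdj (Zak.lattice e) Φ (x - n) := by
  have hD0 : 0 ≤ D := nonneg_of_mul_nonneg_left ((norm_nonneg _).trans (hD 0 0))
    (mul_pos (decay_pos 0) (decay_pos 0))
  have hQb := ZSpan.fundamentalDomain_isBounded (dualBasis e)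
  have hfin : volume (ZSpan.fundamentalDomain (dualBasis e)) ≠ ⊤ :=
    ((measure_mono (subset_closure)).trans_lt hQb.isCompact_closure.measure_lt_top).ne
  have hQm := ZSpan.fundamentalDomain_measurableSet (dualBasis e)
  obtain ⟨r, hr⟩ := hQb.exists_norm_le
  let f (k : Zak.lattice e) (ξ : EuclideanSpace ℝ (Fin d)) : ℂ :=
    char (n + k : EuclideanSpace ℝ (Fin d)) ξ * Φ (x + k, ξ)
  have hfc (k) : Continuous (f k) := (contDiff_char _).continuous.mul
    (hΦs.comp (continuous_const.prodMk continuous_id))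
  have hfle (k ξ) : ‖f k ξ‖ ≤ D * decay (x + k) * decay ξ := by
    simp only [f]
    rw [norm_mul, norm_char, one_mul, mul_assoc]
    exact hD _ _
  have h1 (ξ) : char n ξ * ∑' p : Zak.lattice e × Zak.lattice (Zak.dualVec e),
      char (p.1 : EuclideanSpace ℝ (Fin d)) ξ * Φ (x + p.1, ξ + p.2) =
      ∑' k : Zak.lattice e, ∑' κ : Zak.lattice (Zak.dualVec e), f k (ξ + κ) := by
    rw [(summable_char_mul e hD x ξ).tsum_prod, ← tsum_mul_left]
    refine tsum_congr fun k => ?_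
    rw [← tsum_mul_left]
    refine tsum_congr fun κ => ?_
    simp only [f]
    rw [char_add_right, char_eq_one e ((Zak.lattice e).add_mem hn k.2) κ.2, mul_one, char_add_left]
    ring
  have hsk (k ξ) : Summable fun κ : Zak.lattice (Zak.dualVec e) => ‖f k (ξ + κ)‖ :=
    Summable.of_nonneg_of_le (fun _ => norm_nonneg _) (fun κ => hfle k _)
      ((summable_decay_add (Zak.lattice (Zak.dualVec e)) ξ).mul_left _)
  obtain ⟨T, hT⟩ : ∃ T : ℝ, ∀ ξ ∈ ZSpan.fundamentalDomain (dualBasis e),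
      ∑' κ : Zak.lattice (Zak.dualVec e), decay (ξ + κ) ≤ T := by
    refine ⟨(1 + |r|) ^ (Module.finrank ℝ (EuclideanSpace ℝ (Fin d)) + 1) *
      ∑' κ : Zak.lattice (Zak.dualVec e), decay (κ : EuclideanSpace ℝ (Fin d)), fun ξ hξ =>
      (tsum_decay_add_le _ ξ).trans ?_⟩
    refine mul_le_mul_of_nonneg_right ?_ (tsum_nonneg fun κ => (decay_pos _).le)
    gcongr
    exact (hr ξ hξ).trans (le_abs_self r)
  have hbd (k ξ) (hξ : ξ ∈ ZSpan.fundamentalDomain (dualBasis e)) :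
      ‖∑' κ : Zak.lattice (Zak.dualVec e), f k (ξ + κ)‖ ≤ D * decay (x + k) * T := by
    refine (norm_tsum_le_tsum_norm (hsk k ξ)).trans ?_
    refine ((hsk k ξ).tsum_le_tsum (fun κ => hfle k _)
      ((summable_decay_add (Zak.lattice (Zak.dualVec e)) ξ).mul_left _)).trans ?_
    rw [tsum_mul_left]
    exact mul_le_mul_of_nonneg_left (hT ξ hξ) (mul_nonneg hD0 (decay_pos _).le)
  have hcont (k) : AEStronglyMeasurable (fun ξ => ∑' κ : Zak.lattice (Zak.dualVec e), f k (ξ + κ))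
      (volume.restrict (ZSpan.fundamentalDomain (dualBasis e))) := by
    refine aestronglyMeasurable_of_tendsto_ae atTop
      (f := fun (t : Finset (Zak.lattice (Zak.dualVec e))) ξ => ∑ κ ∈ t, f k (ξ + κ))
      (fun t => ?_) (Eventually.of_forall fun ξ => (hsk k ξ).of_norm.hasSum)
    exact (continuous_finsetSum _ fun κ _ =>
      (hfc k).comp (continuous_id.add continuous_const)).aestronglyMeasurable
  have hi (k) : IntegrableOn (fun ξ => ∑' κ : Zak.lattice (Zak.dualVec e), f k (ξ + κ))
      (ZSpan.fundamentalDomain (dualBasis e)) :=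
    ⟨hcont k, HasFiniteIntegral.restrict_of_bounded (D * decay (x + k) * T) hfin.lt_top
      ((ae_restrict_mem hQm).mono fun ξ hξ => hbd k ξ hξ)⟩
  simp only [h1]
  rw [← integral_tsum_of_summable_integral_norm hi]
  · have h2 (k) : ∫ ξ in ZSpan.fundamentalDomain (dualBasis e),
        ∑' κ : Zak.lattice (Zak.dualVec e), f k (ξ + κ) = ∫ ξ, f k ξ :=
      (integral_eq_setIntegral_tsum _ (isAddFundamentalDomain_dual e) hQb (hfc k) (hfle k)).1.symm
    simp only [h2]
    rw [zakAdj, ← (Equiv.addRight (⟨n, hn⟩ : Zak.lattice e)).tsum_eq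
      (fun j : Zak.lattice e => zakAdjTerm Φ (j : EuclideanSpace ℝ (Fin d)) (x - n))]
    refine tsum_congr fun k => ?_
    simp only [zakAdjTerm, f, Equiv.coe_addRight, Submodule.coe_add]
    congr 1
    ext ξ
    rw [add_comm n, show x - n + ((k : EuclideanSpace ℝ (Fin d)) + n) = x + k by abel]
  · refine Summable.of_nonneg_of_le (fun k => integral_nonneg fun _ => norm_nonneg _) (fun k => ?_)
      ((summable_decay_add (Zak.lattice e) x).mul_left
        (D * T * volume.real (ZSpan.fundamentalDomain (dualBasis e))))
    have h3 := norm_setIntegral_le_of_norm_le_const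
      (f := fun ξ => ‖∑' κ : Zak.lattice (Zak.dualVec e), f k (ξ + κ)‖) (μ := volume) hfin.lt_top
      (fun ξ hξ => by rw [norm_norm]; exact hbd k ξ hξ)
    refine (le_abs_self _).trans (h3.trans (le_of_eq ?_))
    ring

/-- Poisson summation: the quasi-periodization of `Φ` in terms of `zakAdj Φ`. -/
theorem tsum_zakAdj_mul_char (hΦs : Continuous Φ)
    (hD : ∀ x ξ, ‖Φ (x, ξ)‖ ≤ D * (decay x * decay ξ)) {D' : ℝ}
    (hD' : ∀ x, ‖zakAdj (Zak.lattice e) Φ x‖ ≤ D' * decay x)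
    (x ξ : EuclideanSpace ℝ (Fin d)) :
    ∑' p : Zak.lattice e × Zak.lattice (Zak.dualVec e),
      char (p.1 : EuclideanSpace ℝ (Fin d)) ξ * Φ (x + p.1, ξ + p.2) =
    (dualVol e : ℂ)⁻¹ * ∑' m : Zak.lattice e,
      zakAdj (Zak.lattice e) Φ (x + m) * char (m : EuclideanSpace ℝ (Fin d)) ξ := by
  have hv := dualVol_pos e
  have hQb := ZSpan.fundamentalDomain_isBounded (dualBasis e)
  let A : EuclideanSpace ℝ (Fin d) → ℂ := fun ξ => ∑' m : Zak.lattice e,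
    zakAdj (Zak.lattice e) Φ (x + m) * char (m : EuclideanSpace ℝ (Fin d)) ξ
  let B : EuclideanSpace ℝ (Fin d) → ℂ := fun ξ =>
    ∑' p : Zak.lattice e × Zak.lattice (Zak.dualVec e),
      char (p.1 : EuclideanSpace ℝ (Fin d)) ξ * Φ (x + p.1, ξ + p.2)
  have hAs : Summable fun m : Zak.lattice e => D' * decay (x + m) :=
    (summable_decay_add _ x).mul_left D'
  have hA : Continuous A := continuous_tsum
    (fun m => continuous_const.mul (contDiff_char _).continuous) hAs
    (fun m ξ => by rw [norm_mul, norm_char, mul_one]; exact hD' _)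
  have hB : Continuous B := continuous_tsum_char_mul e hΦs hD x
  -- Both sides are continuous and Λ'-periodic in ξ, so it suffices to compare Fourier coefficients;
  -- each coefficient with index n equals S Φ(x - n).
  have hq := eq_zero_of_fourierCoeff_eq_zero e (q := fun ξ => B ξ - (dualVol e : ℂ)⁻¹ * A ξ)
    (hB.sub (continuous_const.mul hA)) ?_ ?_
  · have := congrFun hq ξ
    exact sub_eq_zero.1 this
  · intro κ hκ ξ
    have hA' : A (ξ + κ) = A ξ := tsum_congr fun m => by
      rw [char_add_right, char_eq_one e m.2 hκ, mul_one]
    have hB' : B (ξ + κ) = B ξ := by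
      simp only [B]
      rw [← ((Equiv.refl (Zak.lattice e)).prodCongr
          (Equiv.addRight (⟨κ, hκ⟩ : Zak.lattice (Zak.dualVec e)))).tsum_eq
        (fun p => char (p.1 : EuclideanSpace ℝ (Fin d)) ξ * Φ (x + p.1, ξ + p.2))]
      refine tsum_congr fun p => ?_
      rw [char_add_right, char_eq_one e p.1.2 hκ, mul_one]
      simp only [Equiv.prodCongr_apply, Prod.map_fst, Prod.map_snd, Equiv.refl_apply,
        Equiv.coe_addRight, Submodule.coe_add]
      rw [add_assoc, add_comm κ]
    rw [hA', hB']
  · intro n hn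
    have hcn := (contDiff_char n).continuous
    have iA : IntegrableOn (fun ξ => char n ξ * A ξ) (ZSpan.fundamentalDomain (dualBasis e)) :=
      ((hcn.mul hA).continuousOn.integrableOn_compact hQb.isCompact_closure).mono_set subset_closure
    have iB : IntegrableOn (fun ξ => char n ξ * B ξ) (ZSpan.fundamentalDomain (dualBasis e)) :=
      ((hcn.mul hB).continuousOn.integrableOn_compact hQb.isCompact_closure).mono_set subset_closure
    have cA : ∫ ξ in ZSpan.fundamentalDomain (dualBasis e), char n ξ * A ξ =
        dualVol e * zakAdj (Zak.lattice e) Φ (x + -n) :=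
      setIntegral_char_mul_tsum_char e (a := fun m => zakAdj (Zak.lattice e) Φ (x + m))
        (Summable.of_nonneg_of_le (fun _ => norm_nonneg _) (fun m => hD' _) hAs) hn
    have cB : ∫ ξ in ZSpan.fundamentalDomain (dualBasis e), char n ξ * B ξ =
        zakAdj (Zak.lattice e) Φ (x - n) := setIntegral_char_mul_tsum e hΦs hD x hn
    simp only [mul_sub]
    simp only [mul_left_comm _ (dualVol e : ℂ)⁻¹]
    rw [integral_sub iB (iA.const_mul _), integral_const_mul, cA, cB, ← sub_eq_add_neg]
    have : (dualVol e : ℂ) ≠ 0 := by exact_mod_cast hv.ne'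
    rw [inv_mul_cancel_left₀ this, sub_self]

end poisson

/-- The Poisson formula, multiplied by g(x) γ(ξ). On the left are the pieces of Φ after their
transport to the origin. -/
theorem tsum_windowed (hΦs : Continuous Φ) {D : ℝ}
    (hD : ∀ x ξ, ‖Φ (x, ξ)‖ ≤ D * (decay x * decay ξ)) {D' : ℝ}
    (hD' : ∀ x, ‖zakAdj (Zak.lattice e) Φ x‖ ≤ D' * decay x)
    (z : EuclideanSpace ℝ (Fin d) × EuclideanSpace ℝ (Fin d)) :
    ∑' p : Zak.lattice e × Zak.lattice (Zak.dualVec e),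
      windowed g γ (fun z => Φ (z + ((p.1 : EuclideanSpace ℝ (Fin d)), (p.2 : EuclideanSpace ℝ (Fin d))))) (p.1 : EuclideanSpace ℝ (Fin d)) z =
    (dualVol e : ℂ)⁻¹ * zakAdjInv (Zak.lattice e) g γ (zakAdj (Zak.lattice e) Φ) z := by
  obtain ⟨x, ξ⟩ := z
  have h1 : ∀ p : Zak.lattice e × Zak.lattice (Zak.dualVec e),
      windowed g γ (fun z => Φ (z + ((p.1 : EuclideanSpace ℝ (Fin d)), (p.2 : EuclideanSpace ℝ (Fin d))))) (p.1 : EuclideanSpace ℝ (Fin d)) (x, ξ) =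
      g x * γ ξ * (char (p.1 : EuclideanSpace ℝ (Fin d)) ξ * Φ (x + p.1, ξ + p.2)) := by
    intro p
    rw [windowed, Prod.mk_add_mk]
    ring
  simp only [h1]
  rw [tsum_mul_left, tsum_zakAdj_mul_char e hΦs hD hD', mul_left_comm]
  congr 1
  rw [zakAdjInv, ← tsum_mul_left]
  refine tsum_congr fun m => ?_
  rw [windowed]
  ring

end identities

/-! ### Partitions of unity from a nonzero function -/

section window

variable {ι V : Type*} [NormedAddCommGroup V] [NormedSpace ℝ V] {b : Module.Basis ι ℝ V}

theorem listDeriv_star (f : V → ℂ) (l : List ι) :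
    listDeriv b l (fun x => star (f x)) = fun x => star (listDeriv b l f x) := by
  induction l with
  | nil => rfl
  | cons i l ih =>
    ext x
    rw [listDeriv_cons, ih, dirDeriv, fderiv_star]
    rfl

theorem contDiff_star {f : V → ℂ} (hf : ContDiff ℝ ∞ f) : ContDiff ℝ ∞ fun x => star (f x) :=
  (starL' ℝ : ℂ ≃L[ℝ] ℂ).contDiff.comp hf

variable [Fintype ι] [DecidableEq ι] {s σ : ι → ℝ} {h C : ℝ} {f : V → ℂ}

/-- The passage from f to |f|² secures a nonzero integral; the Leibniz rule costs a factor 2 in h.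
-/
theorem HasGSBound.mul_star (hs : ∀ i, 0 < s i) (hσ : ∀ i, 0 < σ i) (hh : 0 < h)
    (hf : ContDiff ℝ ∞ f) (H : HasGSBound b s σ h C f) :
    HasGSBound b s σ (2 * h) (C * C) (f * fun x => star (f x)) := fun x => by
  have h1 : DerivBound b σ h (C / growth b s h x) (fun x => star (f x)) x := fun l => by
    rw [listDeriv_star]
    simpa using H x l
  have h2 := growth_anti (b := b) hs hh (by linarith : h ≤ 2 * h) x
  have h3 := one_le_growth (b := b) hs hh x
  have h4 := growth_pos (b := b) hs (by positivity : 0 < 2 * h) x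
  refine ((H x).mul hσ h1 hh.le hh.le hf (contDiff_star hf)).mono (by positivity)
    (two_mul h).ge ?_
  rw [div_mul_div_comm]
  refine div_le_div_of_nonneg_left (mul_self_nonneg C) h4 ?_
  nlinarith

theorem HasGSBound.const_smul (hf : ContDiff ℝ ∞ f) (H : HasGSBound b s σ h C f) (c : ℂ) :
    HasGSBound b s σ h (‖c‖ * C) (c • f) := fun x l => by
  rw [listDeriv_smul hf, Pi.smul_apply, norm_smul, mul_div_assoc, mul_assoc]
  exact mul_le_mul_of_nonneg_left (H x l) (norm_nonneg c)

omit [NormedSpace ℝ V] in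
theorem integral_mul_star_ne_zero [MeasurableSpace V] [BorelSpace V] (μ : Measure V)
    [μ.IsOpenPosMeasure] (hf : Continuous f) (hi : Integrable (f * fun x => star (f x)) μ)
    (h0 : f ≠ 0) : ∫ x, (f * fun x => star (f x)) x ∂μ ≠ 0 := by
  have e : (f * fun x => star (f x)) = fun x => ((‖f x‖ ^ 2 : ℝ) : ℂ) := by
    ext x
    push_cast
    exact RCLike.mul_conj (f x)
  rw [e] at hi ⊢
  beta_reduce
  rw [integral_complex_ofReal]
  intro h1
  have h2 : ∫ x, ‖f x‖ ^ 2 ∂μ = 0 := by exact_mod_cast h1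
  have hi' : Integrable (fun x => ‖f x‖ ^ 2) μ := by
    have := hi.re
    simpa only [RCLike.re_to_complex, Complex.ofReal_re] using this
  rw [integral_eq_zero_iff_of_nonneg (fun x => by positivity) hi'] at h2
  have h3 := (Continuous.ae_eq_iff_eq μ (hf.norm.pow 2) continuous_const).1 h2
  refine h0 (funext fun x => norm_eq_zero.1 (pow_eq_zero_iff two_ne_zero |>.1 ?_))
  exact congrFun h3 x

/-- The convolution of `w` with the indicator function of a fundamental domain of a lattice yields
a window, the translates of which by the lattice form a partition of unity. -/
theorem exists_partition [FiniteDimensional ℝ V] [MeasurableSpace V] [BorelSpace V] (μ : Measure V)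
    [μ.IsAddHaarMeasure] (hs : ∀ i, 0 < s i) (L : Submodule ℤ V) [DiscreteTopology L] [IsZLattice ℝ L]
    [VAddInvariantMeasure L V μ] {Q : Set V} (hQ : IsAddFundamentalDomain L Q μ)
    (hQb : Bornology.IsBounded Q) {w : V → ℂ} (hw : ContDiff ℝ ∞ w) (hh : 0 < h)
    (H : HasGSBound b s σ h C w) (h1 : ∫ x, w x ∂μ = 1) :
    ∃ g : V → ℂ, ContDiff ℝ ∞ g ∧ (∀ x, ∑' k : L, g (x - k) = 1) ∧
      ∀ {h C : ℝ}, 0 < h → HasGSBound b s σ h C w → ∃ C', HasGSBound b s σ (2 * h) C' g := by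
  have hfin : μ Q < ⊤ := (measure_mono subset_closure).trans_lt hQb.isCompact_closure.measure_lt_top
  have : IsFiniteMeasure (μ.restrict Q) := ⟨by rwa [Measure.restrict_apply_univ]⟩
  have key {h C : ℝ} (hh : 0 < h) (H : HasGSBound b s σ h C w) :=
    contDiff_integral_of_derivBound (b := b) (σ := σ) (h := h) hh.le (μ := μ.restrict Q)
      (F := fun y x => w (x + -y)) (A := fun _ _ => C) (k := fun _ => C)
      (fun y => hw.comp (contDiff_id.add contDiff_const)) (integrable_const C)
      (fun _ _ => le_rfl) (fun y x => ((H (x + -y)).mono hh.le le_rfl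
        (div_le_self (H.nonneg hs hh) (one_le_growth hs hh _))).comp_add)
      (fun l x => by
        simp only [listDeriv_comp_add_right]
        exact ((contDiff_listDeriv hw l).continuous.comp
          (continuous_const.add continuous_neg)).aestronglyMeasurable)
  refine ⟨fun x => ∫ y in Q, w (x + -y) ∂μ, (key hh H).1, fun x => ?_, fun {h C} hh H => ?_⟩
  · obtain ⟨D, hD, hD'⟩ := HasGSBound.exists_norm_le_decay' hs hh H
    -- With g(x) = ∫_Q w(x - y) dy, unfolding of 1 = ∫ w(x - y) dy along the translates of Q gives
    -- ∑_k g(x - k).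
    have h2 := (integral_eq_setIntegral_tsum L hQ hQb (f := fun y => w (x + -y))
      (hw.continuous.comp (continuous_const.add continuous_neg))
      (C := D * (1 + ‖x‖) ^ (Module.finrank ℝ V + 1)) (fun y => ?_)).2
    · simp only [← sub_eq_add_neg] at h2 ⊢
      rw [integral_sub_left_eq_self w μ x, h1] at h2
      rw [h2]
      refine tsum_congr fun k => ?_
      congr 1
      ext y
      congr 1
      abel
    · refine (hD' _).trans ?_
      rw [← decay_neg, mul_assoc, show -(x + -y) = y + -x by abel]
      refine mul_le_mul_of_nonneg_left ?_ hD.le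
      simpa using decay_add_le y (-x)
  -- The weight is bounded on Q, so averaging over Q changes the decay only by a constant factor and
  -- a factor 2 in h.
  · obtain ⟨M, hM, hMQ⟩ := exists_growth_le_of_isBounded (b := b) hs hh hQb
    have hC := H.nonneg hs hh
    refine ⟨C * M * μ.real Q, fun x l => ?_⟩
    rw [(key hh H).2]
    have hg := growth_pos (b := b) hs (by positivity : 0 < 2 * h) x
    have hl := facWeight_pos σ l
    have h3 : ∀ y ∈ Q, ‖listDeriv b l (fun x => w (x + -y)) x‖ ≤
        C * M / growth b s (2 * h) x * ((2 * h) ^ l.length * facWeight σ l) := fun y hy => by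
      rw [listDeriv_comp_add_right]
      refine (H _ l).trans ?_
      have h4 := growth_add_le (b := b) hs hh (x + -y) y
      rw [neg_add_cancel_right] at h4
      have h5 := growth_pos (b := b) hs hh (x + -y)
      have h6 : C / growth b s h (x + -y) ≤ C * M / growth b s (2 * h) x := by
        rw [div_le_div_iff₀ h5 hg, mul_assoc]
        refine mul_le_mul_of_nonneg_left ?_ hC
        rw [mul_comm M]
        exact h4.trans (mul_le_mul_of_nonneg_left (hMQ y hy) h5.le)
      gcongr
      linarith
    refine (norm_setIntegral_le_of_norm_le_const hfin h3).trans (le_of_eq ?_)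
    ring

/-- A nonzero element of a Gelfand-Shilov space gives rise to a window in this space. -/
theorem exists_window [FiniteDimensional ℝ V] [MeasurableSpace V] [BorelSpace V] (μ : Measure V)
    [μ.IsAddHaarMeasure] (hs : ∀ i, 0 < s i) (hσ : ∀ i, 0 < σ i) (L : Submodule ℤ V)
    [DiscreteTopology L] [IsZLattice ℝ L]
    [VAddInvariantMeasure L V μ] {Q : Set V} (hQ : IsAddFundamentalDomain L Q μ)
    (hQb : Bornology.IsBounded Q) (hf : ContDiff ℝ ∞ f) (h0 : f ≠ 0) (hh : 0 < h)
    (H : HasGSBound b s σ h C f) :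
    ∃ g : V → ℂ, ContDiff ℝ ∞ g ∧ (∀ x, ∑' k : L, g (x - k) = 1) ∧
      ∀ {h C : ℝ}, 0 < h → HasGSBound b s σ h C f → ∃ C', HasGSBound b s σ (4 * h) C' g := by
  have hw : ContDiff ℝ ∞ (f * fun x => star (f x)) := hf.mul (contDiff_star hf)
  have H2 := H.mul_star hs hσ hh hf
  have hi := H2.integrable μ hs (by positivity) hw []
  have hI := integral_mul_star_ne_zero μ hf.continuous hi h0
  obtain ⟨c, hc⟩ : ∃ c, c = (∫ x, (f * fun x => star (f x)) x ∂μ)⁻¹ := ⟨_, rfl⟩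
  obtain ⟨g, hg, hg1, hgb⟩ := exists_partition (b := b) μ hs L hQ hQb (w := c • (f * fun x => star (f x)))
    (hw.const_smul c) (by positivity : 0 < 2 * h) (H2.const_smul hw c) (by
      simp only [Pi.smul_apply]
      rw [integral_smul, hc, smul_eq_mul, inv_mul_cancel₀ hI])
  refine ⟨g, hg, hg1, fun {h C} hh H => ?_⟩
  have := hgb (by positivity : 0 < 2 * h) ((H.mul_star hs hσ hh hf).const_smul hw c)
  rwa [show 2 * (2 * h) = 4 * h by ring] at this

end window

/-! ### Derivatives of products with monomials -/

section monomials

variable {ι V : Type*} [NormedAddCommGroup V] [NormedSpace ℝ V] {b : Module.Basis ι ℝ V}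

theorem contDiff_listMono [FiniteDimensional ℝ V] (b : Module.Basis ι ℝ V) (p : List ι) :
    ContDiff ℝ ∞ fun x => (listMono b p x : ℂ) := by
  induction p with
  | nil => simpa using contDiff_const
  | cons i p ih =>
    simp only [listMono_cons, Complex.ofReal_mul]
    exact (Complex.ofRealCLM.contDiff.comp
      (LinearMap.toContinuousLinearMap (b.coord i)).contDiff).mul ih

variable [DecidableEq ι]

theorem dirDeriv_listMono [FiniteDimensional ℝ V] (p : List ι) (i : ι) :
    dirDeriv b i (fun x => (listMono b p x : ℂ)) =
      (p.count i : ℂ) • fun x => (listMono b (p.erase i) x : ℂ) := by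
  induction p with
  | nil => ext x; simp [dirDeriv]
  | cons j p ih =>
    have e : (fun x => (listMono b (j :: p) x : ℂ)) =
        (fun x => ((LinearMap.toContinuousLinearMap (b.coord j) x : ℝ) : ℂ)) *
          fun x => (listMono b p x : ℂ) := by
      ext x
      simp [listMono_cons]
    have e1 : dirDeriv b i (fun x => ((LinearMap.toContinuousLinearMap (b.coord j) x : ℝ) : ℂ)) =
        fun _ => if j = i then 1 else 0 := by
      ext x
      have h1 : HasFDerivAt (fun x => ((LinearMap.toContinuousLinearMap (b.coord j) x : ℝ) : ℂ))
          (Complex.ofRealCLM.comp (LinearMap.toContinuousLinearMap (b.coord j))) x :=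
        Complex.ofRealCLM.hasFDerivAt.comp x (ContinuousLinearMap.hasFDerivAt _)
      rw [dirDeriv, h1.fderiv]
      simp [Finsupp.single_apply, apply_ite, eq_comm]
    have hc : ContDiff ℝ ∞ fun x => ((LinearMap.toContinuousLinearMap (b.coord j) x : ℝ) : ℂ) :=
      Complex.ofRealCLM.contDiff.comp (ContinuousLinearMap.contDiff _)
    rw [e, dirDeriv_mul hc (contDiff_listMono b p), e1, ih]
    ext x
    simp only [Pi.add_apply, Pi.mul_apply, Pi.smul_apply, smul_eq_mul]
    by_cases hji : j = i
    · subst hji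
      simp only [if_true, List.count_cons_self, List.erase_cons_head]
      by_cases hm : j ∈ p
      · have h2 : listMono b p x = b.repr x j * listMono b (p.erase j) x := by
          rw [← listMono_cons]
          exact ((List.perm_cons_erase hm).map _).prod_eq
        rw [h2]
        push_cast
        simp
        ring
      · simp [List.count_eq_zero_of_not_mem hm]
    · rw [if_neg hji, List.count_cons_of_ne hji, List.erase_cons_tail (by simpa using hji),
        listMono_cons]
      push_cast
      simp
      ring

variable [Fintype ι]

/-- The bounds `|x^p D_q f(x)| ≤ A ∏ u(p i, q i)` and a recursive property of the weight `u` imply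
bounds for the derivatives of `x^p D_q f`. -/
theorem norm_listDeriv_listMono_mul_le [FiniteDimensional ℝ V] {f : V → ℂ} (hf : ContDiff ℝ ∞ f)
    {u : ℕ → ℕ → ℝ} (hu : ∀ a c, 0 ≤ u a c) (hrec : ∀ a c, (a + 1) * u a c ≤ u (a + 1) (c + 1))
    {x : V} {A : ℝ} (hA : 0 ≤ A)
    (H : ∀ p q : List ι, |listMono b p x| * ‖listDeriv b q f x‖ ≤ A * ∏ i, u (p.count i) (q.count i))
    (l : List ι) : ∀ p q : List ι,
      ‖listDeriv b l ((fun x => (listMono b p x : ℂ)) * listDeriv b q f) x‖ ≤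
        A * (2 ^ l.length * ∏ i, u (p.count i) ((l ++ q).count i)) := by
  induction l with
  | nil =>
    intro p q
    simpa using H p q
  | cons i l ih =>
    intro p q
    have cp := contDiff_listMono b p
    have cq := contDiff_listDeriv (b := b) hf q
    -- The derivative in direction i falls either on the monomial, which removes i from p, or on f,
    -- which adds i to q.
    have e : listDeriv b (i :: l) ((fun x => (listMono b p x : ℂ)) * listDeriv b q f) =
        (p.count i : ℂ) • listDeriv b l ((fun x => (listMono b (p.erase i) x : ℂ)) * listDeriv b q f) +
        listDeriv b l ((fun x => (listMono b p x : ℂ)) * listDeriv b (i :: q) f) := by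
      rw [listDeriv_cons, ← listDeriv_dirDeriv
          (f := (fun x => (listMono b p x : ℂ)) * listDeriv b q f) (cp.mul cq),
        dirDeriv_mul cp cq, dirDeriv_listMono,
        smul_mul_assoc]
      have c1 : ContDiff ℝ ∞ ((fun x => (listMono b (p.erase i) x : ℂ)) * listDeriv b q f) :=
        (contDiff_listMono b _).mul cq
      have c2 : ContDiff ℝ ∞ ((fun x => (listMono b p x : ℂ)) * dirDeriv b i (listDeriv b q f)) :=
        cp.mul (contDiff_dirDeriv cq i)
      have c3 : ContDiff ℝ ∞
          ((p.count i : ℂ) • ((fun x => (listMono b (p.erase i) x : ℂ)) * listDeriv b q f)) :=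
        c1.const_smul (p.count i : ℂ)
      rw [listDeriv_add c3 c2, listDeriv_smul c1]
      rfl
    rw [e, Pi.add_apply, Pi.smul_apply]
    refine (norm_add_le _ _).trans ?_
    have h2 : ‖listDeriv b l ((fun x => (listMono b p x : ℂ)) * listDeriv b (i :: q) f) x‖ ≤
        A * (2 ^ l.length * ∏ j, u (p.count j) ((i :: l ++ q).count j)) := by
      refine (ih p (i :: q)).trans (le_of_eq ?_)
      congr 3
      ext j
      rw [(List.perm_middle (a := i) (l₁ := l) (l₂ := q)).count_eq]
      rfl
    have h1 : ‖(p.count i : ℂ) • listDeriv b l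
        ((fun x => (listMono b (p.erase i) x : ℂ)) * listDeriv b q f) x‖ ≤
        A * (2 ^ l.length * ∏ j, u (p.count j) ((i :: l ++ q).count j)) := by
      rw [norm_smul, Complex.norm_natCast]
      refine (mul_le_mul_of_nonneg_left (ih (p.erase i) q) (Nat.cast_nonneg _)).trans ?_
      rw [mul_left_comm, mul_left_comm _ (2 ^ l.length : ℝ)]
      refine mul_le_mul_of_nonneg_left (mul_le_mul_of_nonneg_left ?_ (by positivity)) hA
      rw [← Finset.mul_prod_erase _ _ (Finset.mem_univ i), ← mul_assoc,
        ← Finset.mul_prod_erase _ (fun j => u (p.count j) ((i :: l ++ q).count j)) (Finset.mem_univ i)]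
      have h3 : ∏ j ∈ Finset.univ.erase i, u ((p.erase i).count j) ((l ++ q).count j) =
          ∏ j ∈ Finset.univ.erase i, u (p.count j) ((i :: l ++ q).count j) := by
        refine Finset.prod_congr rfl fun j hj => ?_
        have hj' : j ≠ i := (Finset.mem_erase.1 hj).1
        rw [List.count_erase_of_ne hj', List.cons_append, List.count_cons_of_ne hj'.symm]
      rw [h3]
      refine mul_le_mul_of_nonneg_right ?_ (Finset.prod_nonneg fun j _ => hu _ _)
      rw [List.count_erase_self, List.cons_append, List.count_cons_self]
      -- By the recursive property of u, the factor p_i from differentiating the monomial is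
      -- absorbed by raising both arguments of u. Both branches then have the same bound, whence one
      -- factor 2 per derivative.
      rcases Nat.eq_zero_or_pos (p.count i) with h0 | h0
      · rw [h0]
        simpa using hu 0 _
      · obtain ⟨n, hn⟩ := Nat.exists_eq_add_of_lt h0
        rw [hn]
        simpa using hrec n ((l ++ q).count i)
    refine (add_le_add h1 h2).trans (le_of_eq ?_)
    rw [List.length_cons]
    ring

/-- The characterization of `HasGSBound` in terms of monomials. -/
theorem hasGSBound_iff {s σ : ι → ℝ} (hs : ∀ i, 0 < s i) {h : ℝ} (hh : 0 < h) {f : V → ℂ} {C : ℝ} :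
    HasGSBound b s σ h C f ↔ ∀ (l m : List ι) (x : V),
      |listMono b l x| * ‖listDeriv b m f x‖ ≤
        C * (h ^ l.length * facWeight s l * (h ^ m.length * facWeight σ m)) := by
  constructor
  · intro H l m x
    have hg := growth_pos (b := b) hs hh x
    have hm := facWeight_pos σ m
    have hl := facWeight_pos s l
    calc _ ≤ (h ^ l.length * facWeight s l * growth b s h x) *
          (C / growth b s h x * (h ^ m.length * facWeight σ m)) :=
          mul_le_mul (listMono_le hs hh l x) (H x m) (norm_nonneg _) (by positivity)
      _ = _ := by field_simp
  · intro H x m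
    have hg := growth_pos (b := b) hs hh x
    have hm := facWeight_pos σ m
    rw [div_mul_eq_mul_div, le_div_iff₀ hg]
    rcases (norm_nonneg (listDeriv b m f x)).eq_or_lt with h0 | h0
    · have := H [] [] x
      have hC : 0 ≤ C := by simpa using (mul_nonneg (abs_nonneg _) (norm_nonneg _)).trans this
      rw [← h0, zero_mul]; positivity
    rw [← le_div_iff₀' h0]
    refine growth_le hh fun l => ?_
    rw [← mul_div_assoc, le_div_iff₀ h0]
    exact (H l m x).trans (le_of_eq (by ring))

/-- `growth_sq_le` provides two copies of the weight: one bounds the monomial, the other one leaves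
an integrable factor. -/
theorem HasGSBound.exists_listMono_mul_le {s σ : ι → ℝ} (hs : ∀ i, 0 < s i) {h : ℝ} (hh : 0 < h)
    {f : V → ℂ} {C : ℝ} (H : HasGSBound b s σ h C f) :
    ∃ D, 0 ≤ D ∧ ∀ p q x, |listMono b p x| * ‖listDeriv b q f x‖ ≤ D * decay x *
      ((dbl s * h) ^ p.length * facWeight s p * ((dbl s * h) ^ q.length * facWeight σ q)) := by
  have hK := one_le_dbl hs
  obtain ⟨k, hk⟩ : ∃ k, k = dbl s * h := ⟨_, rfl⟩
  have hhk : h ≤ k := hk ▸ le_mul_of_one_le_left hh.le hK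
  have hk0 : 0 < k := hh.trans_le hhk
  have hC := H.nonneg hs hh
  rw [← hk]
  obtain ⟨D, hD0, hD⟩ := exists_inv_growth_le (b := b) hs hk0
  refine ⟨C * D, by positivity, fun p q x => ?_⟩
  have h1 := listMono_le (b := b) hs hk0 p x
  have h2 := growth_sq_le (b := b) hs hh x
  rw [← hk] at h2
  have gk := growth_pos (b := b) hs hk0 x
  have gh := growth_pos (b := b) hs hh x
  have wp := facWeight_pos s p
  have wq := facWeight_pos σ q
  have dx := decay_pos x
  calc _ ≤ (k ^ p.length * facWeight s p * growth b s k x) *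
        (C / growth b s h x * (h ^ q.length * facWeight σ q)) :=
        mul_le_mul h1 (H x q) (norm_nonneg _) (by positivity)
    _ ≤ (k ^ p.length * facWeight s p * growth b s k x) *
        (C / (growth b s k x * growth b s k x) * (k ^ q.length * facWeight σ q)) := by
        gcongr
    _ = C * (growth b s k x)⁻¹ * (k ^ p.length * facWeight s p * (k ^ q.length * facWeight σ q)) := by
        field_simp
    _ ≤ C * (D * decay x) * (k ^ p.length * facWeight s p * (k ^ q.length * facWeight σ q)) := by
        gcongr
        exact hD x
    _ = _ := by ring

end monomials

/-! ### Auxiliary weights for the Fourier transform -/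

section weight

/-- The weight for `norm_listDeriv_listMono_mul_le`. -/
theorem exists_mixed_weight {s σ k : ℝ} (hσ : 0 < σ) (hk : 0 < k) {M : ℝ} {v : ℕ → ℝ}
    (hv1 : ∀ n, 1 ≤ v n) (hvM : ∀ n, v n ≤ M)
    (hv : ∀ n : ℕ, ((n + 1 : ℕ) : ℝ) ^ (1 - s - σ) * v n ≤ k ^ 2 * v (n + 1)) :
    ∃ u : ℕ → ℕ → ℝ, (∀ a c, 0 ≤ u a c) ∧ (∀ a c, (a + 1) * u a c ≤ u (a + 1) (c + 1)) ∧
      (∀ a c, k ^ (a + c) * ((a.factorial : ℝ) ^ s * (c.factorial : ℝ) ^ σ) ≤ u a c) ∧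
      ∀ a c, u a c ≤ M * ((2 ^ σ * k) ^ (a + c) * ((a.factorial : ℝ) ^ s * (c.factorial : ℝ) ^ σ)) := by
  have fp (n : ℕ) : (0 : ℝ) < n.factorial := by exact_mod_cast n.factorial_pos
  -- Up to geometric factors, a!^{s-σ} (a+c)!^σ is a!^s c!^σ. From (a, c) to (a+1, c+1) it grows at
  -- least by (a+1)^{s-σ} (a+1)^{2σ} = (a+1)^{s+σ}; the missing factor (a+1)^{1-s-σ} is supplied by
  -- k² and v.
  refine ⟨fun a c => k ^ (a + c) * ((a.factorial : ℝ) ^ (s - σ) * ((a + c).factorial : ℝ) ^ σ * v a),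
    fun a c => ?_, fun a c => ?_, fun a c => ?_, fun a c => ?_⟩
  · have := fp a
    have := hv1 a
    positivity
  · have h1 : (((a + 1 : ℕ) : ℝ)) ^ (2 * σ) * ((a + c).factorial : ℝ) ^ σ ≤
        ((a + 1 + (c + 1)).factorial : ℝ) ^ σ := by
      rw [Real.rpow_mul (by positivity), ← Real.mul_rpow (by positivity) (by positivity)]
      refine Real.rpow_le_rpow (by positivity) ?_ hσ.le
      rw [show a + 1 + (c + 1) = (a + c + 1) + 1 by ring, Nat.factorial_succ, Nat.factorial_succ]
      rw [show (2 : ℝ) = ((2 : ℕ) : ℝ) by norm_num, Real.rpow_natCast]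
      norm_cast
      rw [← mul_assoc, sq]
      gcongr <;> omega
    have hp : (0 : ℝ) < ((a + 1 : ℕ) : ℝ) := by positivity
    have h2 : ((a + 1).factorial : ℝ) ^ (s - σ) =
        ((a + 1 : ℕ) : ℝ) ^ (s - σ) * (a.factorial : ℝ) ^ (s - σ) := by
      rw [Nat.factorial_succ, Nat.cast_mul, Real.mul_rpow (by positivity) (by positivity)]
    have h3 : ((a + 1 : ℕ) : ℝ) = ((a + 1 : ℕ) : ℝ) ^ (1 - s - σ) * ((a + 1 : ℕ) : ℝ) ^ (s - σ) *
        ((a + 1 : ℕ) : ℝ) ^ (2 * σ) := by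
      rw [← Real.rpow_add hp, ← Real.rpow_add hp]
      conv_lhs => rw [← Real.rpow_one ((a + 1 : ℕ) : ℝ)]
      congr 1
      ring
    have := fp a
    have := hv1 (a + 1)
    have hv' := hv a
    have := hv1 a
    dsimp only
    calc ((a : ℝ) + 1) * (k ^ (a + c) * ((a.factorial : ℝ) ^ (s - σ) * ((a + c).factorial : ℝ) ^ σ * v a))
        = ((a + 1 : ℕ) : ℝ) *
          (k ^ (a + c) * ((a.factorial : ℝ) ^ (s - σ) * ((a + c).factorial : ℝ) ^ σ * v a)) := by
          push_cast; rfl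
      _ = k ^ (a + c) * (((a + 1 : ℕ) : ℝ) ^ (s - σ) * (a.factorial : ℝ) ^ (s - σ)) *
          (((a + 1 : ℕ) : ℝ) ^ (2 * σ) * ((a + c).factorial : ℝ) ^ σ) *
          (((a + 1 : ℕ) : ℝ) ^ (1 - s - σ) * v a) := by
          conv_lhs => rw [h3]
          ring
      _ ≤ k ^ (a + c) * (((a + 1 : ℕ) : ℝ) ^ (s - σ) * (a.factorial : ℝ) ^ (s - σ)) *
          ((a + 1 + (c + 1)).factorial : ℝ) ^ σ * (k ^ 2 * v (a + 1)) := by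
          gcongr
      _ = _ := by rw [h2]; ring
  · have h1 : (a.factorial : ℝ) ^ σ * (c.factorial : ℝ) ^ σ ≤ ((a + c).factorial : ℝ) ^ σ := by
      rw [← Real.mul_rpow (fp a).le (fp c).le]
      refine Real.rpow_le_rpow (by positivity) ?_ hσ.le
      exact_mod_cast Nat.le_of_dvd (Nat.factorial_pos _) (Nat.factorial_mul_factorial_dvd_factorial_add _ _)
    have h2 : (a.factorial : ℝ) ^ s = (a.factorial : ℝ) ^ (s - σ) * (a.factorial : ℝ) ^ σ := by
      rw [← Real.rpow_add (fp a), sub_add_cancel]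
    have := fp a
    refine mul_le_mul_of_nonneg_left ?_ (by positivity)
    rw [h2, mul_assoc]
    refine le_trans (mul_le_mul_of_nonneg_left h1 (by positivity)) ?_
    exact le_mul_of_one_le_right (by positivity) (hv1 a)
  · have h1 : ((a + c).factorial : ℝ) ^ σ ≤
        (2 ^ σ) ^ (a + c) * ((a.factorial : ℝ) ^ σ * (c.factorial : ℝ) ^ σ) := by
      rw [← Real.rpow_natCast, ← Real.rpow_mul two_pos.le, mul_comm σ, Real.rpow_mul two_pos.le,
        Real.rpow_natCast, ← Real.mul_rpow (fp a).le (fp c).le,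
        ← Real.mul_rpow (by positivity) (by positivity)]
      refine Real.rpow_le_rpow (by positivity) ?_ hσ.le
      rw [← Nat.add_choose_mul_factorial_mul_factorial a c]
      push_cast
      rw [mul_assoc]
      gcongr
      exact_mod_cast Nat.choose_le_two_pow _ _
    have h2 : (a.factorial : ℝ) ^ s = (a.factorial : ℝ) ^ (s - σ) * (a.factorial : ℝ) ^ σ := by
      rw [← Real.rpow_add (fp a), sub_add_cancel]
    have hM := (hv1 a).trans (hvM a)
    have := hv1 a
    have := fp a
    have := fp c
    dsimp only
    calc _ ≤ k ^ (a + c) * ((a.factorial : ℝ) ^ (s - σ) *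
          ((2 ^ σ) ^ (a + c) * ((a.factorial : ℝ) ^ σ * (c.factorial : ℝ) ^ σ)) * M) := by
          gcongr
          exact hvM a
      _ = _ := by
          rw [h2, mul_pow]
          ring

/-- As t < 0, only finitely many of the numbers (n+1)^t / k² exceed 1, so the product of their
maxima with 1 is eventually constant. With t = 1 - s - σ and arbitrarily small k this makes every h
accessible in the Beurling case. -/
theorem exists_rpow_weight {t k : ℝ} (ht : t < 0) (hk : 0 < k) :
    ∃ (M : ℝ) (v : ℕ → ℝ), (∀ n, 1 ≤ v n) ∧ (∀ n, v n ≤ M) ∧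
      ∀ n : ℕ, ((n + 1 : ℕ) : ℝ) ^ t * v n ≤ k ^ 2 * v (n + 1) := by
  let r (n : ℕ) : ℝ := max 1 (((n + 1 : ℕ) : ℝ) ^ t / k ^ 2)
  let v (n : ℕ) : ℝ := ∏ j ∈ Finset.range n, r j
  have hr (n) : 1 ≤ r n := le_max_left _ _
  have hlim : Tendsto (fun n : ℕ => ((n + 1 : ℕ) : ℝ) ^ t / k ^ 2) atTop (nhds 0) := by
    have h1 : Tendsto (fun n : ℕ => ((n + 1 : ℕ) : ℝ) ^ t) atTop (nhds 0) := by
      have := (tendsto_rpow_neg_atTop (y := -t) (by linarith)).comp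
        (tendsto_natCast_atTop_atTop.comp (tendsto_add_atTop_nat 1))
      simpa [Function.comp_def] using this
    simpa using h1.div_const (k ^ 2)
  obtain ⟨N, hN⟩ := eventually_atTop.1 (hlim.eventually_lt_const one_pos)
  have hmono : Monotone v := monotone_nat_of_le_succ fun n => by
    simp only [v, Finset.prod_range_succ]
    exact le_mul_of_one_le_right (Finset.prod_nonneg fun j _ => zero_le_one.trans (hr j)) (hr n)
  have hconst (n : ℕ) : v (N + n) = v N := by
    induction n with
    | zero => rfl
    | succ n ih =>
      rw [← add_assoc, show v (N + n + 1) = v (N + n) * r (N + n) from Finset.prod_range_succ _ _, ih]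
      rw [show r (N + n) = 1 from max_eq_left (hN _ (by omega)).le, mul_one]
  refine ⟨v N, v, fun n => ?_, fun n => ?_, fun n => ?_⟩
  · exact (hmono (Nat.zero_le n)).trans' (by simp [v])
  · rcases le_total n N with h | h
    · exact hmono h
    · obtain ⟨m, rfl⟩ := Nat.exists_eq_add_of_le h
      exact (hconst m).le
  · rw [show v (n + 1) = v n * r n from Finset.prod_range_succ _ _, mul_left_comm, mul_comm _ (v n)]
    refine mul_le_mul_of_nonneg_left ?_ (Finset.prod_nonneg fun j _ => zero_le_one.trans (hr j))
    rw [← div_le_iff₀' (by positivity)]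
    exact le_max_right _ _

end weight

/-! ### The Fourier transform exchanges the two parameters -/

section fourier

variable {d : ℕ} {s σ : ℝ} {h C : ℝ} {f : EuclideanSpace ℝ (Fin d) → ℂ}

/-- The Fourier transform, normalized by `∫ f(x) e^{i⟪x, ξ⟫} dx`. -/
def fourier (f : EuclideanSpace ℝ (Fin d) → ℂ) (ξ : EuclideanSpace ℝ (Fin d)) : ℂ :=
  ∫ x, char x ξ * f x

theorem listDeriv_char (p : List (Fin d)) (x : EuclideanSpace ℝ (Fin d)) :
    listDeriv (stdBasis d) p (char x) =
      (Complex.I ^ p.length * (listMono (stdBasis d) p x : ℂ)) • char x := by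
  induction p with
  | nil => simp
  | cons i p ih =>
    rw [listDeriv_cons, ih, dirDeriv_smul (contDiff_char x), dirDeriv_char, listMono_cons, smul_smul]
    congr 1
    push_cast
    rw [List.length_cons]
    ring

theorem prod_pow_count {ι : Type*} [Fintype ι] [DecidableEq ι] (k : ℝ) (l : List ι) :
    ∏ i, k ^ l.count i = k ^ l.length := by
  rw [← prod_map_eq_prod_pow_count l fun _ => k]; simp

/-- Up to factors of modulus one, ξ^q ∂^p of the Fourier transform is the Fourier transform of ∂^q
(x^p f), hence bounded by the L¹ norm of the latter. In the new parameter, 2 comes from the Leibniz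
rule, 2^σ from the mixed weight, and `dbl s` from separating an integrable factor; M enters once for
each coordinate. -/
theorem HasGSBound.fourier_bound (hs : 0 < s) (hσ : 0 < σ) (hh : 0 < h)
    (hf : ContDiff ℝ ∞ f) (H : HasGSBound (stdBasis d) (fun _ => s) (fun _ => σ) h C f) {M : ℝ}
    {v : ℕ → ℝ} (hv1 : ∀ n, 1 ≤ v n) (hvM : ∀ n, v n ≤ M)
    (hv : ∀ n : ℕ, ((n + 1 : ℕ) : ℝ) ^ (1 - s - σ) * v n ≤
      (dbl (fun _ : Fin d => s) * h) ^ 2 * v (n + 1)) :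
    ContDiff ℝ ∞ (fourier f) ∧ ∃ C', HasGSBound (stdBasis d) (fun _ => σ) (fun _ => s)
      (2 * (2 ^ σ * (dbl (fun _ : Fin d => s) * h))) C' (fourier f) := by
  have hs' : ∀ _ : Fin d, 0 < s := fun _ => hs
  have hσ' : ∀ _ : Fin d, 0 < σ := fun _ => hσ
  have hK := one_le_dbl hs'
  obtain ⟨k, hk⟩ : ∃ k, k = dbl (fun _ : Fin d => s) * h := ⟨_, rfl⟩
  have hhk : h ≤ k := hk ▸ le_mul_of_one_le_left hh.le hK
  have hk0 : 0 < k := hh.trans_le hhk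
  rw [← hk] at hv ⊢
  obtain ⟨D, hD0, hD⟩ := H.exists_listMono_mul_le hs' hh
  rw [← hk] at hD
  obtain ⟨u, hu, hrec, hub, huM⟩ := exists_mixed_weight hσ hk0 hv1 hvM hv
  have hM : 0 ≤ M := zero_le_one.trans ((hv1 0).trans (hvM 0))
  have base (x) (p q : List (Fin d)) : |listMono (stdBasis d) p x| * ‖listDeriv (stdBasis d) q f x‖ ≤
      (D * decay x) * ∏ i, u (p.count i) (q.count i) := by
    have dx := decay_pos x
    refine (hD p q x).trans (mul_le_mul_of_nonneg_left ?_ (by positivity))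
    rw [← prod_pow_count k p, ← prod_pow_count k q, facWeight, facWeight, ← Finset.prod_mul_distrib,
      ← Finset.prod_mul_distrib, ← Finset.prod_mul_distrib]
    refine Finset.prod_le_prod (fun i _ => by positivity) fun i _ => ?_
    refine le_trans (le_of_eq ?_) (hub _ _)
    rw [pow_add]
    ring
  have hmixed (p q : List (Fin d)) (x) :
      ‖listDeriv (stdBasis d) q ((fun x => (listMono (stdBasis d) p x : ℂ)) * f) x‖ ≤
        D * (2 ^ q.length * ∏ i, u (p.count i) (q.count i)) * decay x := by
    have := norm_listDeriv_listMono_mul_le hf hu hrec (by have := decay_pos x; positivity)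
      (base x) q p []
    simp only [listDeriv_nil, List.append_nil] at this
    refine this.trans (le_of_eq ?_)
    ring
  have hsm (p : List (Fin d)) : ContDiff ℝ ∞ ((fun x => (listMono (stdBasis d) p x : ℂ)) * f) :=
    (contDiff_listMono _ p).mul hf
  have hint (p q : List (Fin d)) : Integrable
      (listDeriv (stdBasis d) q ((fun x => (listMono (stdBasis d) p x : ℂ)) * f)) :=
    ((integrable_decay volume).const_mul _).mono'
      (contDiff_listDeriv (hsm p) q).continuous.aestronglyMeasurable (Eventually.of_forall (hmixed p q))
  have hder (p : List (Fin d)) (x ξ) : listDeriv (stdBasis d) p (fun ξ => char x ξ * f x) ξ =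
      Complex.I ^ p.length * (char ξ x * (listMono (stdBasis d) p x * f x)) := by
    rw [show (fun ξ => char x ξ * f x) = f x • char x by ext; simp [mul_comm],
      listDeriv_smul (contDiff_char x), listDeriv_char, char_comm ξ]
    simp only [Pi.smul_apply, smul_eq_mul]
    ring
  have hF := contDiff_integral_and_listDeriv (b := stdBasis d) (μ := volume)
    (F := fun x ξ => char x ξ * f x) (fun x => (contDiff_char x).mul contDiff_const)
    (k := fun p x => ‖listMono (stdBasis d) p x * f x‖)
    (fun p => (hint p []).norm) (fun p x ξ => by
      rw [hder, norm_mul, norm_pow, Complex.norm_I, one_pow, one_mul, norm_mul, norm_char, one_mul])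
    (fun p ξ => by
      simp only [hder]
      exact (continuous_const.mul ((contDiff_char ξ).continuous.mul
        (hsm p).continuous)).aestronglyMeasurable)
  refine ⟨hF.1, D * M ^ d * ∫ x : EuclideanSpace ℝ (Fin d), decay x, ?_⟩
  rw [hasGSBound_iff hσ' (by positivity)]
  intro q p ξ
  have h1 : listDeriv (stdBasis d) p (fourier f) ξ =
      Complex.I ^ p.length * ∫ x, char ξ x * ((fun x => (listMono (stdBasis d) p x : ℂ)) * f) x := by
    rw [← integral_const_mul]
    refine (hF.2 p ξ).trans (integral_congr_ae (Eventually.of_forall fun x => hder p x ξ))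
  rw [h1, norm_mul, norm_pow, Complex.norm_I, one_pow, one_mul,
    listMono_mul_norm_integral_char ξ (hsm p) (hint p) q]
  have h2 : ‖∫ x, char ξ x * listDeriv (stdBasis d) q
      ((fun x => (listMono (stdBasis d) p x : ℂ)) * f) x‖ ≤
      ∫ x : EuclideanSpace ℝ (Fin d),
        D * (2 ^ q.length * ∏ i, u (p.count i) (q.count i)) * decay x := by
    refine norm_integral_le_of_norm_le ((integrable_decay volume).const_mul _)
      (Eventually.of_forall fun x => ?_)
    rw [norm_mul, norm_char, one_mul]
    exact hmixed p q x
  rw [integral_const_mul] at h2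
  refine h2.trans ?_
  have hJ : 0 ≤ ∫ x : EuclideanSpace ℝ (Fin d), decay x := integral_nonneg fun x => (decay_pos x).le
  have h3 : ∏ i, u (p.count i) (q.count i) ≤ M ^ d * ((2 ^ σ * k) ^ p.length * (2 ^ σ * k) ^ q.length *
      (facWeight (fun _ => s) p * facWeight (fun _ => σ) q)) := by
    calc _ ≤ ∏ i, M * ((2 ^ σ * k) ^ (p.count i + q.count i) *
          (((p.count i).factorial : ℝ) ^ s * ((q.count i).factorial : ℝ) ^ σ)) :=
          Finset.prod_le_prod (fun i _ => hu _ _) fun i _ => huM _ _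
      _ = _ := by
          rw [← prod_pow_count _ p, ← prod_pow_count _ q]
          simp only [facWeight, Finset.prod_mul_distrib, Finset.prod_const, Finset.card_univ,
            Fintype.card_fin, pow_add]
  have wp := facWeight_pos (fun _ : Fin d => s) p
  have wq := facWeight_pos (fun _ : Fin d => σ) q
  calc _ ≤ D * (2 ^ q.length * (M ^ d * ((2 ^ σ * k) ^ p.length * (2 ^ σ * k) ^ q.length *
      (facWeight (fun _ => s) p * facWeight (fun _ => σ) q)))) * ∫ x : EuclideanSpace ℝ (Fin d), decay x := by
        gcongr
    _ ≤ D * (2 ^ q.length * 2 ^ p.length * (M ^ d * ((2 ^ σ * k) ^ p.length * (2 ^ σ * k) ^ q.length *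
      (facWeight (fun _ => s) p * facWeight (fun _ => σ) q)))) * ∫ x : EuclideanSpace ℝ (Fin d), decay x := by
        gcongr
        exact le_mul_of_one_le_right (by positivity) (one_le_pow₀ one_le_two)
    _ = _ := by
        simp only [mul_pow]
        ring

end fourier

/-! ### Nontriviality forces s + σ ≥ 1 or s + σ > 1 -/

section moments

variable {ι V : Type*} [NormedAddCommGroup V] [NormedSpace ℝ V] [FiniteDimensional ℝ V]
  [MeasurableSpace V] [BorelSpace V] [Fintype ι] [DecidableEq ι] {b : Module.Basis ι ℝ V}
  (μ : Measure V) [μ.IsAddHaarMeasure] {s σ : ι → ℝ} {h C : ℝ} {w : V → ℂ}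

theorem HasGSBound.integrable_listMono_mul (hs : ∀ i, 0 < s i) (hh : 0 < h) (hw : ContDiff ℝ ∞ w)
    (H : HasGSBound b s σ h C w) (p q : List ι) :
    Integrable (fun x => (listMono b p x : ℂ) * listDeriv b q w x) μ := by
  obtain ⟨D, -, hD⟩ := H.exists_listMono_mul_le hs hh
  refine ((integrable_decay μ).const_mul (D * ((dbl s * h) ^ p.length * facWeight s p *
    ((dbl s * h) ^ q.length * facWeight σ q)))).mono' ?_ (Eventually.of_forall fun x => ?_)
  · exact ((contDiff_listMono b p).continuous.mul
      (contDiff_listDeriv hw q).continuous).aestronglyMeasurable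
  · rw [norm_mul, Complex.norm_real, Real.norm_eq_abs]
    exact (hD p q x).trans (le_of_eq (by ring))

/-- Each of the n integrations by parts lowers the exponent of x_i by one and brings it down as a
factor. -/
theorem HasGSBound.integral_listMono_mul (hs : ∀ i, 0 < s i) (hh : 0 < h) (hw : ContDiff ℝ ∞ w)
    (H : HasGSBound b s σ h C w) (i : ι) (n : ℕ) :
    ∫ x, (listMono b (List.replicate n i) x : ℂ) * listDeriv b (List.replicate n i) w x ∂μ =
      (-1) ^ n * n.factorial * ∫ x, w x ∂μ := by
  have step (p q : List ι) : ∫ x, (listMono b p x : ℂ) * listDeriv b (i :: q) w x ∂μ =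
      -(p.count i * ∫ x, (listMono b (p.erase i) x : ℂ) * listDeriv b q w x ∂μ) := by
    have e (x) : fderiv ℝ (fun x => (listMono b p x : ℂ)) x (b i) =
        p.count i * (listMono b (p.erase i) x : ℂ) := congrFun (dirDeriv_listMono p i) x
    have := integral_mul_fderiv_eq_neg_fderiv_mul_of_integrable (μ := μ)
      (f := fun x => (listMono b p x : ℂ)) (g := listDeriv b q w) (v := b i) ?_
      (H.integrable_listMono_mul μ hs hh hw p (i :: q)) (H.integrable_listMono_mul μ hs hh hw p q)
      (fun x _ => (contDiff_listMono b p).differentiable (by simp) x)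
      (fun x _ => (contDiff_listDeriv hw q).differentiable (by simp) x)
    · change ∫ x, (listMono b p x : ℂ) * listDeriv b (i :: q) w x ∂μ = _ at this
      rw [this]
      simp only [e, mul_assoc]
      rw [integral_const_mul]
    · simp only [e, mul_assoc]
      exact (H.integrable_listMono_mul μ hs hh hw (p.erase i) q).const_mul _
  induction n with
  | zero => simp
  | succ n ih =>
    have h1 : (List.replicate (n + 1) i).erase i = List.replicate n i := by
      rw [List.replicate_succ, List.erase_cons_head]
    have h2 := step (List.replicate (n + 1) i) (List.replicate n i)
    rw [h1, ih, List.count_replicate_self] at h2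
    rw [show i :: List.replicate n i = List.replicate (n + 1) i from rfl] at h2
    rw [h2, Nat.factorial_succ]
    push_cast
    ring

/-- The moment of x_i^n ∂_i^n w is n! ∫ w up to sign, while the Gelfand-Shilov bounds limit it to a
multiple of k^{2n} n!^{s+σ} with k = `dbl s` · h. -/
theorem HasGSBound.exists_factorial_mul_le {s σ : ℝ} (hs : 0 < s) (hh : 0 < h)
    (hw : ContDiff ℝ ∞ w) (H : HasGSBound b (fun _ => s) (fun _ => σ) h C w) (i : ι) :
    ∃ B, 0 ≤ B ∧ ∀ n : ℕ, (n.factorial : ℝ) ^ (1 - s - σ) * ‖∫ x, w x ∂μ‖ ≤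
      B * ((dbl (fun _ : ι => s) * h) ^ 2) ^ n := by
  obtain ⟨D, hD0, hD⟩ := H.exists_listMono_mul_le (fun _ => hs) hh
  refine ⟨D * ∫ x, decay x ∂μ, mul_nonneg hD0 (integral_nonneg fun x => (decay_pos x).le), fun n => ?_⟩
  have h1 := congrArg norm (H.integral_listMono_mul μ (fun _ => hs) hh hw i n)
  rw [norm_mul, norm_mul, norm_pow, norm_neg, norm_one, one_pow, one_mul, Complex.norm_natCast] at h1
  have fw (t : ℝ) : facWeight (fun _ : ι => t) (List.replicate n i) = (n.factorial : ℝ) ^ t := by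
    rw [facWeight, Finset.prod_eq_single i]
    · rw [List.count_replicate_self]
    · intro j _ hj
      rw [List.count_replicate]
      simp [hj.symm]
    · simp
  have h2 : ‖∫ x, (listMono b (List.replicate n i) x : ℂ) * listDeriv b (List.replicate n i) w x ∂μ‖ ≤
      ∫ x, D * ((dbl (fun _ : ι => s) * h) ^ n * (n.factorial : ℝ) ^ s *
        ((dbl (fun _ : ι => s) * h) ^ n * (n.factorial : ℝ) ^ σ)) * decay x ∂μ := by
    refine norm_integral_le_of_norm_le ((integrable_decay μ).const_mul _)
      (Eventually.of_forall fun x => ?_)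
    rw [norm_mul, Complex.norm_real, Real.norm_eq_abs]
    refine (hD _ _ x).trans (le_of_eq ?_)
    rw [fw, fw, List.length_replicate]
    ring
  rw [h1, integral_const_mul] at h2
  have hn : (0 : ℝ) < n.factorial := by exact_mod_cast n.factorial_pos
  have h3 : (n.factorial : ℝ) = (n.factorial : ℝ) ^ (1 - s - σ) *
      ((n.factorial : ℝ) ^ s * (n.factorial : ℝ) ^ σ) := by
    rw [← Real.rpow_add hn, ← Real.rpow_add hn]
    conv_lhs => rw [← Real.rpow_one (n.factorial : ℝ)]
    congr 1
    ring
  have hp : (0 : ℝ) < (n.factorial : ℝ) ^ s * (n.factorial : ℝ) ^ σ := by positivity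
  rw [← mul_le_mul_iff_of_pos_right hp]
  calc _ = (n.factorial : ℝ) * ‖∫ x, w x ∂μ‖ := by
        conv_rhs => rw [h3]
        ring
    _ ≤ _ := h2
    _ = _ := by ring

theorem not_forall_le_mul_pow {a B r : ℝ} (ha : 0 < a) (hr0 : 0 ≤ r) (hr : r < 1) :
    ¬ ∀ n : ℕ, a ≤ B * r ^ n := by
  intro H
  have h1 : Tendsto (fun n : ℕ => B * r ^ n) atTop (nhds (B * 0)) :=
    (tendsto_pow_atTop_nhds_zero_of_lt_one hr0 hr).const_mul B
  rw [mul_zero] at h1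
  exact absurd (ge_of_tendsto' h1 H) (not_le.2 ha)

/-- For s + σ < 1 the power n!^{1-s-σ} would outgrow every geometric sequence. -/
theorem HasGSBound.one_le_add {s σ : ℝ} (hs : 0 < s) (hh : 0 < h)
    (hw : ContDiff ℝ ∞ w) (H : HasGSBound b (fun _ => s) (fun _ => σ) h C w) (i : ι)
    (h0 : ∫ x, w x ∂μ ≠ 0) : 1 ≤ s + σ := by
  by_contra! hlt
  obtain ⟨B, hB, h1⟩ := H.exists_factorial_mul_le μ hs hh hw i
  obtain ⟨k, hk⟩ : ∃ k, k = (dbl (fun _ : ι => s) * h) ^ 2 := ⟨_, rfl⟩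
  rw [← hk] at h1
  have hk0 : 0 ≤ k := hk ▸ sq_nonneg _
  -- The doubled base 2k leaves the factor (1/2)^n, which tends to zero.
  obtain ⟨B', hB'⟩ := exists_pow_div_factorial_rpow_le (s := 1 - s - σ) (by linarith)
    (t := 2 * k) (by positivity)
  refine not_forall_le_mul_pow (norm_pos_iff.2 h0) (r := 1 / 2) (B := B * B') (by norm_num)
    (by norm_num) fun n => ?_
  have hn : (0 : ℝ) < (n.factorial : ℝ) ^ (1 - s - σ) := by positivity
  have h2 := h1 n
  have h3 := hB' n
  rw [← le_div_iff₀' hn] at h2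
  refine h2.trans ?_
  calc B * k ^ n / (n.factorial : ℝ) ^ (1 - s - σ) =
        B * ((2 * k) ^ n / (n.factorial : ℝ) ^ (1 - s - σ)) * (1 / 2) ^ n := by
        rw [mul_pow, one_div, inv_pow]
        field_simp
    _ ≤ _ := by gcongr

/-- For s + σ ≤ 1 the power n!^{1-s-σ} is at least 1, and a small h makes the geometric factor tend
to zero. -/
theorem one_lt_add_of_forall_hasGSBound {s σ : ℝ} (hs : 0 < s)
    (hw : ContDiff ℝ ∞ w) (H : ∀ h, 0 < h → ∃ C, HasGSBound b (fun _ => s) (fun _ => σ) h C w) (i : ι)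
    (h0 : ∫ x, w x ∂μ ≠ 0) : 1 < s + σ := by
  by_contra! hlt
  have hK := one_le_dbl (fun _ : ι => hs)
  have hK0 : 0 < dbl (fun _ : ι => s) := one_pos.trans_le hK
  -- This h makes the ratio (`dbl s` · h)² equal to 1/4.
  have hh : 0 < 1 / (2 * dbl (fun _ : ι => s)) := by positivity
  obtain ⟨C, hC⟩ := H _ hh
  obtain ⟨B, hB, h1⟩ := hC.exists_factorial_mul_le μ hs hh hw i
  refine not_forall_le_mul_pow (norm_pos_iff.2 h0) (r := 1 / 4) (B := B) (by norm_num)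
    (by norm_num) fun n => ?_
  have h2 := h1 n
  rw [show (dbl (fun _ : ι => s) * (1 / (2 * dbl (fun _ : ι => s)))) ^ 2 = 1 / 4 by
    field_simp; norm_num] at h2
  refine le_trans ?_ h2
  refine le_mul_of_one_le_left (norm_nonneg _) (Real.one_le_rpow ?_ (by linarith))
  exact_mod_cast n.factorial_pos

end moments

/-! ### Existence of windows -/

section windows

variable {d : ℕ} (e : Module.Basis (Fin d) ℝ (EuclideanSpace ℝ (Fin d))) {s σ : ℝ}
  {f : EuclideanSpace ℝ (Fin d) → ℂ}

theorem fourier_zero (w : EuclideanSpace ℝ (Fin d) → ℂ) : fourier w 0 = ∫ x, w x := by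
  simp [fourier, char]

/-- For d = 0 there is no coordinate on which the moment argument could act, but then the exponents
are irrelevant and can be replaced by 1 and 1; this is the role of `p 2`. -/
theorem exists_const_eq (hs : 0 < s) (hσ : 0 < σ) {p : ℝ → Prop} (hp : p 2)
    (H : Fin d → p (s + σ)) : ∃ s' σ', 0 < s' ∧ 0 < σ' ∧ p (s' + σ') ∧
      (fun _ : Fin d => s) = (fun _ => s') ∧ (fun _ : Fin d => σ) = fun _ => σ' := by
  rcases Nat.eq_zero_or_pos d with rfl | hd
  · exact ⟨1, 1, one_pos, one_pos, by norm_num; exact hp, Subsingleton.elim _ _, Subsingleton.elim _ _⟩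
  · exact ⟨s, σ, hs, hσ, H ⟨0, hd⟩, rfl, rfl⟩

theorem HasGSBound.fourier_bound_roumieu (hs : 0 < s) (hσ : 0 < σ) (hsum : Fin d → 1 ≤ s + σ)
    (hf : ContDiff ℝ ∞ f) {h C : ℝ} (hh : 0 < h)
    (H : HasGSBound (stdBasis d) (fun _ => s) (fun _ => σ) h C f) : ContDiff ℝ ∞ (fourier f) ∧
      ∃ h', 0 < h' ∧ ∃ C', HasGSBound (stdBasis d) (fun _ => σ) (fun _ => s) h' C' (fourier f) := by
  obtain ⟨s', σ', hs', hσ', hsum, es, eσ⟩ := exists_const_eq (d := d) hs hσ (p := fun t => 1 ≤ t)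
    one_le_two hsum
  rw [es, eσ] at H
  rw [es, eσ]
  obtain ⟨k, hk, hk2⟩ : ∃ k, 1 ≤ k ∧ h ≤ k := ⟨max 1 h, le_max_left _ _, le_max_right _ _⟩
  have hk0 : 0 < k := one_pos.trans_le hk
  have H3 := H.mono (fun _ => hs') hh hk2 le_rfl (H.nonneg (fun _ => hs') hh)
  have hdk : 1 ≤ dbl (fun _ : Fin d => s') * k :=
    one_le_mul_of_one_le_of_one_le (one_le_dbl fun _ => hs') hk
  have hdk0 := one_pos.trans_le hdk
  -- For exponents with sum at least 1 and k ≥ 1, the constant factor v = 1 is admissible: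
  -- (n+1)^{1-s'-σ'} ≤ 1 ≤ (`dbl s'` · k)².
  obtain ⟨hFs, HF⟩ := H3.fourier_bound hs' hσ' hk0 hf (v := fun _ => 1) (M := 1)
    (fun _ => le_rfl) (fun _ => le_rfl) (fun n => by
      rw [mul_one, mul_one]
      refine (Real.rpow_le_one_of_one_le_of_nonpos ?_ (by linarith)).trans (one_le_pow₀ hdk)
      exact_mod_cast Nat.le_add_left 1 n)
  exact ⟨hFs, _, by positivity, HF⟩

theorem fourier_bound_beurling (hs : 0 < s) (hσ : 0 < σ) (hsum : Fin d → 1 < s + σ)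
    (hf : ContDiff ℝ ∞ f)
    (H : ∀ h, 0 < h → ∃ C, HasGSBound (stdBasis d) (fun _ => s) (fun _ => σ) h C f) :
    ContDiff ℝ ∞ (fourier f) ∧ ∀ h, 0 < h →
      ∃ C, HasGSBound (stdBasis d) (fun _ => σ) (fun _ => s) h C (fourier f) := by
  obtain ⟨s', σ', hs', hσ', hsum, es, eσ⟩ := exists_const_eq (d := d) hs hσ (p := fun t => 1 < t)
    one_lt_two hsum
  rw [es, eσ] at H
  rw [es, eσ]
  have hK0 := one_pos.trans_le (one_le_dbl (fun _ : Fin d => hs'))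
  have key : ∀ h, 0 < h → ContDiff ℝ ∞ (fourier f) ∧
      ∃ C, HasGSBound (stdBasis d) (fun _ => σ') (fun _ => s') h C (fourier f) := fun h hh => by
    obtain ⟨k, hk⟩ : ∃ k, k = h / (2 * (2 ^ σ' * dbl (fun _ : Fin d => s'))) := ⟨_, rfl⟩
    have hk0 : 0 < k := by rw [hk]; positivity
    obtain ⟨C, hC⟩ := H k hk0
    obtain ⟨M, v, hv1, hvM, hv⟩ := exists_rpow_weight (t := 1 - s' - σ') (by linarith)
      (k := dbl (fun _ : Fin d => s') * k) (by positivity)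
    obtain ⟨h1, C', h2⟩ := hC.fourier_bound hs' hσ' hk0 hf hv1 hvM hv
    refine ⟨h1, C', ?_⟩
    rwa [show 2 * (2 ^ σ' * (dbl (fun _ : Fin d => s') * k)) = h by rw [hk]; field_simp] at h2
  exact ⟨(key 1 one_pos).1, fun h hh => (key h hh).2⟩

/-- Windows for `zakAdjInv` in the Roumieu case. -/
theorem exists_windows_roumieu (hs : 0 < s) (hσ : 0 < σ) (hf : ContDiff ℝ ∞ f) (h0 : f ≠ 0)
    {h C : ℝ} (hh : 0 < h) (H : HasGSBound (stdBasis d) (fun _ => s) (fun _ => σ) h C f) :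
    ∃ g γ : EuclideanSpace ℝ (Fin d) → ℂ, ContDiff ℝ ∞ g ∧ ContDiff ℝ ∞ γ ∧
      (∀ x, ∑' k : Zak.lattice e, g (x - k) = 1) ∧
      (∀ ξ, ∑' κ : Zak.lattice (Zak.dualVec e), γ (ξ - κ) = 1) ∧
      ∃ h, 0 < h ∧ (∃ C, HasGSBound (stdBasis d) (fun _ => s) (fun _ => σ) h C g) ∧
        ∃ C, HasGSBound (stdBasis d) (fun _ => σ) (fun _ => s) h C γ := by
  obtain ⟨w, hwdef⟩ : ∃ w, w = f * fun x => star (f x) := ⟨_, rfl⟩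
  have hw : ContDiff ℝ ∞ w := hwdef ▸ hf.mul (contDiff_star hf)
  have H2 := H.mul_star (fun _ => hs) (fun _ => hσ) hh hf
  rw [← hwdef] at H2
  have p2 : 0 < 2 * h := by positivity
  have hi : Integrable w := H2.integrable volume (fun _ => hs) p2 hw []
  have hI : ∫ x, w x ≠ 0 := by
    rw [hwdef] at hi ⊢
    exact integral_mul_star_ne_zero volume hf.continuous hi h0
  obtain ⟨g, hg, hg1, hgb⟩ := exists_window volume (fun _ => hs) (fun _ => hσ) (Zak.lattice e)
    (isAddFundamentalDomain_lattice e) (ZSpan.fundamentalDomain_isBounded e) hf h0 hh H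
  obtain ⟨Cg, hCg⟩ := hgb hh H
  obtain ⟨hFs, k, hk, C', HF⟩ := H2.fourier_bound_roumieu hs hσ
    (fun i => H2.one_le_add volume hs p2 hw i hI) hw p2
  have hF0 : fourier w ≠ 0 := fun h => hI (by rw [← fourier_zero, h, Pi.zero_apply])
  obtain ⟨γ, hγ, hγ1, hγb⟩ := exists_window volume (fun _ => hσ) (fun _ => hs)
    (Zak.lattice (Zak.dualVec e)) (isAddFundamentalDomain_dual e)
    (ZSpan.fundamentalDomain_isBounded _) hFs hF0 hk HF
  obtain ⟨Cγ, hCγ⟩ := hγb hk HF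
  have p1 : 0 < 4 * h := by positivity
  have p3 : 0 < 4 * k := by positivity
  exact ⟨g, γ, hg, hγ, hg1, hγ1, _, lt_max_of_lt_left p1,
    ⟨_, hCg.mono (fun _ => hs) p1 (le_max_left _ _) le_rfl (hCg.nonneg (fun _ => hs) p1)⟩,
    ⟨_, hCγ.mono (fun _ => hσ) p3 (le_max_right _ _) le_rfl (hCγ.nonneg (fun _ => hσ) p3)⟩⟩

/-- Windows for `zakAdjInv` in the Beurling case. -/
theorem exists_windows_beurling (hs : 0 < s) (hσ : 0 < σ) (hf : ContDiff ℝ ∞ f) (h0 : f ≠ 0)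
    (H : ∀ h, 0 < h → ∃ C, HasGSBound (stdBasis d) (fun _ => s) (fun _ => σ) h C f) :
    ∃ g γ : EuclideanSpace ℝ (Fin d) → ℂ, ContDiff ℝ ∞ g ∧ ContDiff ℝ ∞ γ ∧
      (∀ x, ∑' k : Zak.lattice e, g (x - k) = 1) ∧
      (∀ ξ, ∑' κ : Zak.lattice (Zak.dualVec e), γ (ξ - κ) = 1) ∧
      ∀ h, 0 < h → (∃ C, HasGSBound (stdBasis d) (fun _ => s) (fun _ => σ) h C g) ∧
        ∃ C, HasGSBound (stdBasis d) (fun _ => σ) (fun _ => s) h C γ := by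
  obtain ⟨w, hwdef⟩ : ∃ w, w = f * fun x => star (f x) := ⟨_, rfl⟩
  have hw : ContDiff ℝ ∞ w := hwdef ▸ hf.mul (contDiff_star hf)
  have H2 : ∀ h, 0 < h → ∃ C, HasGSBound (stdBasis d) (fun _ => s) (fun _ => σ) h C w := fun h hh => by
    obtain ⟨C, hC⟩ := H (h / 2) (by positivity)
    have := hC.mul_star (fun _ => hs) (fun _ => hσ) (by positivity) hf
    rw [mul_div_cancel₀ _ two_ne_zero, ← hwdef] at this
    exact ⟨_, this⟩
  obtain ⟨C₁, hC₁⟩ := H 1 one_pos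
  obtain ⟨C₂, hC₂⟩ := H2 1 one_pos
  have hi : Integrable w := hC₂.integrable volume (fun _ => hs) one_pos hw []
  have hI : ∫ x, w x ≠ 0 := by
    rw [hwdef] at hi ⊢
    exact integral_mul_star_ne_zero volume hf.continuous hi h0
  obtain ⟨g, hg, hg1, hgb⟩ := exists_window volume (fun _ => hs) (fun _ => hσ) (Zak.lattice e)
    (isAddFundamentalDomain_lattice e) (ZSpan.fundamentalDomain_isBounded e) hf h0 one_pos hC₁
  obtain ⟨hFs, HF⟩ := fourier_bound_beurling hs hσ
    (fun i => one_lt_add_of_forall_hasGSBound volume hs hw H2 i hI) hw H2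
  have hF0 : fourier w ≠ 0 := fun h => hI (by rw [← fourier_zero, h, Pi.zero_apply])
  obtain ⟨C', HF1⟩ := HF 1 one_pos
  obtain ⟨γ, hγ, hγ1, hγb⟩ := exists_window volume (fun _ => hσ) (fun _ => hs)
    (Zak.lattice (Zak.dualVec e)) (isAddFundamentalDomain_dual e)
    (ZSpan.fundamentalDomain_isBounded _) hFs hF0 one_pos HF1
  refine ⟨g, γ, hg, hγ, hg1, hγ1, fun h hh => ?_⟩
  have p4 : 0 < h / 4 := by positivity
  obtain ⟨_, hC⟩ := H _ p4
  obtain ⟨_, hC'⟩ := HF _ p4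
  have h3 := hgb p4 hC
  have h4 := hγb p4 hC'
  rw [mul_div_cancel₀ _ four_ne_zero] at h3 h4
  exact ⟨h3, h4⟩

end windows

/-! ### Bounds and continuity in the Roumieu and Beurling spaces -/

section spaces

/-- A space of smooth functions on `V`, with pointwise operations. -/
class SmoothSpace (X : Type*) (V : outParam Type*) [NormedAddCommGroup V] [NormedSpace ℝ V]
    [AddCommGroup X] [Module ℂ X] [FunLike X V ℂ] : Prop where
  coe_add : ∀ f g : X, ⇑(f + g) = ⇑f + ⇑g
  coe_smul : ∀ (c : ℂ) (f : X), ⇑(c • f) = c • ⇑f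
  contDiff : ∀ f : X, ContDiff ℝ ∞ f

variable {ι V : Type*} [NormedAddCommGroup V] [NormedSpace ℝ V] [Fintype ι] [DecidableEq ι]
  {b : Module.Basis ι ℝ V} {s σ : ι → ℝ} {h : ℝ}

instance (b : Module.Basis ι ℝ V) (s σ : ι → ℝ) : SmoothSpace (Roumieu b s σ) V where
  coe_add _ _ := rfl
  coe_smul _ _ := rfl
  contDiff f := f.2.1

instance (b : Module.Basis ι ℝ V) (s σ : ι → ℝ) : SmoothSpace (Beurling b s σ) V where
  coe_add _ _ := rfl
  coe_smul _ _ := rfl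
  contDiff f := f.2.1

section SmoothSpace

variable {X : Type*} [AddCommGroup X] [Module ℂ X] [FunLike X V ℂ] [SmoothSpace X V]

/-- The inclusion of a space of smooth functions into the space of all functions. -/
def coeLin : X →ₗ[ℂ] V → ℂ where
  toFun f := f
  map_add' := SmoothSpace.coe_add
  map_smul' := SmoothSpace.coe_smul

theorem coeLin_apply (f : X) : coeLin f = (f : V → ℂ) := rfl

/-- The remainder of a partial sum satisfies the bound given by the tail of ∑ c, and F is bounded
with respect to the same h. No convergence in the topology of X is needed. -/
theorem hasSum_of_hasGSBound [FiniteDimensional ℝ V] (hs : ∀ i, 0 < s i) (hh : 0 < h) {F : X →ₗ[ℂ] ℂ}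
    {K : ℝ} (hF : ∀ (φ : X) (C : ℝ), HasGSBound b s σ h C φ → ‖F φ‖ ≤ K * C) {T : Type*} [Countable T]
    {φ : T → X} {c : T → ℝ} (hc : Summable c) (hb : ∀ t, HasGSBound b s σ h (c t) (φ t)) {Φ : X}
    (hΦ : ∀ x, Φ x = ∑' t, φ t x) : HasSum (fun t => F (φ t)) (F Φ) := by
  classical
  have hsum (x : V) : Summable fun t => φ t x := by
    refine Summable.of_norm_bounded hc fun t => ((hb t).norm_le x).trans ?_
    exact div_le_self ((hb t).nonneg hs hh) (one_le_growth hs hh x)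
  have hle (S : Finset T) : ‖F Φ - ∑ t ∈ S, F (φ t)‖ ≤ K * ∑' t : {t // t ∉ S}, c t := by
    have e : F Φ - ∑ t ∈ S, F (φ t) = F (Φ - ∑ t ∈ S, φ t) := by rw [map_sub, map_sum]
    rw [e]
    refine hF _ _ fun x => ?_
    have e2 : ((Φ - ∑ t ∈ S, φ t : X) : V → ℂ) = fun x => ∑' t : {t // t ∉ S}, φ t x := by
      rw [← coeLin_apply, map_sub, map_sum]
      ext x
      rw [Pi.sub_apply, Finset.sum_apply, sub_eq_iff_eq_add', coeLin_apply, hΦ,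
        ← (hsum x).sum_add_tsum_subtype_compl S]
      rfl
    rw [e2]
    have hcS : Summable fun t : {t // t ∉ S} => c t := hc.subtype _
    refine (derivBound_tsum (T := {t // t ∉ S}) (F := fun t => φ t)
      (A := fun t x => c t / growth b s h x) hh.le (fun t => SmoothSpace.contDiff (φ t)) hcS
      (fun t x => div_le_self ((hb t).nonneg hs hh) (one_le_growth hs hh x)) (fun t x => hb t x) x
      (hcS.div_const (growth b s h x)) (fun t => le_rfl)).mono hh.le le_rfl (le_of_eq ?_)
    rw [tsum_div_const]
  have h0 : Tendsto (fun S : Finset T => K * ∑' t : {t // t ∉ S}, c t) atTop (nhds 0) := by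
    simpa using (tendsto_tsum_compl_atTop_zero c).const_mul K
  rw [HasSum, SummationFilter.unconditional_filter, tendsto_iff_norm_sub_tendsto_zero]
  refine squeeze_zero (fun _ => norm_nonneg _) (fun S => ?_) h0
  rw [norm_sub_rev]
  exact hle S

end SmoothSpace

theorem HasGSBound.comp_add (hs : ∀ i, 0 < s i) (hh : 0 < h) {C : ℝ} {f : V → ℂ}
    (H : HasGSBound b s σ h C f) (a : V) :
    HasGSBound b s σ (2 * h) (C * growth b s h a) (fun x => f (x + a)) := fun x => by
  have h1 := growth_add_le (b := b) hs hh (x + a) (-a)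
  rw [add_neg_cancel_right, growth_neg] at h1
  have h2 := growth_pos (b := b) hs (by positivity : 0 < 2 * h) x
  have h3 := growth_pos (b := b) hs hh (x + a)
  refine (H (x + a)).comp_add.mono hh.le (by linarith) ?_
  rw [div_le_div_iff₀ h3 h2, mul_assoc]
  refine mul_le_mul_of_nonneg_left ?_ (H.nonneg hs hh)
  rwa [mul_comm (growth b s h a)]

section roumieu

theorem Roumieu.exists_hasGSBound (hs : ∀ i, 0 < s i) (φ : Roumieu b s σ) :
    ∃ h, 0 < h ∧ ∃ C, HasGSBound b s σ h C φ := by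
  obtain ⟨hφ, h, hh, hfin⟩ := φ.2
  obtain ⟨C, -, hC⟩ := (gsNorm_lt_top_iff hs hh hφ).1 hfin
  exact ⟨h, hh, C, hC⟩

theorem Roumieu.exists_coe_eq (hs : ∀ i, 0 < s i) {f : V → ℂ} (hf : ContDiff ℝ ∞ f) {C : ℝ}
    (hh : 0 < h) (H : HasGSBound b s σ h C f) : ∃ φ : Roumieu b s σ, ⇑φ = f :=
  ⟨⟨f, hf, h, hh, (gsNorm_lt_top_iff hs hh hf).2 ⟨C, H.nonneg hs hh, H⟩⟩, rfl⟩

theorem exists_le_mul_gsNorm_iff (hs : ∀ i, 0 < s i) (hh : 0 < h) {X : Type*} [AddCommGroup X]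
    [Module ℂ X] [FunLike X V ℂ] [SmoothSpace X V] (q : Seminorm ℂ X) :
    (∃ C : ℝ≥0, ∀ f : X, ENNReal.ofReal (q f) ≤ C * gsNorm b s σ h f) ↔
    ∃ K : ℝ, 0 ≤ K ∧ ∀ (f : X) (C : ℝ), HasGSBound b s σ h C f → q f ≤ K * C := by
  constructor
  · rintro ⟨K, hK⟩
    refine ⟨K, K.coe_nonneg, fun f C hC => ?_⟩
    have h0 := hC.nonneg hs hh
    rw [← ENNReal.ofReal_le_ofReal_iff (mul_nonneg K.coe_nonneg h0), ENNReal.ofReal_mul K.coe_nonneg]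
    refine (hK f).trans ?_
    rw [ENNReal.ofReal_coe_nnreal]
    gcongr
    exact (gsNorm_le_iff hs hh (SmoothSpace.contDiff f) h0).2 hC
  · rintro ⟨K, hK0, hK⟩
    refine ⟨K.toNNReal + 1, fun f => ?_⟩
    by_cases hf : gsNorm b s σ h f < ⊤
    · have h1 := (gsNorm_le_iff hs hh (SmoothSpace.contDiff f) ENNReal.toReal_nonneg).1
        (ENNReal.ofReal_toReal hf.ne).ge
      refine (ENNReal.ofReal_le_ofReal (hK f _ h1)).trans ?_
      rw [ENNReal.ofReal_mul hK0, ENNReal.ofReal_toReal hf.ne]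
      gcongr
      push_cast
      exact le_self_add
    · rw [not_lt_top_iff.1 hf, ENNReal.mul_top (by simp)]
      exact le_top

/-- A continuous seminorm is dominated by finitely many of the defining ones, and these are exactly
the seminorms bounded on every step of the inductive limit. -/
theorem Roumieu.continuous_seminorm_iff (hs : ∀ i, 0 < s i) (q : Seminorm ℂ (Roumieu b s σ)) :
    Continuous q ↔ ∀ h : ℝ, 0 < h → ∃ K : ℝ, 0 ≤ K ∧ ∀ (f : Roumieu b s σ) (C : ℝ),
      HasGSBound b s σ h C f → q f ≤ K * C := by
  constructor
  · intro hq h hh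
    obtain ⟨S, K, -, hle⟩ := Seminorm.bound_of_continuous (roumieu_withSeminorms b s σ) q hq
    choose K' hK' hb using fun p : {p : Seminorm ℂ (Roumieu b s σ) // ∀ h : ℝ, 0 < h →
      ∃ C : ℝ≥0, ∀ f : Roumieu b s σ, ENNReal.ofReal (p f) ≤ C * gsNorm b s σ h f} =>
      (exists_le_mul_gsNorm_iff hs hh p.1).1 (p.2 h hh)
    refine ⟨K * ∑ p ∈ S, K' p, mul_nonneg K.coe_nonneg (Finset.sum_nonneg fun p _ => hK' p),
      fun f C hC => (hle f).trans ?_⟩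
    have h0 := hC.nonneg hs hh
    rw [mul_assoc]
    refine mul_le_mul_of_nonneg_left (Seminorm.finset_sup_apply_le
      (mul_nonneg (Finset.sum_nonneg fun p _ => hK' p) h0) fun p hp => ?_) K.coe_nonneg
    refine (hb p f C hC).trans (mul_le_mul_of_nonneg_right ?_ h0)
    exact Finset.single_le_sum (f := K') (fun p _ => hK' p) hp
  · intro H
    exact (roumieu_withSeminorms b s σ).continuous_seminorm
      ⟨q, fun h hh => (exists_le_mul_gsNorm_iff hs hh q).2 (H h hh)⟩

theorem Roumieu.exists_norm_apply_le (hs : ∀ i, 0 < s i) (F : StrongDual ℂ (Roumieu b s σ)) (hh : 0 < h) :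
    ∃ K : ℝ, 0 ≤ K ∧ ∀ (f : Roumieu b s σ) (C : ℝ), HasGSBound b s σ h C f → ‖F f‖ ≤ K * C :=
  (Roumieu.continuous_seminorm_iff hs ((normSeminorm ℂ ℂ).comp F.toLinearMap)).1
    (continuous_norm.comp F.continuous) h hh

variable {ι' V' : Type*} [NormedAddCommGroup V'] [NormedSpace ℝ V'] [Fintype ι'] [DecidableEq ι']
  {b' : Module.Basis ι' ℝ V'} {s' σ' : ι' → ℝ}

theorem Roumieu.continuous_of_bound (hs : ∀ i, 0 < s i) (hs' : ∀ i, 0 < s' i)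
    (T : Roumieu b s σ →ₗ[ℂ] Roumieu b' s' σ')
    (H : ∀ h : ℝ, 0 < h → ∃ h', 0 < h' ∧ ∃ M, 0 ≤ M ∧ ∀ (f : Roumieu b s σ) (C : ℝ),
      HasGSBound b s σ h C f → HasGSBound b' s' σ' h' (M * C) (T f)) : Continuous T := by
  refine WithSeminorms.continuous_of_continuous_comp (roumieu_withSeminorms b' s' σ') T fun p => ?_
  refine (Roumieu.continuous_seminorm_iff hs _).2 fun h hh => ?_
  obtain ⟨h', hh', M, hM, hT⟩ := H h hh
  obtain ⟨K, hK, hb⟩ := (exists_le_mul_gsNorm_iff hs' hh' p.1).1 (p.2 h' hh')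
  refine ⟨K * M, by positivity, fun f C hC => ?_⟩
  rw [mul_assoc]
  exact hb (T f) _ (hT f C hC)

end roumieu

section beurling

theorem Beurling.exists_hasGSBound (hs : ∀ i, 0 < s i) (φ : Beurling b s σ) (hh : 0 < h) :
    ∃ C, HasGSBound b s σ h C φ := by
  obtain ⟨C, -, hC⟩ := (gsNorm_lt_top_iff hs hh φ.2.1).1 (φ.2.2 h hh)
  exact ⟨C, hC⟩

theorem Beurling.exists_coe_eq (hs : ∀ i, 0 < s i) {f : V → ℂ} (hf : ContDiff ℝ ∞ f)
    (H : ∀ h, 0 < h → ∃ C, HasGSBound b s σ h C f) : ∃ φ : Beurling b s σ, ⇑φ = f :=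
  ⟨⟨f, hf, fun h hh => by
    obtain ⟨C, hC⟩ := H h hh
    exact (gsNorm_lt_top_iff hs hh hf).2 ⟨C, hC.nonneg hs hh, hC⟩⟩, rfl⟩

theorem beurlingSeminorm_le (hs : ∀ i, 0 < s i) (hh : 0 < h) {φ : Beurling b s σ} {C : ℝ}
    (H : HasGSBound b s σ h C φ) : beurlingSeminorm b s σ ⟨h, hh⟩ φ ≤ C :=
  ENNReal.toReal_le_of_le_ofReal (H.nonneg hs hh) ((gsNorm_le_iff hs hh φ.2.1 (H.nonneg hs hh)).2 H)

theorem hasGSBound_beurlingSeminorm (hs : ∀ i, 0 < s i) (hh : 0 < h) (φ : Beurling b s σ) :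
    HasGSBound b s σ h (beurlingSeminorm b s σ ⟨h, hh⟩ φ) φ :=
  (gsNorm_le_iff hs hh φ.2.1 ENNReal.toReal_nonneg).1 (ENNReal.ofReal_toReal (φ.2.2 h hh).ne).ge

/-- The norms increase as h decreases, so finitely many of them are dominated by the one with the
smallest h. -/
theorem Beurling.continuous_seminorm_iff (hs : ∀ i, 0 < s i) (q : Seminorm ℂ (Beurling b s σ)) :
    Continuous q ↔ ∃ h : ℝ, 0 < h ∧ ∃ K : ℝ, 0 ≤ K ∧ ∀ (f : Beurling b s σ) (C : ℝ),
      HasGSBound b s σ h C f → q f ≤ K * C := by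
  constructor
  · intro hq
    obtain ⟨S, K, -, hle⟩ := Seminorm.bound_of_continuous (beurling_withSeminorms b s σ) q hq
    obtain ⟨h, hh, hS⟩ : ∃ h : ℝ, 0 < h ∧ ∀ p ∈ S, h ≤ p.1 := by
      clear hle
      induction S using Finset.cons_induction with
      | empty => exact ⟨1, one_pos, by simp⟩
      | cons p S _ ih =>
        obtain ⟨h, hh, hS⟩ := ih
        refine ⟨min h p.1, lt_min hh p.2, fun p' hp' => ?_⟩
        rcases Finset.mem_cons.1 hp' with rfl | h'
        · exact min_le_right _ _
        · exact (min_le_left _ _).trans (hS p' h')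
    refine ⟨h, hh, K, K.coe_nonneg, fun f C hC => (hle f).trans ?_⟩
    refine mul_le_mul_of_nonneg_left ?_ K.coe_nonneg
    refine Seminorm.finset_sup_apply_le (hC.nonneg hs hh) fun p hp => ?_
    exact beurlingSeminorm_le hs p.2 (hC.mono hs hh (hS p hp) le_rfl (hC.nonneg hs hh))
  · rintro ⟨h, hh, K, hK, H⟩
    refine Seminorm.continuous_of_le (q := K.toNNReal • beurlingSeminorm b s σ ⟨h, hh⟩) ?_ fun φ => ?_
    · exact ((beurling_withSeminorms b s σ).continuous_seminorm ⟨h, hh⟩).const_smul K.toNNReal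
    · refine (H φ _ (hasGSBound_beurlingSeminorm hs hh φ)).trans (le_of_eq ?_)
      rw [smul_apply, NNReal.smul_def, smul_eq_mul, Real.coe_toNNReal _ hK]

theorem Beurling.exists_norm_apply_le (hs : ∀ i, 0 < s i) (F : StrongDual ℂ (Beurling b s σ)) :
    ∃ h : ℝ, 0 < h ∧ ∃ K : ℝ, 0 ≤ K ∧ ∀ (f : Beurling b s σ) (C : ℝ),
      HasGSBound b s σ h C f → ‖F f‖ ≤ K * C :=
  (Beurling.continuous_seminorm_iff hs ((normSeminorm ℂ ℂ).comp F.toLinearMap)).1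
    (continuous_norm.comp F.continuous)

variable {ι' V' : Type*} [NormedAddCommGroup V'] [NormedSpace ℝ V'] [Fintype ι'] [DecidableEq ι']
  {b' : Module.Basis ι' ℝ V'} {s' σ' : ι' → ℝ}

theorem Beurling.continuous_of_bound (hs : ∀ i, 0 < s i) (hs' : ∀ i, 0 < s' i)
    (T : Beurling b s σ →ₗ[ℂ] Beurling b' s' σ')
    (H : ∀ h' : ℝ, 0 < h' → ∃ h, 0 < h ∧ ∃ M, 0 ≤ M ∧ ∀ (f : Beurling b s σ) (C : ℝ),
      HasGSBound b s σ h C f → HasGSBound b' s' σ' h' (M * C) (T f)) : Continuous T := by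
  refine WithSeminorms.continuous_of_continuous_comp (beurling_withSeminorms b' s' σ') T fun p => ?_
  obtain ⟨h, hh, M, hM, hT⟩ := H p.1 p.2
  exact (Beurling.continuous_seminorm_iff hs _).2 ⟨h, hh, M, hM, fun f C hC =>
    beurlingSeminorm_le hs' p.2 (hT f C hC)⟩

end beurling

end spaces

/-! ### Quasi-periodic functionals factor through the transpose -/

section quasiPeriodic

variable {d : ℕ} (e : Module.Basis (Fin d) ℝ (EuclideanSpace ℝ (Fin d))) {s σ : Fin d → ℝ} {h : ℝ}
  {X : Type*} [AddCommGroup X] [Module ℂ X] [TopologicalSpace X]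
  [FunLike X (EuclideanSpace ℝ (Fin d) × EuclideanSpace ℝ (Fin d)) ℂ]
  [SmoothSpace X (EuclideanSpace ℝ (Fin d) × EuclideanSpace ℝ (Fin d))]
  {g γ : EuclideanSpace ℝ (Fin d) → ℂ}

omit [SmoothSpace X (EuclideanSpace ℝ (Fin d) × EuclideanSpace ℝ (Fin d))] in
-- Translation by κ leaves F unchanged, and translation by k is converted into the factor
-- e^{i⟨k,ξ⟩}. The intermediate functions have to be test functions themselves, which `htrans`
-- guarantees.
theorem apply_piece_eq {F : StrongDual ℂ X} (hF : F ∈ Zak.quasiPeriodic e X)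
    (htrans : ∀ (Φ : X) (a : EuclideanSpace ℝ (Fin d) × EuclideanSpace ℝ (Fin d)),
      ∃ Ψ : X, ∀ z, Ψ z = Φ (z + a)) {k κ : EuclideanSpace ℝ (Fin d)} (hk : k ∈ Zak.lattice e)
    (hκ : κ ∈ Zak.lattice (Zak.dualVec e)) {Φ Ψ Ψ' : X} (hΨ : ⇑Ψ = piece g γ Φ k κ)
    (hΨ' : ⇑Ψ' = windowed g γ (fun z => Φ (z + (k, κ))) k) : F Ψ = F Ψ' := by
  obtain ⟨A, hA⟩ := htrans Ψ (0, κ)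
  obtain ⟨B, hB⟩ := htrans A (k, 0)
  have h1 : F Ψ = F A := hF.2 κ hκ A Ψ fun x ξ => by
    rw [hA]
    simp
  rw [h1]
  refine hF.1 k hk B A Ψ' (fun x ξ => by rw [hB]; simp) fun x ξ => ?_
  rw [hB, hA, hΨ, hΨ', windowed, piece, char]
  simp only [Prod.mk_add_mk, add_zero, add_sub_cancel_right]
  ring

/-- The functional `F` does not distinguish `Φ` from the image of `Φ` under the projection
`(dualVol e)⁻¹ zakAdjInv ∘ zakAdj`, if it is quasi-periodic. -/
theorem apply_eq_of_mem_quasiPeriodic (hs : ∀ i, 0 < s i) (hσ : ∀ i, 0 < σ i) (hh : 0 < h)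
    (hgs : ContDiff ℝ ∞ g) (hγs : ContDiff ℝ ∞ γ) {Cg Cγ C K : ℝ}
    (hg : HasGSBound (stdBasis d) s σ h Cg g) (hγ : HasGSBound (stdBasis d) σ s h Cγ γ)
    (hg1 : ∀ x, ∑' k : Zak.lattice e, g (x - k) = 1)
    (hγ1 : ∀ ξ, ∑' κ : Zak.lattice (Zak.dualVec e), γ (ξ - κ) = 1)
    {F : StrongDual ℂ X} (hF : F ∈ Zak.quasiPeriodic e X)
    (hFb : ∀ (Φ : X) (C : ℝ), HasGSBound (stdBasis₂ d) (Sum.elim s σ) (Sum.elim σ s) (loss s σ * h) C Φ →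
      ‖F Φ‖ ≤ K * C)
    (htrans : ∀ (Φ : X) (a : EuclideanSpace ℝ (Fin d) × EuclideanSpace ℝ (Fin d)),
      ∃ Ψ : X, ∀ z, Ψ z = Φ (z + a)) {Φ Ψ : X}
    (hΦ : HasGSBound (stdBasis₂ d) (Sum.elim s σ) (Sum.elim σ s) h C Φ)
    (hpiece : ∀ k κ, ∃ Ψ : X, ⇑Ψ = piece g γ Φ k κ)
    (hwin : ∀ k κ, ∃ Ψ : X, ⇑Ψ = windowed g γ (fun z => Φ (z + (k, κ))) k)
    (hΨ : ∀ z, Ψ z = (dualVol e : ℂ)⁻¹ * zakAdjInv (Zak.lattice e) g γ (zakAdj (Zak.lattice e) Φ) z) :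
    F Φ = F Ψ := by
  have hl0 : 0 < loss s σ := one_pos.trans_le (one_le_loss hs hσ)
  have hΦs : ContDiff ℝ ∞ Φ := SmoothSpace.contDiff Φ
  choose A hA using hpiece
  choose B hB using hwin
  obtain ⟨M, hM, hb⟩ := piece_bound hs hσ hh hgs hγs hΦs hg hγ hΦ
  have hc : Summable fun p : Zak.lattice e × Zak.lattice (Zak.dualVec e) =>
      M * (decay (p.1 : EuclideanSpace ℝ (Fin d)) * decay (p.2 : EuclideanSpace ℝ (Fin d))) :=
    (Summable.mul_of_nonneg (f := fun k : Zak.lattice e => decay (k : EuclideanSpace ℝ (Fin d)))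
      (g := fun κ : Zak.lattice (Zak.dualVec e) => decay (κ : EuclideanSpace ℝ (Fin d)))
      (summable_decay _) (summable_decay _) (fun _ => (decay_pos _).le)
      (fun _ => (decay_pos _).le)).mul_left M
  obtain ⟨Dg, -, hDg⟩ := hg.exists_norm_le_decay' hs hh
  obtain ⟨Dγ, -, hDγ⟩ := hγ.exists_norm_le_decay' hσ hh
  obtain ⟨D, -, hD⟩ := hΦ.exists_norm_le_decay_mul hs hσ hh
  have hK0 : 0 < dbl s := one_pos.trans_le (one_le_dbl hs)
  obtain ⟨M', -, hS⟩ := zakAdj_bound (Zak.lattice e) hs hσ hh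
  obtain ⟨D', -, hD'⟩ := (hS hΦs hΦ).2.1.exists_norm_le_decay' hs (by positivity)
  -- F is applied term by term to two series: the pieces, which add up to Φ, and their transported
  -- versions, which add up to Ψ. The terms agree under F.
  have sA := hasSum_of_hasGSBound (b := stdBasis₂ d) (F := F.toLinearMap) (sumElim_pos hs hσ)
    (by positivity) hFb (φ := fun p : Zak.lattice e × Zak.lattice (Zak.dualVec e) => A p.1 p.2)
    hc (fun p => by rw [hA]; exact (hb p.1 p.2).1) (Φ := Φ) (fun z => by
      simp only [hA]
      exact (tsum_piece e hDg hDγ hγ1 hg1 z).symm)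
  have sB := hasSum_of_hasGSBound (b := stdBasis₂ d) (F := F.toLinearMap) (sumElim_pos hs hσ)
    (by positivity) hFb (φ := fun p : Zak.lattice e × Zak.lattice (Zak.dualVec e) => B p.1 p.2)
    hc (fun p => by rw [hB]; exact (hb p.1 p.2).2) (Φ := Ψ) (fun z => by
      rw [hΨ]
      simp only [hB]
      exact (tsum_windowed e hΦs.continuous hD hD' z).symm)
  have hAB : (fun p : Zak.lattice e × Zak.lattice (Zak.dualVec e) => F.toLinearMap (A p.1 p.2)) =
      fun p => F.toLinearMap (B p.1 p.2) :=
    funext fun p => apply_piece_eq e hF htrans p.1.2 p.2.2 (hA p.1 p.2) (hB p.1 p.2)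
  rw [hAB] at sA
  exact sA.unique sB

end quasiPeriodic

/-! ### The Zak transform of Schwartz functions -/

section schwartz

variable {d : ℕ} (e : Module.Basis (Fin d) ℝ (EuclideanSpace ℝ (Fin d))) {s σ : Fin d → ℝ} {h C : ℝ}
  {Φ : EuclideanSpace ℝ (Fin d) × EuclideanSpace ℝ (Fin d) → ℂ}

theorem exists_norm_schwartz_le_decay {V : Type*} [NormedAddCommGroup V] [NormedSpace ℝ V]
    (f : 𝓢(V, ℂ)) : ∃ C, 0 < C ∧ ∀ x, ‖f x‖ ≤ C * decay x := by
  have h1 := fun x => f.one_add_le_sup_seminorm_apply (𝕜 := ℂ) (m := (Module.finrank ℝ V + 1, 0)) le_rfl le_rfl x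
  obtain ⟨C, hC⟩ : ∃ C : ℝ, ∀ x, (1 + ‖x‖) ^ (Module.finrank ℝ V + 1) * ‖iteratedFDeriv ℝ 0 f x‖ ≤ C :=
    ⟨_, h1⟩
  refine ⟨|C| + 1, by positivity, fun x => ?_⟩
  have h2 := hC x
  rw [norm_iteratedFDeriv_zero] at h2
  rw [decay, ← div_eq_mul_inv, le_div_iff₀' (by positivity)]
  exact h2.trans ((le_abs_self C).trans (by linarith))

/-- By Peetre's inequality one factor `decay x` turns the decay in x - j into decay in j; the other
factor is kept for integration over x. For this reason Φ is bounded with a double factor below. -/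
theorem decay_sub_mul_le {V : Type*} [NormedAddCommGroup V] [NormedSpace ℝ V] (x j : V) :
    decay (x - j) * (decay x * decay x) ≤ decay j * decay x := by
  have h1 := decay_add_le (-j) x
  rw [decay_neg, neg_add_eq_sub] at h1
  have hx := decay_pos x
  rw [← mul_assoc]
  refine mul_le_mul_of_nonneg_right ?_ hx.le
  rw [← le_div_iff₀ hx, div_eq_mul_inv, show (decay x)⁻¹ = (1 + ‖x‖) ^ (Module.finrank ℝ V + 1) from
    inv_inv _, mul_comm]
  exact h1

theorem HasGSBound.exists_norm_le_decay_sq_mul (hs : ∀ i, 0 < s i) (hσ : ∀ i, 0 < σ i) (hh : 0 < h)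
    (hΦ : HasGSBound (stdBasis₂ d) (Sum.elim s σ) (Sum.elim σ s) h C Φ) :
    ∃ D, 0 ≤ D ∧ ∀ x ξ, ‖Φ (x, ξ)‖ ≤ D * (decay x * decay x * decay ξ) := by
  have hC := hΦ.nonneg (sumElim_pos hs hσ) hh
  have hK0 := one_pos.trans_le (one_le_dbl hs)
  obtain ⟨A, hA, hA'⟩ := exists_inv_growth_le (b := stdBasis d) hs (h := dbl s * h) (by positivity)
  obtain ⟨B, hB, hB'⟩ := exists_inv_growth_le (b := stdBasis d) hσ hh
  refine ⟨C * (A * A * B), by positivity, fun x ξ => (hΦ.norm_le (x, ξ)).trans ?_⟩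
  have p1 := growth_pos (b := stdBasis d) hσ hh ξ
  have p2 := growth_pos (b := stdBasis d) hs (h := dbl s * h) (by positivity) x
  have p3 := growth_sq_le (b := stdBasis d) hs hh x
  have p4 := decay_pos x
  rw [growth_prod hs hσ hh, div_eq_mul_inv, mul_inv]
  have h1 : (growth (stdBasis d) s h x)⁻¹ ≤ (A * decay x) * (A * decay x) := by
    refine (inv_anti₀ (by positivity) p3).trans ?_
    rw [mul_inv]
    exact mul_le_mul (hA' x) (hA' x) (by positivity) (by positivity)
  calc _ ≤ C * ((A * decay x) * (A * decay x) * (B * decay ξ)) := by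
        gcongr
        exact hB' ξ
    _ = _ := by ring

theorem integrable_decay_prod : Integrable
    (fun z : EuclideanSpace ℝ (Fin d) × EuclideanSpace ℝ (Fin d) => decay z.1 * decay z.2) :=
  (integrable_decay volume).mul_prod (integrable_decay volume)

/-- The Zak transform is the transpose of `zakAdj`. -/
theorem integral_zak_mul (hΦs : Continuous Φ) {D : ℝ} (hD0 : 0 ≤ D)
    (hD : ∀ x ξ, ‖Φ (x, ξ)‖ ≤ D * (decay x * decay x * decay ξ)) (f : 𝓢(EuclideanSpace ℝ (Fin d), ℂ)) :
    Integrable (fun z => Zak.zak e f z * Φ z) ∧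
      ∫ x, f x * zakAdj (Zak.lattice e) Φ x = ∫ z, Zak.zak e f z * Φ z := by
  obtain ⟨A, hA0, hA⟩ := exists_norm_schwartz_le_decay f
  -- The bound `hGle` is summable in j and integrable in (x, ξ), so sums and integrals may be
  -- interchanged freely.
  let G (j : Zak.lattice e) (z : EuclideanSpace ℝ (Fin d) × EuclideanSpace ℝ (Fin d)) : ℂ :=
    f (z.1 - j) * (char (j : EuclideanSpace ℝ (Fin d)) z.2 * Φ z)
  have hGc (j) : Continuous (G j) := (f.continuous.comp (continuous_fst.sub continuous_const)).mul
    (((contDiff_char _).continuous.comp continuous_snd).mul hΦs)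
  have hGle (j z) : ‖G j z‖ ≤ A * D * decay (j : EuclideanSpace ℝ (Fin d)) * (decay z.1 * decay z.2) := by
    simp only [G]
    rw [norm_mul, norm_mul, norm_char, one_mul]
    have h1 := decay_sub_mul_le z.1 (j : EuclideanSpace ℝ (Fin d))
    have p1 := decay_pos z.2
    have p2 := decay_pos z.1
    have p3 := decay_pos (z.1 - j : EuclideanSpace ℝ (Fin d))
    calc _ ≤ (A * decay (z.1 - j)) * (D * (decay z.1 * decay z.1 * decay z.2)) :=
          mul_le_mul (hA _) (hD z.1 z.2) (norm_nonneg _) (by positivity)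
      _ = A * D * decay z.2 * (decay (z.1 - j) * (decay z.1 * decay z.1)) := by ring
      _ ≤ A * D * decay z.2 * (decay (j : EuclideanSpace ℝ (Fin d)) * decay z.1) := by gcongr
      _ = _ := by ring
  have hGi (j) : Integrable (G j) := (integrable_decay_prod.const_mul _).mono'
    (hGc j).aestronglyMeasurable (Eventually.of_forall (hGle j))
  have hsd := summable_decay (Zak.lattice e)
  have hsum (z) : Summable fun j => G j z :=
    Summable.of_norm_bounded ((hsd.mul_left (A * D)).mul_right _) fun j => hGle j z
  have hzak : (fun z => Zak.zak e f z * Φ z) = fun z => ∑' j, G j z := by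
    ext z
    rw [Zak.zak, ← tsum_mul_right]
    refine tsum_congr fun j => ?_
    simp only [G, char]
    ring
  have hGn : Summable fun j => ∫ z, ‖G j z‖ := by
    refine Summable.of_nonneg_of_le (fun _ => integral_nonneg fun _ => norm_nonneg _) (fun j => ?_)
      ((hsd.mul_left (A * D)).mul_right
        (∫ z : EuclideanSpace ℝ (Fin d) × EuclideanSpace ℝ (Fin d), decay z.1 * decay z.2))
    rw [← integral_const_mul]
    exact integral_mono (hGi j).norm (integrable_decay_prod.const_mul _) (hGle j)
  have hcont : Continuous fun z => ∑' j, G j z := by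
    refine continuous_tsum hGc (hsd.mul_left (A * D)) fun j z => (hGle j z).trans ?_
    have p1 := decay_pos (j : EuclideanSpace ℝ (Fin d))
    exact mul_le_of_le_one_right (by positivity)
      (mul_le_one₀ (decay_le_one _) (decay_pos _).le (decay_le_one _))
  have hint : Integrable fun z => ∑' j, G j z := by
    refine (integrable_decay_prod.const_mul
      (A * D * ∑' j : Zak.lattice e, decay (j : EuclideanSpace ℝ (Fin d)))).mono'
      hcont.aestronglyMeasurable (Eventually.of_forall fun z => ?_)
    rw [← tsum_mul_left, ← tsum_mul_right]
    exact tsum_of_norm_bounded ((hsd.mul_left (A * D)).mul_right _).hasSum fun j => hGle j z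
  rw [hzak]
  refine ⟨hint, ?_⟩
  rw [← integral_tsum_of_summable_integral_norm hGi hGn]
  -- Fubini and the substitution x ↦ x + j move the translation from f to Φ.
  have hterm (j : Zak.lattice e) : ∫ z, G j z = ∫ x, f x * zakAdjTerm Φ j x := by
    rw [Measure.volume_eq_prod] at hGi ⊢
    rw [integral_prod _ (hGi j), ← integral_add_right_eq_self _ (j : EuclideanSpace ℝ (Fin d))]
    simp only [G, add_sub_cancel_right]
    simp only [integral_const_mul]
    rfl
  simp only [hterm]
  have hdi := integrable_decay (V := EuclideanSpace ℝ (Fin d)) volume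
  obtain ⟨J, hJdef⟩ : ∃ J, J = ∫ ξ : EuclideanSpace ℝ (Fin d), decay ξ := ⟨_, rfl⟩
  have hJ : 0 ≤ J := hJdef ▸ integral_nonneg fun x => (decay_pos x).le
  have hT (j x : EuclideanSpace ℝ (Fin d)) : ‖f x * zakAdjTerm Φ j x‖ ≤
      A * D * J * decay j * decay (x + j) := by
    have h1 : ‖zakAdjTerm Φ j x‖ ≤ ∫ ξ : EuclideanSpace ℝ (Fin d), D * (decay (x + j) * decay (x + j)) * decay ξ := by
      refine norm_integral_le_of_norm_le (hdi.const_mul _) (Eventually.of_forall fun ξ => ?_)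
      rw [norm_mul, norm_char, one_mul, mul_assoc]
      exact hD _ _
    rw [integral_const_mul, ← hJdef] at h1
    have h2 := decay_sub_mul_le (x + j) j
    rw [add_sub_cancel_right] at h2
    have p1 := decay_pos x
    rw [norm_mul]
    calc _ ≤ (A * decay x) * (D * (decay (x + j) * decay (x + j)) * J) :=
          mul_le_mul (hA x) h1 (norm_nonneg _) (by positivity)
      _ = A * D * J *
          (decay x * (decay (x + j) * decay (x + j))) := by ring
      _ ≤ A * D * J * (decay j * decay (x + j)) := by gcongr
      _ = _ := by ring
  have hTc (j : EuclideanSpace ℝ (Fin d)) : AEStronglyMeasurable fun x => f x * zakAdjTerm Φ j x := by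
    refine f.continuous.aestronglyMeasurable.mul ?_
    have : Continuous fun p : EuclideanSpace ℝ (Fin d) × EuclideanSpace ℝ (Fin d) =>
        char j p.2 * Φ (p.1 + j, p.2) := ((contDiff_char _).continuous.comp continuous_snd).mul
      (hΦs.comp ((continuous_fst.add continuous_const).prodMk continuous_snd))
    exact this.stronglyMeasurable.integral_prod_right.aestronglyMeasurable
  have hTi (j : EuclideanSpace ℝ (Fin d)) : Integrable fun x => f x * zakAdjTerm Φ j x :=
    ((hdi.comp_add_right j).const_mul _).mono' (hTc j) (Eventually.of_forall (hT j))
  rw [integral_tsum_of_summable_integral_norm (F := fun (j : Zak.lattice e) x => f x * zakAdjTerm Φ j x)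
    (fun j => hTi j)]
  · simp only [tsum_mul_left]
    rfl
  · refine Summable.of_nonneg_of_le (fun _ => integral_nonneg fun _ => norm_nonneg _) (fun j => ?_)
      ((hsd.mul_left (A * D * J)).mul_right
        (∫ x : EuclideanSpace ℝ (Fin d), decay x))
    rw [← integral_add_right_eq_self decay (j : EuclideanSpace ℝ (Fin d)), ← integral_const_mul]
    exact integral_mono (hTi j).norm ((hdi.comp_add_right _).const_mul _) (hT j)

end schwartz

/-! ### Weak convergence on bounded sets -/

section weakConvergence

variable {ι V : Type*} [NormedAddCommGroup V] [NormedSpace ℝ V] [Fintype ι] [DecidableEq ι]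
  [FiniteDimensional ℝ V] [MeasurableSpace V] [BorelSpace V] {μ : Measure V} [μ.IsAddHaarMeasure]
  {b : Module.Basis ι ℝ V} {s σ : ι → ℝ} {h M : ℝ}

omit [MeasurableSpace V] [BorelSpace V] in
/-- Bounded families in a Gelfand-Shilov space are equi-Lipschitz, with all their derivatives. -/
theorem exists_norm_listDeriv_sub_le (hs : ∀ i, 0 < s i) (hh : 0 < h) (l : List ι) (hM : 0 ≤ M) :
    ∃ c, 0 ≤ c ∧ ∀ {f : V → ℂ}, ContDiff ℝ ∞ f → HasGSBound b s σ h M f → ∀ x y,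
      ‖listDeriv b l f x - listDeriv b l f y‖ ≤ c * ‖x - y‖ := by
  refine ⟨∑ i, ‖LinearMap.toContinuousLinearMap (b.coord i)‖ *
    (M * (h ^ (i :: l).length * facWeight σ (i :: l))), Finset.sum_nonneg fun i _ => ?_,
    fun {f} hf H x y => ?_⟩
  · have := facWeight_pos σ (i :: l)
    positivity
  refine Convex.norm_image_sub_le_of_norm_fderiv_le (𝕜 := ℝ) (s := Set.univ) (fun x _ =>
    (contDiff_listDeriv hf l).differentiable (by simp) x) (fun z _ => ?_) convex_univ
    (Set.mem_univ y) (Set.mem_univ x)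
  rw [fderiv_eq_sum_dirDeriv (b := b)]
  refine norm_sum_le_of_le _ fun i _ => ?_
  rw [ContinuousLinearMap.norm_smulRight_apply]
  refine mul_le_mul_of_nonneg_left ?_ (norm_nonneg _)
  have h1 := H z (i :: l)
  rw [listDeriv_cons] at h1
  refine h1.trans (mul_le_mul_of_nonneg_right (div_le_self hM (one_le_growth hs hh z)) ?_)
  have := facWeight_pos σ (i :: l)
  positivity

/-- Integration by parts against a Schwartz function. -/
theorem exists_integral_mul_listDeriv_eq (hs : ∀ i, 0 < s i) (hh : 0 < h) (l : List ι) (f : 𝓢(V, ℂ)) :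
    ∃ f' : 𝓢(V, ℂ), ∀ {φ : V → ℂ}, ContDiff ℝ ∞ φ → HasGSBound b s σ h M φ →
      ∫ x, f x * listDeriv b l φ x ∂μ = ∫ x, f' x * φ x ∂μ := by
  induction l generalizing f with
  | nil => exact ⟨f, fun _ _ => rfl⟩
  | cons i l ih =>
    obtain ⟨f', hf'⟩ := ih (-LineDeriv.lineDerivOp (b i) f)
    refine ⟨f', fun {φ} hφ H => ?_⟩
    have hint (g : 𝓢(V, ℂ)) (l : List ι) : Integrable (fun x => g x * listDeriv b l φ x) μ := by
      obtain ⟨D, hD, hx⟩ := H.exists_norm_le_decay hs hh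
      refine (g.integrable (μ := μ)).mul_bdd (c := D * (h ^ l.length * facWeight σ l))
        (contDiff_listDeriv hφ l).continuous.aestronglyMeasurable (Eventually.of_forall fun x => ?_)
      have := facWeight_pos σ l
      exact (hx l x).trans (mul_le_of_le_one_right (by positivity) (decay_le_one x))
    rw [← hf' hφ H, listDeriv_cons]
    have h1 := hint (LineDeriv.lineDerivOp (b i) f) l
    have h2 := hint f (i :: l)
    simp only [SchwartzMap.lineDerivOp_apply_eq_fderiv] at h1
    rw [listDeriv_cons] at h2
    simp only [dirDeriv] at h2 ⊢
    rw [integral_mul_fderiv_eq_neg_fderiv_mul_of_integrable h1 h2 (hint f l)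
      (fun x _ => f.differentiable x)
      (fun x _ => (contDiff_listDeriv hφ l).differentiable (by simp) x), ← integral_neg]
    simp [SchwartzMap.lineDerivOp_apply_eq_fderiv]

variable {T : Type*} {𝒰 : Filter T} {φ : T → V → ℂ}

/-- The mean of the derivative over a small ball around x, weighted by a bump function, tends to
zero after integration by parts. By the uniform Lipschitz bound it is close to the value at x. -/
theorem tendsto_listDeriv (hs : ∀ i, 0 < s i) (hh : 0 < h) (hM : 0 ≤ M) (hφ : ∀ t, ContDiff ℝ ∞ (φ t))
    (hb : ∀ᶠ t in 𝒰, HasGSBound b s σ h M (φ t))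
    (h0 : ∀ f : 𝓢(V, ℂ), Tendsto (fun t => ∫ x, f x * φ t x ∂μ) 𝒰 (nhds 0)) (l : List ι) (x : V) :
    Tendsto (fun t => listDeriv b l (φ t) x) 𝒰 (nhds 0) := by
  rw [Metric.tendsto_nhds]
  intro η hη
  obtain ⟨c, hc, hL⟩ := exists_norm_listDeriv_sub_le (b := b) (s := s) (σ := σ) hs hh l hM
  -- On the outer radius η / (2(c+1)) the Lipschitz constant c allows an oscillation of at most η /
  -- 2.
  let ρ : ContDiffBump x := ⟨η / (4 * (c + 1)), η / (2 * (c + 1)), by positivity, by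
    gcongr; norm_num⟩
  have hsupp : HasCompactSupport fun y => ((ρ.normed μ y : ℝ) : ℂ) :=
    ρ.hasCompactSupport_normed.comp_left Complex.ofReal_zero
  have hsm : ContDiff ℝ ∞ fun y => ((ρ.normed μ y : ℝ) : ℂ) :=
    Complex.ofRealCLM.contDiff.comp ρ.contDiff_normed
  obtain ⟨f', hf'⟩ := exists_integral_mul_listDeriv_eq (μ := μ) (b := b) (s := s) (σ := σ) (M := M)
    hs hh l (hsupp.toSchwartzMap hsm)
  have h1 := (Metric.tendsto_nhds.1 (h0 f')) (η / 2) (by positivity)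
  filter_upwards [hb, h1] with t ht ht'
  rw [dist_zero_right] at ht' ⊢
  rw [← hf' (hφ t) ht] at ht'
  have hρi : Integrable (ρ.normed μ) μ :=
    (ρ.contDiff_normed (n := 0)).continuous.integrable_of_hasCompactSupport ρ.hasCompactSupport_normed
  have hcont := (contDiff_listDeriv (b := b) (hφ t) l).continuous
  have h2 : ‖∫ y, ((ρ.normed μ y : ℝ) : ℂ) * listDeriv b l (φ t) y ∂μ - listDeriv b l (φ t) x‖ ≤ η / 2 := by
    have e1 : listDeriv b l (φ t) x = ∫ y, ((ρ.normed μ y : ℝ) : ℂ) * listDeriv b l (φ t) x ∂μ := by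
      rw [integral_mul_const, integral_complex_ofReal, ρ.integral_normed]
      simp
    conv_lhs => rw [e1]
    rw [← integral_sub, ← mul_one (η / 2), ← ρ.integral_normed (μ := μ), ← integral_const_mul]
    · refine norm_integral_le_of_norm_le (hρi.const_mul _) (Eventually.of_forall fun y => ?_)
      rw [← mul_sub, norm_mul, Complex.norm_real, Real.norm_eq_abs, abs_of_nonneg (ρ.nonneg_normed y),
        mul_comm]
      by_cases hy : y ∈ Metric.ball x ρ.rOut
      · refine mul_le_mul_of_nonneg_right ?_ (ρ.nonneg_normed y)
        rw [Metric.mem_ball, dist_eq_norm] at hy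
        refine (hL (hφ t) ht y x).trans ?_
        calc _ ≤ (c + 1) * (η / (2 * (c + 1))) :=
              mul_le_mul (by linarith) hy.le (norm_nonneg _) (by positivity)
          _ = η / 2 := by field_simp
      · rw [← ρ.support_normed_eq (μ := μ), Function.notMem_support] at hy
        simp [hy]
    · exact (hsm.continuous.mul hcont).integrable_of_hasCompactSupport hsupp.mul_right
    · exact (hsm.continuous.mul continuous_const).integrable_of_hasCompactSupport hsupp.mul_right
  have h3 := norm_sub_norm_le (listDeriv b l (φ t) x)
    (∫ y, ((ρ.normed μ y : ℝ) : ℂ) * listDeriv b l (φ t) y ∂μ)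
  rw [norm_sub_rev] at h3
  have h4 : ‖∫ y, ((ρ.normed μ y : ℝ) : ℂ) * listDeriv b l (φ t) y ∂μ‖ < η / 2 := ht'
  linarith

/-- Pointwise convergence on a finite net of the ball extends to the ball by the uniform Lipschitz
bound. -/
theorem eventually_norm_listDeriv_le (hs : ∀ i, 0 < s i) (hh : 0 < h) (hM : 0 ≤ M)
    (hφ : ∀ t, ContDiff ℝ ∞ (φ t)) (hb : ∀ᶠ t in 𝒰, HasGSBound b s σ h M (φ t))
    (h0 : ∀ f : 𝓢(V, ℂ), Tendsto (fun t => ∫ x, f x * φ t x ∂μ) 𝒰 (nhds 0)) (l : List ι) (R : ℝ)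
    {η : ℝ} (hη : 0 < η) : ∀ᶠ t in 𝒰, ∀ x, ‖x‖ ≤ R → ‖listDeriv b l (φ t) x‖ ≤ η := by
  obtain ⟨c, hc, hL⟩ := exists_norm_listDeriv_sub_le (b := b) (s := s) (σ := σ) hs hh l hM
  obtain ⟨S, -, hS, hcov⟩ := (isCompact_closedBall (0 : V) R).finite_cover_balls
    (e := η / (2 * (c + 1))) (by positivity)
  have h1 : ∀ᶠ t in 𝒰, ∀ y ∈ S, ‖listDeriv b l (φ t) y‖ < η / 2 := by
    rw [eventually_all_finite hS]
    intro y _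
    have := Metric.tendsto_nhds.1 (tendsto_listDeriv hs hh hM hφ hb h0 l y) (η / 2) (by positivity)
    simpa only [dist_zero_right] using this
  filter_upwards [hb, h1] with t ht ht' x hx
  have hx' := hcov (mem_closedBall_zero_iff.2 hx)
  simp only [Set.mem_iUnion, Metric.mem_ball, dist_eq_norm, exists_prop] at hx'
  obtain ⟨y, hy, hxy⟩ := hx'
  have h2 : ‖listDeriv b l (φ t) x - listDeriv b l (φ t) y‖ ≤ η / 2 := by
    refine (hL (hφ t) ht x y).trans ?_
    calc _ ≤ (c + 1) * (η / (2 * (c + 1))) :=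
          mul_le_mul (by linarith) hxy.le (norm_nonneg _) (by positivity)
      _ = η / 2 := by field_simp
  have h3 := norm_sub_norm_le (listDeriv b l (φ t) x) (listDeriv b l (φ t) y)
  have := ht' y hy
  linarith

/-- Bounded families which converge weakly to zero converge to zero in a weaker norm. -/
theorem eventually_hasGSBound (hs : ∀ i, 0 < s i) (hh : 0 < h) (hM : 0 ≤ M)
    (hφ : ∀ t, ContDiff ℝ ∞ (φ t)) (hb : ∀ᶠ t in 𝒰, HasGSBound b s σ h M (φ t))
    (h0 : ∀ f : 𝓢(V, ℂ), Tendsto (fun t => ∫ x, f x * φ t x ∂μ) 𝒰 (nhds 0)) {δ : ℝ} (hδ : 0 < δ) :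
    ∀ᶠ t in 𝒰, HasGSBound b s σ (2 * (dbl s * h)) δ (φ t) := by
  have hd := one_le_dbl hs
  have hK : 0 < dbl s * h := by positivity
  obtain ⟨A, hA, hA'⟩ := exists_inv_growth_le (b := b) hs hK
  -- Doubling the parameter gains (1/2)^{|l|}, and the factor `dbl s` gains a factor `decay x`.
  -- These gains alone suffice for |l| > N or ‖x‖ > R. There remain finitely many lists on a fixed
  -- ball, where the convergence is uniform.
  obtain ⟨N, hN⟩ := exists_pow_lt_of_lt_one (div_pos hδ (by positivity : 0 < M * A + 1))
    (by norm_num : (1 / 2 : ℝ) < 1)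
  obtain ⟨R, hR⟩ : ∃ R : ℝ, R = M * A / δ := ⟨_, rfl⟩
  obtain ⟨G, hG, hG'⟩ := exists_growth_le_of_isBounded (b := b) hs (h := 2 * (dbl s * h))
    (by positivity) (Metric.isBounded_closedBall (x := (0 : V)) (r := R))
  have h1 : ∀ᶠ t in 𝒰, ∀ l ∈ {l : List ι | l.length ≤ N}, ∀ x, ‖x‖ ≤ R →
      ‖listDeriv b l (φ t) x‖ ≤ δ / G * ((2 * (dbl s * h)) ^ l.length * facWeight σ l) := by
    rw [eventually_all_finite (List.finite_length_le ι N)]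
    intro l _
    have := facWeight_pos σ l
    exact eventually_norm_listDeriv_le hs hh hM hφ hb h0 l R (by positivity)
  filter_upwards [hb, h1] with t ht ht' x l
  have hw := facWeight_pos σ l
  have g0 := growth_pos (b := b) hs (by positivity : 0 < 2 * (dbl s * h)) x
  have key (hsmall : M * A * ((1 / 2) ^ l.length * decay x) ≤ δ) : ‖listDeriv b l (φ t) x‖ ≤
      δ / growth b s (2 * (dbl s * h)) x * ((2 * (dbl s * h)) ^ l.length * facWeight σ l) := by
    refine (ht x l).trans ?_
    have g1 := growth_pos (b := b) hs hK x
    have g2 : growth b s (2 * (dbl s * h)) x ≤ growth b s (dbl s * h) x :=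
      growth_anti hs hK (by linarith) x
    have g3 := growth_sq_le (b := b) hs hh x
    have g4 : growth b s (dbl s * h) x * growth b s (2 * (dbl s * h)) x ≤ growth b s h x := by
      refine le_trans ?_ g3
      gcongr
    have hle : h ^ l.length ≤ (1 / 2) ^ l.length * (2 * (dbl s * h)) ^ l.length := by
      rw [← mul_pow]
      gcongr
      nlinarith
    calc M / growth b s h x * (h ^ l.length * facWeight σ l)
        ≤ M / (growth b s (dbl s * h) x * growth b s (2 * (dbl s * h)) x) *
          ((1 / 2) ^ l.length * (2 * (dbl s * h)) ^ l.length * facWeight σ l) := by gcongr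
      _ = M * ((growth b s (dbl s * h) x)⁻¹ * (1 / 2) ^ l.length) / growth b s (2 * (dbl s * h)) x *
          ((2 * (dbl s * h)) ^ l.length * facWeight σ l) := by
        field_simp
      _ ≤ M * ((A * decay x) * (1 / 2) ^ l.length) / growth b s (2 * (dbl s * h)) x *
          ((2 * (dbl s * h)) ^ l.length * facWeight σ l) := by
        gcongr
        exact hA' x
      _ ≤ _ := by
        gcongr
        linarith
  have hp : ((1 / 2 : ℝ)) ^ l.length ≤ 1 := pow_le_one₀ (by norm_num) (by norm_num)
  have hx0 := decay_pos x
  have hx1 := decay_le_one x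
  by_cases hl : l.length ≤ N
  · by_cases hx : ‖x‖ ≤ R
    · refine (ht' l hl x hx).trans ?_
      gcongr
      exact hG' x (mem_closedBall_zero_iff.2 hx)
    · refine key ?_
      rw [not_le, hR, div_lt_iff₀ hδ] at hx
      have hdec : decay x ≤ (1 + ‖x‖)⁻¹ := by
        refine inv_anti₀ (by positivity) ?_
        exact le_self_pow₀ (by linarith [norm_nonneg x]) (by omega)
      calc M * A * ((1 / 2) ^ l.length * decay x) ≤ M * A * (1 * (1 + ‖x‖)⁻¹) := by gcongr
        _ ≤ δ := by
          rw [one_mul, ← div_eq_mul_inv, div_le_iff₀ (by positivity)]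
          nlinarith
  · refine key ?_
    have : ((1 / 2 : ℝ)) ^ l.length ≤ (1 / 2) ^ N :=
      pow_le_pow_of_le_one (by norm_num) (by norm_num) (by omega)
    rw [lt_div_iff₀ (by positivity)] at hN
    calc M * A * ((1 / 2) ^ l.length * decay x) ≤ M * A * ((1 / 2) ^ N * 1) := by gcongr
      _ ≤ (1 / 2) ^ N * (M * A + 1) := by
        have : (0 : ℝ) < (1 / 2) ^ N := by positivity
        nlinarith
      _ ≤ δ := hN.le

end weakConvergence

/-! ### Density of the Schwartz functions in the strong duals -/

section density

/-- A linear functional which is small on the elements of an absolutely convex set `B` where the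
functionals `ℓ i` are small is close to a linear combination of the `ℓ i` on `B`. -/
theorem exists_norm_sub_sum_le {X I : Type*} [AddCommGroup X] [Module ℂ X] [Fintype I] {B : Set X}
    (h0 : (0 : X) ∈ B) (hB : ∀ x ∈ B, ∀ y ∈ B, ∀ a b : ℝ, 0 ≤ a → 0 ≤ b → a + b = 1 →
      (a : ℂ) • x + (b : ℂ) • y ∈ B) (hbal : ∀ x ∈ B, ∀ c : ℂ, ‖c‖ ≤ 1 → c • x ∈ B)
    (ℓ : I → X →ₗ[ℂ] ℂ) (u : X →ₗ[ℂ] ℂ) {ε : ℝ} (hε : 0 < ε) {δ : I → ℝ} (hδ : ∀ i, 0 < δ i)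
    (hu : ∀ x ∈ B, (∀ i, ‖ℓ i x‖ < δ i) → ‖u x‖ ≤ ε) :
    ∃ c : I → ℂ, ∀ x ∈ B, ‖u x - ∑ i, c i * ℓ i x‖ ≤ ε := by
  classical
  -- By hypothesis no x in B has L x in this open convex set: ‖u x‖ ≤ ε if all ℓ i x are small. So U
  -- and L(B) can be separated.
  let U : Set ((I → ℂ) × ℂ) := {p | (∀ i, ‖p.1 i‖ < δ i) ∧ ε < p.2.re}
  let L : X →ₗ[ℂ] (I → ℂ) × ℂ := (LinearMap.pi ℓ).prod u
  have hUo : IsOpen U := by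
    have : U = (⋂ i, {p : (I → ℂ) × ℂ | ‖p.1 i‖ < δ i}) ∩ {p | ε < p.2.re} := by
      ext p
      simp [U]
    rw [this]
    refine (isOpen_iInter_of_finite fun i => isOpen_lt (by fun_prop) continuous_const).inter
      (isOpen_lt continuous_const (by fun_prop))
  have hUc : Convex ℝ U := by
    intro p hp q hq a b ha hb hab
    refine ⟨fun i => ?_, ?_⟩
    · have h1 := convex_ball (0 : ℂ) (δ i) (mem_ball_zero_iff.2 (hp.1 i)) (mem_ball_zero_iff.2 (hq.1 i))
        ha hb hab
      exact mem_ball_zero_iff.1 h1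
    · have h1 := (convex_Ioi ε) (Set.mem_Ioi.2 hp.2) (Set.mem_Ioi.2 hq.2) ha hb hab
      simpa using h1
  have hKc : Convex ℝ (L '' B) := by
    rintro _ ⟨x, hx, rfl⟩ _ ⟨y, hy, rfl⟩ a b ha hb hab
    refine ⟨_, hB x hx y hy a b ha hb hab, ?_⟩
    rw [map_add, map_smul, map_smul]
    rfl
  have hdis : Disjoint U (L '' B) := by
    rw [Set.disjoint_left]
    rintro _ hU ⟨x, hx, rfl⟩
    have h1 := hu x hx hU.1
    have h2 : ε < (u x).re := hU.2
    exact absurd ((Complex.re_le_norm _).trans h1) (not_le.2 h2)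
  obtain ⟨f, r, hf1, hf2⟩ := RCLike.geometric_hahn_banach_open (𝕜 := ℂ) hUc hUo hKc hdis
  have hr : r ≤ 0 := by
    have := hf2 (L 0) ⟨0, h0, rfl⟩
    simpa using this
  -- Since Re (z c) < r whenever Re z > ε, the number c is real and negative with c ε ≤ r.
  obtain ⟨c, hc⟩ : ∃ c, c = f (0, 1) := ⟨_, rfl⟩
  have hfz (z : ℂ) : f (0, z) = z * c := by
    have : ((0, z) : (I → ℂ) × ℂ) = z • (0, 1) := by simp
    rw [this, map_smul, hc, smul_eq_mul]
  have hUz (z : ℂ) (hz : ε < z.re) : (z * c).re < r := by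
    have := hf1 (0, z) ⟨fun i => by simpa using hδ i, hz⟩
    rwa [hfz] at this
  -- B is balanced, so x can be rotated to make f (L x) equal to -‖f (L x)‖.
  have hnorm (x : X) (hx : x ∈ B) : ‖f (L x)‖ ≤ -r := by
    by_cases h : f (L x) = 0
    · rw [h, norm_zero]
      linarith
    · have hn : ‖f (L x)‖ ≠ 0 := norm_ne_zero_iff.2 h
      have h1 := hf2 (L ((-(starRingEnd ℂ (f (L x))) / ‖f (L x)‖ : ℂ) • x)) ⟨_, hbal x hx _ (by
        rw [norm_div, norm_neg, RCLike.norm_conj, Complex.norm_real, norm_norm, div_self hn]), rfl⟩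
      rw [map_smul, map_smul, smul_eq_mul, div_mul_eq_mul_div, neg_mul, mul_comm, Complex.mul_conj,
        Complex.normSq_eq_norm_sq] at h1
      have h2 : (-((‖f (L x)‖ ^ 2 : ℝ) : ℂ) / (‖f (L x)‖ : ℂ)) = ((-‖f (L x)‖ : ℝ) : ℂ) := by
        have : (‖f (L x)‖ : ℂ) ≠ 0 := by exact_mod_cast hn
        push_cast
        field_simp
      rw [h2] at h1
      have h3 : r ≤ -‖f (L x)‖ := h1
      linarith
  have hcim : c.im = 0 := by
    by_contra hne
    have h1 := hUz ⟨ε + 1, ((ε + 1) * c.re - r) / c.im⟩ (by simp)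
    rw [Complex.mul_re] at h1
    simp only at h1
    rw [div_mul_cancel₀ _ hne] at h1
    linarith
  have hcr : c.re < 0 := by
    have h1 := hUz ((ε + 1 : ℝ)) (by simp)
    rw [Complex.re_ofReal_mul] at h1
    by_contra! h2
    have : 0 ≤ (ε + 1) * c.re := by positivity
    linarith
  have hce : c.re * ε ≤ r := by
    refine le_of_forall_pos_le_add fun η hη => ?_
    have h1 := hUz ((ε + η / -c.re : ℝ)) (by
      rw [Complex.ofReal_re]
      have : 0 < η / -c.re := div_pos hη (by linarith)
      linarith)
    rw [Complex.re_ofReal_mul, add_mul] at h1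
    have h2 : η / -c.re * c.re = -η := by
      have := hcr.ne
      field_simp
    linarith
  have hcn : ‖c‖ = -c.re := by
    have : c = (c.re : ℂ) := Complex.ext (by simp) (by simp [hcim])
    rw [this, Complex.norm_real, Real.norm_eq_abs, abs_of_neg (by simpa using hcr)]
    simp
  have hc0 : c ≠ 0 := fun h => by simp [h] at hcr
  have hsplit (x : X) : f (L x) = (∑ i, f (Pi.single i 1, 0) * ℓ i x) + u x * c := by
    have h1 : L x = (∑ i, ℓ i x • ((Pi.single i 1, 0) : (I → ℂ) × ℂ)) + (0, u x) := by
      refine Prod.ext ?_ ?_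
      · ext j
        simp [L, Prod.fst_sum, Finset.sum_apply, Pi.single_apply]
      · simp [L, Prod.snd_sum]
    rw [h1, map_add, map_sum, hfz]
    simp only [map_smul, smul_eq_mul, mul_comm]
  -- The coefficients result from solving f (L x) = ∑ f(e_i) ℓ i x + c u x for u x; the error is f
  -- (L x) / c, of modulus at most -r / |c| ≤ ε.
  refine ⟨fun i => -(f (Pi.single i 1, 0) / c), fun x hx => ?_⟩
  have h1 : u x - ∑ i, -(f (Pi.single i 1, 0) / c) * ℓ i x = f (L x) / c := by
    rw [hsplit, add_div, mul_div_cancel_right₀ _ hc0, Finset.sum_div, add_comm, sub_eq_add_neg,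
      ← Finset.sum_neg_distrib]
    congr 1
    refine Finset.sum_congr rfl fun i _ => ?_
    ring
  rw [h1, norm_div, hcn, div_le_iff₀ (by linarith)]
  have := hnorm x hx
  nlinarith

variable {ι V : Type*} [NormedAddCommGroup V] [NormedSpace ℝ V] [Fintype ι] [DecidableEq ι]
  [FiniteDimensional ℝ V] [MeasurableSpace V] [BorelSpace V] {μ : Measure V} [μ.IsAddHaarMeasure]
  {b : Module.Basis ι ℝ V} {s σ : ι → ℝ} {h M : ℝ}
  {X : Type*} [AddCommGroup X] [Module ℂ X] [FunLike X V ℂ] [SmoothSpace X V]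

/-- Functionals on a Gelfand-Shilov space can be approximated by Schwartz functions, uniformly on
bounded sets. -/
theorem exists_schwartz_norm_sub_le (hs : ∀ i, 0 < s i) (hh : 0 < h) (hM : 0 ≤ M)
    (ℓ : 𝓢(V, ℂ) → X →ₗ[ℂ] ℂ) (hℓ : ∀ f φ, ℓ f φ = ∫ x, f x * φ x ∂μ) (u : X →ₗ[ℂ] ℂ) {K : ℝ}
    (hu : ∀ (φ : X) (C : ℝ), HasGSBound b s σ (2 * (dbl s * h)) C φ → ‖u φ‖ ≤ K * C) {ε : ℝ} (hε : 0 < ε) :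
    ∃ f : 𝓢(V, ℂ), ∀ φ : X, HasGSBound b s σ h M φ → ‖u φ - ∫ x, f x * φ x ∂μ‖ ≤ ε := by
  classical
  let B : Set X := {φ | HasGSBound b s σ h M φ}
  have hBc : ∀ x ∈ B, ∀ y ∈ B, ∀ p q : ℂ, ‖p‖ + ‖q‖ ≤ 1 → p • x + q • y ∈ B := by
    intro x hx y hy p q hpq z l
    have hx' := hx z l
    have hy' := hy z l
    rw [SmoothSpace.coe_add, SmoothSpace.coe_smul, SmoothSpace.coe_smul,
      listDeriv_add (f := p • (x : V → ℂ)) (g := q • (y : V → ℂ)) ((SmoothSpace.contDiff x).const_smul p) ((SmoothSpace.contDiff y).const_smul q),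
      listDeriv_smul (SmoothSpace.contDiff x), listDeriv_smul (SmoothSpace.contDiff y)]
    have h0 := (norm_nonneg _).trans hx'
    refine (norm_add_le _ _).trans ?_
    simp only [Pi.smul_apply, norm_smul]
    calc _ ≤ ‖p‖ * (M / growth b s h z * (h ^ l.length * facWeight σ l)) +
          ‖q‖ * (M / growth b s h z * (h ^ l.length * facWeight σ l)) := by gcongr
      _ = (‖p‖ + ‖q‖) * (M / growth b s h z * (h ^ l.length * facWeight σ l)) := by ring
      _ ≤ _ := mul_le_of_le_one_left h0 hpq
  have hB0 : (0 : X) ∈ B := by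
    intro z l
    have e : ((0 : X) : V → ℂ) = (0 : ℂ) • (0 : V → ℂ) := by
      rw [zero_smul, ← coeLin_apply, map_zero]
    rw [e, listDeriv_smul (f := (0 : V → ℂ)) contDiff_zero_fun, zero_smul]
    have := facWeight_pos σ l
    have := growth_pos (b := b) hs hh z
    simp only [Pi.zero_apply, norm_zero]
    positivity
  -- The neighbourhoods of zero in B for the weak topology given by all Schwartz functions.
  let 𝒰 : Filter X := comap (fun φ f => ℓ f φ) (nhds (0 : 𝓢(V, ℂ) → ℂ)) ⊓ 𝓟 B
  have hb : ∀ᶠ φ : X in 𝒰, HasGSBound b s σ h M φ := mem_inf_of_right (mem_principal_self B)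
  have h0 : ∀ f : 𝓢(V, ℂ), Tendsto (fun φ : X => ∫ x, f x * φ x ∂μ) 𝒰 (nhds 0) := fun f => by
    have h1 : Tendsto (fun (φ : X) (f : 𝓢(V, ℂ)) => ℓ f φ) 𝒰 (nhds 0) :=
      tendsto_comap.mono_left inf_le_left
    simpa only [hℓ, Pi.zero_apply] using (tendsto_pi_nhds.1 h1) f
  have hev : ∀ᶠ φ in 𝒰, ‖u φ‖ ≤ ε := by
    filter_upwards [eventually_hasGSBound (φ := fun φ : X => (φ : V → ℂ)) hs hh hM
      (fun φ => SmoothSpace.contDiff φ) hb h0 (δ := ε / (|K| + 1)) (by positivity)] with φ hφ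
    refine (hu φ _ hφ).trans ?_
    calc K * (ε / (|K| + 1)) ≤ (|K| + 1) * (ε / (|K| + 1)) := by
          gcongr
          exact (le_abs_self K).trans (by linarith)
      _ = ε := by field_simp
  obtain ⟨S, hS, hSB⟩ := mem_inf_principal.1 hev |> mem_comap.1
  -- A neighbourhood in the product topology restricts only finitely many Schwartz functions, those
  -- in I.
  rw [nhds_pi, Filter.mem_pi'] at hS
  obtain ⟨I, t, ht, hI⟩ := hS
  choose δ hδ hball using fun f => Metric.mem_nhds_iff.1 (ht f)
  obtain ⟨c, hc⟩ := exists_norm_sub_sum_le hB0 (fun x hx y hy p q hp hq hpq => hBc x hx y hy p q (by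
      rw [Complex.norm_real, Complex.norm_real, Real.norm_of_nonneg hp, Real.norm_of_nonneg hq, hpq]))
    (fun x hx c hc => by simpa using hBc x hx 0 hB0 c 0 (by simpa using hc))
    (fun f : I => ℓ f) u hε (fun f : I => hδ f) fun φ hφ hsmall => hSB (hI fun f hf =>
      hball f (by simpa using hsmall ⟨f, hf⟩)) hφ
  refine ⟨∑ f : I, c f • (f : 𝓢(V, ℂ)), fun φ hφ => ?_⟩
  refine le_of_eq_of_le ?_ (hc φ hφ)
  congr 2
  have hfin := (gsNorm_lt_top_iff hs hh (SmoothSpace.contDiff φ)).2 ⟨M, hM, hφ⟩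
  have e1 : ∀ x, (∑ f : I, c f • (f : 𝓢(V, ℂ))) x * φ x = ∑ f : I, c f * ((f : 𝓢(V, ℂ)) x * φ x) := by
    intro x
    rw [sum_apply, Finset.sum_mul]
    simp [mul_assoc]
  simp only [e1, hℓ]
  rw [integral_finsetSum (f := fun (f : I) x => c f * ((f : 𝓢(V, ℂ)) x * φ x)) _ fun f _ =>
    (integrable_schwartz_mul μ b s σ (f : 𝓢(V, ℂ)) (SmoothSpace.contDiff φ) hfin).const_mul _]
  simp only [integral_const_mul]

/-- The seminorm `sup |ℓ n φ|` defined by a pointwise bounded sequence of functionals. -/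
def supSeminorm (ℓ : ℕ → X →ₗ[ℂ] ℂ) (hℓ : ∀ φ, BddAbove (Set.range fun n => ‖ℓ n φ‖)) : Seminorm ℂ X :=
  Seminorm.of (fun φ => ⨆ n, ‖ℓ n φ‖)
    (fun φ ψ => ciSup_le fun n => by
      rw [map_add]
      exact (norm_add_le _ _).trans (add_le_add (le_ciSup (hℓ φ) n) (le_ciSup (hℓ ψ) n)))
    (fun c φ => by
      simp only [map_smul, norm_smul]
      exact (Real.mul_iSup_of_nonneg (norm_nonneg c) _).symm)

omit [FiniteDimensional ℝ V] [MeasurableSpace V] [BorelSpace V] in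
-- The inductive limit is regular. Otherwise, for every n some element of B violates the bound with
-- h = M = n + 1 at some point and some multi-indices. The supremum of the corresponding normalized
-- functionals is a continuous seminorm which is unbounded on B.
theorem Roumieu.exists_hasGSBound_of_isVonNBounded (hs : ∀ i, 0 < s i) {B : Set (Roumieu b s σ)}
    (hB : Bornology.IsVonNBounded ℂ B) :
    ∃ h, 0 < h ∧ ∃ M, 0 ≤ M ∧ ∀ φ ∈ B, HasGSBound b s σ h M φ := by
  by_contra! hcon
  have h1 (n : ℕ) : ∃ φ ∈ B, ∃ l m x, (n + 1 : ℝ) * ((n + 1 : ℝ) ^ l.length * facWeight s l *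
      ((n + 1 : ℝ) ^ m.length * facWeight σ m)) < |listMono b l x| * ‖listDeriv b m φ x‖ := by
    obtain ⟨φ, hφ, h2⟩ := hcon (n + 1) (by positivity) (n + 1) (by positivity)
    rw [hasGSBound_iff hs (by positivity)] at h2
    push Not at h2
    exact ⟨φ, hφ, h2⟩
  choose φ hφ l m x hlt using h1
  let w (n : ℕ) : ℝ := (n + 1 : ℝ) ^ (l n).length * facWeight s (l n) *
    ((n + 1 : ℝ) ^ (m n).length * facWeight σ (m n))
  have hw (n : ℕ) : 0 < w n := by
    have := facWeight_pos s (l n)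
    have := facWeight_pos σ (m n)
    positivity
  let ℓ (n : ℕ) : Roumieu b s σ →ₗ[ℂ] ℂ :=
    { toFun := fun f => (listMono b (l n) (x n) / w n : ℝ) * listDeriv b (m n) f (x n)
      map_add' := fun f g => by
        rw [← mul_add]
        exact congrArg _ (congrFun (listDeriv_add f.2.1 g.2.1 (m n)) (x n))
      map_smul' := fun c f => by
        rw [RingHom.id_apply, smul_eq_mul, mul_left_comm]
        exact congrArg _ (congrFun (listDeriv_smul f.2.1 c (m n)) (x n)) }
  have hℓn (n : ℕ) (f : Roumieu b s σ) :
      ‖ℓ n f‖ = |listMono b (l n) (x n)| * ‖listDeriv b (m n) f (x n)‖ / w n := by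
    change ‖((listMono b (l n) (x n) / w n : ℝ) : ℂ) * listDeriv b (m n) f (x n)‖ = _
    rw [norm_mul, Complex.norm_real, Real.norm_eq_abs, abs_div, abs_of_pos (hw n), div_mul_eq_mul_div]
  have hbound (h : ℝ) (hh : 0 < h) : ∃ K : ℝ, 0 ≤ K ∧ ∀ (f : Roumieu b s σ) (C : ℝ),
      HasGSBound b s σ h C f → ∀ n, ‖ℓ n f‖ ≤ K * C := by
    -- With respect to a fixed h, the n-th functional has norm at most r n, which is at most 1 for n
    -- ≥ h; only finitely many n need constants of their own.
    let r (n : ℕ) : ℝ := (h / (n + 1)) ^ (l n).length * (h / (n + 1)) ^ (m n).length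
    have hr (n : ℕ) : 0 ≤ r n := by positivity
    obtain ⟨N, hN⟩ := exists_nat_ge h
    refine ⟨∑ n ∈ Finset.range N, r n + 1,
      add_nonneg (Finset.sum_nonneg fun n _ => hr n) zero_le_one, fun f C hf n => ?_⟩
    have hC := hf.nonneg hs hh
    have h2 := (hasGSBound_iff hs hh).1 hf (l n) (m n) (x n)
    have h3 : r n ≤ ∑ n ∈ Finset.range N, r n + 1 := by
      by_cases hn : n < N
      · have := Finset.single_le_sum (fun n _ => hr n) (Finset.mem_range.2 hn)
        linarith
      · have h4 : h / (n + 1) ≤ 1 := by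
          rw [div_le_one (by positivity)]
          have : (N : ℝ) ≤ n := by exact_mod_cast not_lt.1 hn
          linarith
        have h5 : r n ≤ 1 := mul_le_one₀ (pow_le_one₀ (by positivity) h4) (by positivity)
          (pow_le_one₀ (by positivity) h4)
        have := Finset.sum_nonneg fun n (_ : n ∈ Finset.range N) => hr n
        linarith
    refine le_trans (le_trans ?_ (le_of_eq (mul_comm C (r n)))) (mul_le_mul_of_nonneg_right h3 hC)
    rw [hℓn, div_le_iff₀ (hw n)]
    refine h2.trans (le_of_eq ?_)
    simp only [r, w, div_pow]
    have : (n + 1 : ℝ) ≠ 0 := by positivity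
    field_simp
  have hbdd (f : Roumieu b s σ) : BddAbove (Set.range fun n => ‖ℓ n f‖) := by
    obtain ⟨h, hh, C, hC⟩ := Roumieu.exists_hasGSBound hs f
    obtain ⟨K, -, hK⟩ := hbound h hh
    exact ⟨K * C, by rintro _ ⟨n, rfl⟩; exact hK f C hC n⟩
  obtain ⟨r, hr, hr'⟩ := (roumieu_withSeminorms b s σ).isVonNBounded_iff_seminorm_bounded.1 hB
    ⟨supSeminorm ℓ hbdd, fun h hh => (exists_le_mul_gsNorm_iff hs hh _).2 (by
      obtain ⟨K, hK0, hK⟩ := hbound h hh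
      exact ⟨K, hK0, fun f C hC => ciSup_le fun n => hK f C hC n⟩)⟩
  obtain ⟨n, hn⟩ := exists_nat_ge r
  have h2 : ‖ℓ n (φ n)‖ < r := (le_ciSup (hbdd (φ n)) n).trans_lt (hr' (φ n) (hφ n))
  rw [hℓn, div_lt_iff₀ (hw n)] at h2
  have h3 := (hlt n).trans h2
  have h4 := lt_of_mul_lt_mul_right h3 (hw n).le
  linarith

omit [FiniteDimensional ℝ V] [MeasurableSpace V] [BorelSpace V] in
theorem Beurling.exists_hasGSBound_of_isVonNBounded (hs : ∀ i, 0 < s i) {B : Set (Beurling b s σ)}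
    (hB : Bornology.IsVonNBounded ℂ B) (hh : 0 < h) :
    ∃ M, 0 ≤ M ∧ ∀ φ ∈ B, HasGSBound b s σ h M φ := by
  obtain ⟨r, hr, hr'⟩ := (beurling_withSeminorms b s σ).isVonNBounded_iff_seminorm_bounded.1 hB ⟨h, hh⟩
  exact ⟨r, hr.le, fun φ hφ => (hasGSBound_beurlingSeminorm hs hh φ).mono hs hh le_rfl
    (hr' φ hφ).le (apply_nonneg _ _)⟩

/-- Uniform smallness on bounded sets describes the neighbourhoods of zero in the strong dual. -/
theorem denseRange_of_approx {X A : Type*} [AddCommGroup X] [Module ℂ X] [TopologicalSpace X]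
    [IsTopologicalAddGroup X] [ContinuousSMul ℂ X] {R : A → StrongDual ℂ X}
    (H : ∀ (u : StrongDual ℂ X) (B : Set X), Bornology.IsVonNBounded ℂ B → ∀ ε > 0, ∃ a, ∀ φ ∈ B,
      ‖u φ - R a φ‖ ≤ ε) : DenseRange R := by
  intro u
  rw [mem_closure_iff_nhds]
  intro t ht
  have h1 : Tendsto (fun v => u - v) (nhds (0 : StrongDual ℂ X)) (nhds u) := by
    have : Tendsto (fun v : StrongDual ℂ X => u - v) (nhds 0) (nhds (u - 0)) :=
      tendsto_const_nhds.sub tendsto_id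
    rwa [sub_zero] at this
  obtain ⟨⟨B, ε⟩, ⟨hB, hε⟩, hsub⟩ := (ContinuousLinearMap.hasBasis_nhds_zero_of_basis
    (𝕜₁ := ℂ) (σ := RingHom.id ℂ) (E := X) Metric.nhds_basis_closedBall).mem_iff.1 (h1 ht)
  obtain ⟨a, ha⟩ := H u B hB ε hε
  have h2 := hsub (show u - R a ∈ _ from fun φ hφ => by
    rw [mem_closedBall_zero_iff]
    exact ha φ hφ)
  rw [Set.mem_preimage, sub_sub_cancel] at h2
  exact ⟨R a, h2, a, rfl⟩

theorem Roumieu.denseRange_ofSchwartz (hs : ∀ i, 0 < s i) :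
    DenseRange (Roumieu.ofSchwartz μ b s σ) := by
  refine denseRange_of_approx fun u B hB ε hε => ?_
  obtain ⟨h, hh, M, hM, hBM⟩ := Roumieu.exists_hasGSBound_of_isVonNBounded hs hB
  have := one_le_dbl hs
  obtain ⟨K, -, hu⟩ := Roumieu.exists_norm_apply_le hs u (h := 2 * (dbl s * h)) (by positivity)
  obtain ⟨f, hf⟩ := exists_schwartz_norm_sub_le (μ := μ) hs hh hM
    (fun f => (Roumieu.ofSchwartz μ b s σ f).toLinearMap) (fun _ _ => rfl) u.toLinearMap hu hε
  exact ⟨f, fun φ hφ => hf φ (hBM φ hφ)⟩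

theorem Beurling.denseRange_ofSchwartz (hs : ∀ i, 0 < s i) :
    DenseRange (Beurling.ofSchwartz μ b s σ) := by
  refine denseRange_of_approx fun u B hB ε hε => ?_
  obtain ⟨h, hh, K, -, hu⟩ := Beurling.exists_norm_apply_le hs u
  have hd := one_le_dbl hs
  -- The convergence result loses the factor 2 · `dbl s`, and u is bounded with respect to h; in the
  -- Beurling space B is bounded with respect to this smaller k too.
  obtain ⟨k, hk⟩ : ∃ k, k = h / (2 * dbl s) := ⟨_, rfl⟩
  have hk0 : 0 < k := hk ▸ by positivity
  have hkh : 2 * (dbl s * k) = h := by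
    rw [hk]
    field_simp
  obtain ⟨M, hM, hBM⟩ := Beurling.exists_hasGSBound_of_isVonNBounded hs hB hk0
  rw [← hkh] at hu
  obtain ⟨f, hf⟩ := exists_schwartz_norm_sub_le (μ := μ) hs hk0 hM
    (fun f => (Beurling.ofSchwartz μ b s σ f).toLinearMap) (fun _ _ => rfl) u.toLinearMap hu hε
  exact ⟨f, fun φ hφ => hf φ (hBM φ hφ)⟩

end density

/-! ### Linearity of the operators on functions -/

section linear

/-- A linear operation on functions which maps `X` to `Y` defines a linear map. -/
theorem exists_linearMap_coe_eq {V W X Y : Type*} [NormedAddCommGroup V] [NormedSpace ℝ V]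
    [NormedAddCommGroup W] [NormedSpace ℝ W] [AddCommGroup X] [Module ℂ X] [FunLike X V ℂ]
    [SmoothSpace X V] [AddCommGroup Y] [Module ℂ Y] [FunLike Y W ℂ] [SmoothSpace Y W]
    {A : (V → ℂ) → W → ℂ} (hex : ∀ φ : X, ∃ ψ : Y, ⇑ψ = A φ)
    (hadd : ∀ φ ψ : X, A (⇑φ + ⇑ψ) = A φ + A ψ) (hsmul : ∀ (c : ℂ) (φ : X), A (c • ⇑φ) = c • A φ) :
    ∃ T : X →ₗ[ℂ] Y, ∀ φ, ⇑(T φ) = A φ := by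
  choose T hT using hex
  exact ⟨{ toFun := T
           map_add' := fun φ ψ => DFunLike.coe_injective (by
            rw [SmoothSpace.coe_add, hT, hT, hT, SmoothSpace.coe_add, hadd])
           map_smul' := fun c φ => DFunLike.coe_injective (by
            rw [RingHom.id_apply, SmoothSpace.coe_smul, hT, hT, SmoothSpace.coe_smul, hsmul]) }, hT⟩

variable {d : ℕ} {s σ : Fin d → ℝ} {h C : ℝ} (L : Submodule ℤ (EuclideanSpace ℝ (Fin d)))
  {Φ Ψ : EuclideanSpace ℝ (Fin d) × EuclideanSpace ℝ (Fin d) → ℂ} {g γ : EuclideanSpace ℝ (Fin d) → ℂ}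
  {φ ψ : EuclideanSpace ℝ (Fin d) → ℂ}

theorem zakAdj_add (h1 : ∀ x, Integrable fun ξ => Φ (x, ξ)) (h2 : ∀ x, Integrable fun ξ => Ψ (x, ξ))
    (h3 : ∀ x, Summable fun j : L => zakAdjTerm Φ j x) (h4 : ∀ x, Summable fun j : L => zakAdjTerm Ψ j x) :
    zakAdj L (Φ + Ψ) = zakAdj L Φ + zakAdj L Ψ := by
  have hi (F : EuclideanSpace ℝ (Fin d) × EuclideanSpace ℝ (Fin d) → ℂ)
      (hF : ∀ x, Integrable fun ξ => F (x, ξ)) (j x : EuclideanSpace ℝ (Fin d)) :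
      Integrable fun ξ => char j ξ * F (x + j, ξ) := by
    refine (hF (x + j)).bdd_mul (c := 1) (contDiff_char j).continuous.aestronglyMeasurable
      (Eventually.of_forall fun ξ => (norm_char j ξ).le)
  ext x
  rw [Pi.add_apply, zakAdj, zakAdj, zakAdj, ← (h3 x).tsum_add (h4 x)]
  refine tsum_congr fun j => ?_
  rw [zakAdjTerm, zakAdjTerm, zakAdjTerm, ← integral_add (hi Φ h1 j x) (hi Ψ h2 j x)]
  simp only [Pi.add_apply, mul_add]

theorem zakAdj_smul (c : ℂ) : zakAdj L (c • Φ) = c • zakAdj L Φ := by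
  ext x
  rw [Pi.smul_apply, zakAdj, zakAdj, smul_eq_mul, ← tsum_mul_left]
  refine tsum_congr fun j => ?_
  rw [zakAdjTerm, zakAdjTerm, ← integral_const_mul]
  simp only [Pi.smul_apply, smul_eq_mul, mul_left_comm]

theorem zakAdjInv_add (h1 : ∀ z, Summable fun m : L => windowed g γ (fun z => φ (z.1 + m)) m z)
    (h2 : ∀ z, Summable fun m : L => windowed g γ (fun z => ψ (z.1 + m)) m z) :
    zakAdjInv L g γ (φ + ψ) = zakAdjInv L g γ φ + zakAdjInv L g γ ψ := by
  ext z
  rw [Pi.add_apply, zakAdjInv, zakAdjInv, zakAdjInv, ← (h1 z).tsum_add (h2 z)]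
  refine tsum_congr fun m => ?_
  simp only [windowed, Pi.add_apply, mul_add]

theorem zakAdjInv_smul (c : ℂ) : zakAdjInv L g γ (c • φ) = c • zakAdjInv L g γ φ := by
  ext z
  rw [Pi.smul_apply, zakAdjInv, zakAdjInv, smul_eq_mul, ← tsum_mul_left]
  refine tsum_congr fun m => ?_
  simp only [windowed, Pi.smul_apply, smul_eq_mul, mul_left_comm c]

theorem HasGSBound.integrable_slice (hs : ∀ i, 0 < s i) (hσ : ∀ i, 0 < σ i) (hh : 0 < h)
    (hΦs : ContDiff ℝ ∞ Φ) (hΦ : HasGSBound (stdBasis₂ d) (Sum.elim s σ) (Sum.elim σ s) h C Φ)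
    (x : EuclideanSpace ℝ (Fin d)) : Integrable fun ξ => Φ (x, ξ) := by
  obtain ⟨D, -, hD⟩ := hΦ.exists_norm_le_decay_mul hs hσ hh
  refine (((integrable_decay volume).const_mul (decay x)).const_mul D).mono'
    (hΦs.continuous.comp (continuous_const.prodMk continuous_id)).aestronglyMeasurable
    (Eventually.of_forall fun ξ => hD x ξ)

theorem HasGSBound.slice_left (hs : ∀ i, 0 < s i) (hσ : ∀ i, 0 < σ i) (hh : 0 < h)
    (hΦs : ContDiff ℝ ∞ Φ) (hΦ : HasGSBound (stdBasis₂ d) (Sum.elim s σ) (Sum.elim σ s) h C Φ)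
    (ξ : EuclideanSpace ℝ (Fin d)) : HasGSBound (stdBasis d) s σ h C fun x => Φ (x, ξ) := fun x => by
  refine ((hΦ (x, ξ)).slice_left hΦs).mono hh.le le_rfl ?_
  have h1 := growth_pos (b := stdBasis d) hs hh x
  have h2 := one_le_growth (b := stdBasis d) hσ hh ξ
  rw [growth_prod hs hσ hh]
  exact div_le_div_of_nonneg_left (hΦ.nonneg (sumElim_pos hs hσ) hh) h1
    (le_mul_of_one_le_right h1.le h2)

end linear

/-! ### The operators between the test function spaces -/

section zak

variable {d : ℕ} (e : Module.Basis (Fin d) ℝ (EuclideanSpace ℝ (Fin d)))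

/-- If `S` is given by `zakAdj` and has a right inverse `R` such that `R ∘ S` is not seen by the
quasi-periodic functionals, then the transpose of `S` is a homeomorphism onto these functionals. -/
theorem exists_equiv_quasiPeriodic {X₁ X₂ : Type*} [AddCommGroup X₁] [Module ℂ X₁] [TopologicalSpace X₁]
    [FunLike X₁ (EuclideanSpace ℝ (Fin d)) ℂ] [AddCommGroup X₂] [Module ℂ X₂] [TopologicalSpace X₂]
    [FunLike X₂ (EuclideanSpace ℝ (Fin d) × EuclideanSpace ℝ (Fin d)) ℂ]
    (S : X₂ →L[ℂ] X₁) (hS : ∀ Φ, ⇑(S Φ) = zakAdj (Zak.lattice e) Φ) (R : X₁ →L[ℂ] X₂)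
    (hSR : ∀ φ, S (R φ) = φ)
    (hRS : ∀ F ∈ Zak.quasiPeriodic e X₂, ∀ Φ, F (R (S Φ)) = F Φ) :
    ∃ Z : StrongDual ℂ X₁ ≃L[ℂ] Zak.quasiPeriodic e X₂,
      ∀ u Φ, (Z u : StrongDual ℂ X₂) Φ = u (S Φ) := by
  have hqp (u : StrongDual ℂ X₁) : ContinuousLinearMap.precomp ℂ S u ∈ Zak.quasiPeriodic e X₂ := by
    refine ⟨fun k hk Φ Φ₁ Φ₂ h₁ h₂ => congrArg u (DFunLike.coe_injective ?_),
      fun κ hκ Φ Φ₁ h₁ => congrArg u (DFunLike.coe_injective ?_)⟩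
    · exact (hS Φ₁).trans ((zakAdj_translate e hk h₁ h₂).trans (hS Φ₂).symm)
    · exact (hS Φ₁).trans ((zakAdj_translate_right e hκ h₁).trans (hS Φ).symm)
  refine ⟨ContinuousLinearEquiv.equivOfInverse
    ((ContinuousLinearMap.precomp ℂ S).codRestrict (Zak.quasiPeriodic e X₂) hqp)
    ((ContinuousLinearMap.precomp ℂ R).comp (Zak.quasiPeriodic e X₂).subtypeL)
    (fun u => ?_) (fun F => ?_), fun u Φ => rfl⟩
  · ext φ
    exact congrArg u (hSR φ)
  · ext Φ
    exact hRS F F.2 Φ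

variable {s σ : Fin d → ℝ}

theorem Roumieu.exists_zakAdj (hs : ∀ i, 0 < s i) (hσ : ∀ i, 0 < σ i) :
    ∃ S : Roumieu (stdBasis₂ d) (Sum.elim s σ) (Sum.elim σ s) →L[ℂ] Roumieu (stdBasis d) s σ,
      ∀ Φ, ⇑(S Φ) = zakAdj (Zak.lattice e) Φ := by
  have hp := sumElim_pos hs hσ
  have hd := one_pos.trans_le (one_le_dbl hs)
  have hreg (Φ : Roumieu (stdBasis₂ d) (Sum.elim s σ) (Sum.elim σ s)) :
      (∀ x, Integrable fun ξ => Φ (x, ξ)) ∧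
      (∀ x, Summable fun j : Zak.lattice e => zakAdjTerm Φ j x) ∧
      ∃ φ : Roumieu (stdBasis d) s σ, ⇑φ = zakAdj (Zak.lattice e) Φ := by
    obtain ⟨h, hh, C, hC⟩ := Roumieu.exists_hasGSBound hp Φ
    obtain ⟨M, -, hM⟩ := zakAdj_bound (Zak.lattice e) hs hσ hh
    obtain ⟨h1, h2, h3⟩ := hM Φ.2.1 hC
    exact ⟨hC.integrable_slice hs hσ hh Φ.2.1, h3, Roumieu.exists_coe_eq hs h1 (by positivity) h2⟩
  obtain ⟨S, hS⟩ := exists_linearMap_coe_eq (A := zakAdj (Zak.lattice e)) (fun Φ => (hreg Φ).2.2)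
    (fun Φ Ψ => zakAdj_add _ (hreg Φ).1 (hreg Ψ).1 (hreg Φ).2.1 (hreg Ψ).2.1)
    (fun c Φ => zakAdj_smul _ c)
  refine ⟨⟨S, Roumieu.continuous_of_bound hp hs S fun h hh => ?_⟩, hS⟩
  obtain ⟨M, hM0, hM⟩ := zakAdj_bound (Zak.lattice e) hs hσ hh
  exact ⟨2 * (dbl s * h), by positivity, M, hM0, fun Φ C hC => by
    rw [hS]
    exact (hM Φ.2.1 hC).2.1⟩

theorem Beurling.exists_zakAdj (hs : ∀ i, 0 < s i) (hσ : ∀ i, 0 < σ i) :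
    ∃ S : Beurling (stdBasis₂ d) (Sum.elim s σ) (Sum.elim σ s) →L[ℂ] Beurling (stdBasis d) s σ,
      ∀ Φ, ⇑(S Φ) = zakAdj (Zak.lattice e) Φ := by
  have hp := sumElim_pos hs hσ
  have hd := one_pos.trans_le (one_le_dbl hs)
  have hlev (h : ℝ) : 2 * (dbl s * (h / (2 * dbl s))) = h := by field_simp
  have hreg (Φ : Beurling (stdBasis₂ d) (Sum.elim s σ) (Sum.elim σ s)) :
      (∀ x, Integrable fun ξ => Φ (x, ξ)) ∧
      (∀ x, Summable fun j : Zak.lattice e => zakAdjTerm Φ j x) ∧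
      ∃ φ : Beurling (stdBasis d) s σ, ⇑φ = zakAdj (Zak.lattice e) Φ := by
    have hb (h : ℝ) (hh : 0 < h) := zakAdj_bound (Zak.lattice e) hs hσ
      (h := h / (2 * dbl s)) (by positivity)
    have hC (h : ℝ) (hh : 0 < h) := Beurling.exists_hasGSBound hp Φ
      (h := h / (2 * dbl s)) (by positivity)
    obtain ⟨C, hC1⟩ := hC 1 one_pos
    obtain ⟨M, -, hM⟩ := hb 1 one_pos
    obtain ⟨h1, -, h3⟩ := hM Φ.2.1 hC1
    refine ⟨hC1.integrable_slice hs hσ (by positivity) Φ.2.1, h3,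
      Beurling.exists_coe_eq hs h1 fun h hh => ?_⟩
    obtain ⟨C, hC1⟩ := hC h hh
    obtain ⟨M, -, hM⟩ := hb h hh
    have := (hM Φ.2.1 hC1).2.1
    rw [hlev] at this
    exact ⟨_, this⟩
  obtain ⟨S, hS⟩ := exists_linearMap_coe_eq (A := zakAdj (Zak.lattice e)) (fun Φ => (hreg Φ).2.2)
    (fun Φ Ψ => zakAdj_add _ (hreg Φ).1 (hreg Ψ).1 (hreg Φ).2.1 (hreg Ψ).2.1)
    (fun c Φ => zakAdj_smul _ c)
  refine ⟨⟨S, Beurling.continuous_of_bound hp hs S fun h hh => ?_⟩, hS⟩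
  obtain ⟨M, hM0, hM⟩ := zakAdj_bound (Zak.lattice e) hs hσ (h := h / (2 * dbl s)) (by positivity)
  exact ⟨h / (2 * dbl s), by positivity, M, hM0, fun Φ C hC => by
    rw [hS, ← hlev h]
    exact (hM Φ.2.1 hC).2.1⟩

variable {g γ : EuclideanSpace ℝ (Fin d) → ℂ}

/-- The right inverse of `zakAdj`, as a continuous map between Roumieu spaces. -/
theorem Roumieu.exists_zakAdjInv (hs : ∀ i, 0 < s i) (hσ : ∀ i, 0 < σ i)
    (hgs : ContDiff ℝ ∞ g) (hγs : ContDiff ℝ ∞ γ) {h₀ Cg Cγ : ℝ} (hh₀ : 0 < h₀)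
    (hg : HasGSBound (stdBasis d) s σ h₀ Cg g) (hγ : HasGSBound (stdBasis d) σ s h₀ Cγ γ) :
    ∃ R : Roumieu (stdBasis d) s σ →L[ℂ] Roumieu (stdBasis₂ d) (Sum.elim s σ) (Sum.elim σ s),
      ∀ φ, ⇑(R φ) = (dualVol e : ℂ)⁻¹ • zakAdjInv (Zak.lattice e) g γ φ := by
  have hp := sumElim_pos hs hσ
  have hl := one_pos.trans_le (one_le_loss hs hσ)
  -- The windows satisfy bounds for h₀ and larger parameters only, so all functions are estimated
  -- with max h₀ h.
  have hb (h : ℝ) (hh : 0 < h) := zakAdjInv_bound (Zak.lattice e) hs hσ (lt_max_of_lt_left hh₀) hgs hγs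
    (hg.mono hs hh₀ (le_max_left h₀ h) le_rfl (hg.nonneg hs hh₀))
    (hγ.mono hσ hh₀ (le_max_left h₀ h) le_rfl (hγ.nonneg hσ hh₀))
  have hreg (φ : Roumieu (stdBasis d) s σ) :
      (∀ z, Summable fun m : Zak.lattice e => windowed g γ (fun z => φ (z.1 + m)) m z) ∧
      ∃ Φ : Roumieu (stdBasis₂ d) (Sum.elim s σ) (Sum.elim σ s),
        ⇑Φ = (dualVol e : ℂ)⁻¹ • zakAdjInv (Zak.lattice e) g γ φ := by
    obtain ⟨h, hh, C, hC⟩ := Roumieu.exists_hasGSBound hs φ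
    obtain ⟨M, -, hM⟩ := hb h hh
    obtain ⟨h1, h2, h3⟩ := hM φ.2.1 (hC.mono hs hh (le_max_right h₀ h) le_rfl (hC.nonneg hs hh))
    exact ⟨h3, Roumieu.exists_coe_eq hp (h1.const_smul (dualVol e : ℂ)⁻¹) (by positivity) (h2.const_smul h1 _)⟩
  obtain ⟨R, hR⟩ := exists_linearMap_coe_eq
    (A := fun φ => (dualVol e : ℂ)⁻¹ • zakAdjInv (Zak.lattice e) g γ φ) (fun φ => (hreg φ).2)
    (fun φ ψ => by rw [zakAdjInv_add _ (hreg φ).1 (hreg ψ).1, smul_add])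
    (fun c φ => by rw [zakAdjInv_smul, smul_comm])
  refine ⟨⟨R, Roumieu.continuous_of_bound hs hp R fun h hh => ?_⟩, hR⟩
  obtain ⟨M, hM0, hM⟩ := hb h hh
  refine ⟨loss s σ * max h₀ h, by positivity, ‖(dualVol e : ℂ)⁻¹‖ * M, by positivity, fun φ C hC => ?_⟩
  obtain ⟨h1, h2, -⟩ := hM φ.2.1 (hC.mono hs hh (le_max_right h₀ h) le_rfl (hC.nonneg hs hh))
  rw [hR, mul_assoc]
  exact h2.const_smul h1 _

/-- The right inverse of `zakAdj`, as a continuous map between Beurling spaces. -/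
theorem Beurling.exists_zakAdjInv (hs : ∀ i, 0 < s i) (hσ : ∀ i, 0 < σ i)
    (hgs : ContDiff ℝ ∞ g) (hγs : ContDiff ℝ ∞ γ)
    (hg : ∀ h, 0 < h → ∃ C, HasGSBound (stdBasis d) s σ h C g)
    (hγ : ∀ h, 0 < h → ∃ C, HasGSBound (stdBasis d) σ s h C γ) :
    ∃ R : Beurling (stdBasis d) s σ →L[ℂ] Beurling (stdBasis₂ d) (Sum.elim s σ) (Sum.elim σ s),
      ∀ φ, ⇑(R φ) = (dualVol e : ℂ)⁻¹ • zakAdjInv (Zak.lattice e) g γ φ := by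
  have hp := sumElim_pos hs hσ
  have hl := one_pos.trans_le (one_le_loss hs hσ)
  have hb (h : ℝ) (hh : 0 < h) : ∃ M, 0 ≤ M ∧ ∀ {C} {φ}, ContDiff ℝ ∞ φ →
      HasGSBound (stdBasis d) s σ (h / loss s σ) C φ →
      ContDiff ℝ ∞ (zakAdjInv (Zak.lattice e) g γ φ) ∧
      HasGSBound (stdBasis₂ d) (Sum.elim s σ) (Sum.elim σ s) h (M * C) (zakAdjInv (Zak.lattice e) g γ φ) ∧
      ∀ z, Summable fun m : Zak.lattice e => windowed g γ (fun z => φ (z.1 + m)) m z := by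
    have hk : 0 < h / loss s σ := by positivity
    obtain ⟨Cg, hg'⟩ := hg _ hk
    obtain ⟨Cγ, hγ'⟩ := hγ _ hk
    have := zakAdjInv_bound (Zak.lattice e) hs hσ hk hgs hγs hg' hγ'
    rwa [mul_div_cancel₀ _ hl.ne'] at this
  have hreg (φ : Beurling (stdBasis d) s σ) :
      (∀ z, Summable fun m : Zak.lattice e => windowed g γ (fun z => φ (z.1 + m)) m z) ∧
      ∃ Φ : Beurling (stdBasis₂ d) (Sum.elim s σ) (Sum.elim σ s),
        ⇑Φ = (dualVol e : ℂ)⁻¹ • zakAdjInv (Zak.lattice e) g γ φ := by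
    have hφ (h : ℝ) (hh : 0 < h) : ∃ C, ContDiff ℝ ∞ (zakAdjInv (Zak.lattice e) g γ φ) ∧
        HasGSBound (stdBasis₂ d) (Sum.elim s σ) (Sum.elim σ s) h C (zakAdjInv (Zak.lattice e) g γ φ) ∧
        ∀ z, Summable fun m : Zak.lattice e => windowed g γ (fun z => φ (z.1 + m)) m z := by
      obtain ⟨C, hC⟩ := Beurling.exists_hasGSBound hs φ (h := h / loss s σ) (by positivity)
      obtain ⟨M, -, hM⟩ := hb h hh
      exact ⟨_, hM φ.2.1 hC⟩
    obtain ⟨_, h1, -, h3⟩ := hφ 1 one_pos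
    refine ⟨h3, Beurling.exists_coe_eq hp (h1.const_smul (dualVol e : ℂ)⁻¹) fun h hh => ?_⟩
    obtain ⟨_, -, h2, -⟩ := hφ h hh
    exact ⟨_, h2.const_smul h1 _⟩
  obtain ⟨R, hR⟩ := exists_linearMap_coe_eq
    (A := fun φ => (dualVol e : ℂ)⁻¹ • zakAdjInv (Zak.lattice e) g γ φ) (fun φ => (hreg φ).2)
    (fun φ ψ => by rw [zakAdjInv_add _ (hreg φ).1 (hreg ψ).1, smul_add])
    (fun c φ => by rw [zakAdjInv_smul, smul_comm])
  refine ⟨⟨R, Beurling.continuous_of_bound hs hp R fun h hh => ?_⟩, hR⟩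
  obtain ⟨M, hM0, hM⟩ := hb h hh
  refine ⟨h / loss s σ, by positivity, ‖(dualVol e : ℂ)⁻¹‖ * M, by positivity, fun φ C hC => ?_⟩
  obtain ⟨h1, h2, -⟩ := hM φ.2.1 hC
  rw [hR, mul_assoc]
  exact h2.const_smul h1 _

end zak

/-! ### Inversion and uniqueness -/

section zak

variable {d : ℕ} (e : Module.Basis (Fin d) ℝ (EuclideanSpace ℝ (Fin d)))

theorem apply_apply_eq_self {X₁ X₂ : Type*} [AddCommGroup X₁] [Module ℂ X₁]
    [FunLike X₁ (EuclideanSpace ℝ (Fin d)) ℂ] [AddCommGroup X₂] [Module ℂ X₂]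
    [FunLike X₂ (EuclideanSpace ℝ (Fin d) × EuclideanSpace ℝ (Fin d)) ℂ] [SmoothSpace X₁ (EuclideanSpace ℝ (Fin d))]
    {s σ : Fin d → ℝ} {g γ : EuclideanSpace ℝ (Fin d) → ℂ}
    (hs : ∀ i, 0 < s i) (hσ : ∀ i, 0 < σ i) (hγs : ContDiff ℝ ∞ γ)
    (hg1 : ∀ x, ∑' k : Zak.lattice e, g (x - k) = 1)
    (hγ1 : ∀ ξ, ∑' κ : Zak.lattice (Zak.dualVec e), γ (ξ - κ) = 1)
    {h Cγ : ℝ} (hh : 0 < h) (hγ : HasGSBound (stdBasis d) σ s h Cγ γ) {S : X₂ → X₁}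
    (hS : ∀ Φ, ⇑(S Φ) = zakAdj (Zak.lattice e) Φ) {R : X₁ → X₂}
    (hR : ∀ φ, ⇑(R φ) = (dualVol e : ℂ)⁻¹ • zakAdjInv (Zak.lattice e) g γ φ) {φ : X₁} {h' C : ℝ}
    (hh' : 0 < h') (hφ : HasGSBound (stdBasis d) s σ h' C φ) : S (R φ) = φ := by
  refine DFunLike.coe_injective ?_
  obtain ⟨D, -, hD⟩ := hγ.exists_norm_le_decay' hσ hh
  obtain ⟨D', -, hD'⟩ := hφ.exists_norm_le_decay' hs hh'
  rw [hS, hR, zakAdj_smul]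
  ext x
  rw [Pi.smul_apply, zakAdj_zakAdjInv e hγs.continuous hD hγ1 hg1 hD' x, smul_eq_mul,
    inv_mul_cancel_left₀ (by exact_mod_cast (dualVol_pos e).ne')]

variable {s σ : ℝ}

theorem Roumieu.exists_right_inverse (hs : 0 < s) (hσ : 0 < σ)
    {S : Roumieu₂ d d s σ σ s →L[ℂ] Roumieu₁ d s σ} (hS : ∀ Φ, ⇑(S Φ) = zakAdj (Zak.lattice e) Φ) :
    ∃ R : Roumieu₁ d s σ →L[ℂ] Roumieu₂ d d s σ σ s, (∀ φ, S (R φ) = φ) ∧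
      ∀ F ∈ Zak.quasiPeriodic e (Roumieu₂ d d s σ σ s), ∀ Φ, F (R (S Φ)) = F Φ := by
  have hs' : ∀ _ : Fin d, 0 < s := fun _ => hs
  have hσ' : ∀ _ : Fin d, 0 < σ := fun _ => hσ
  have hp := sumElim_pos hs' hσ'
  -- If the space on ℝ^d is zero, there are no windows; but the slices Φ(·, ξ) belong to this space,
  -- so Φ = 0 and R = 0 will do.
  by_cases hX : ∀ φ : Roumieu₁ d s σ, φ = 0
  · refine ⟨0, fun φ => (hX _).trans (hX φ).symm, fun F _ Φ => congrArg F ?_⟩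
    refine DFunLike.coe_injective (funext fun z => ?_)
    obtain ⟨h, hh, C, hC⟩ := Roumieu.exists_hasGSBound hp Φ
    obtain ⟨φ, hφ⟩ := Roumieu.exists_coe_eq hs' (Φ.2.1.comp (contDiff_id.prodMk contDiff_const)) hh
      (hC.slice_left hs' hσ' hh Φ.2.1 z.2)
    have h1 := congrFun hφ z.1
    rw [hX φ] at h1
    exact h1
  · push Not at hX
    obtain ⟨f, hf⟩ := hX
    obtain ⟨h, hh, C, hC⟩ := Roumieu.exists_hasGSBound hs' f
    obtain ⟨g, γ, hgs, hγs, hg1, hγ1, h₀, hh₀, ⟨Cg, hg⟩, Cγ, hγ⟩ := exists_windows_roumieu e hs hσ f.2.1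
      (fun h0 => hf (DFunLike.coe_injective h0)) hh hC
    obtain ⟨R, hR⟩ := Roumieu.exists_zakAdjInv e hs' hσ' hgs hγs hh₀ hg hγ
    refine ⟨R, fun φ => ?_, fun F hF Φ => ?_⟩
    · obtain ⟨h', hh', C', hφ⟩ := Roumieu.exists_hasGSBound hs' φ
      exact apply_apply_eq_self e hs' hσ' hγs hg1 hγ1 hh₀ hγ hS hR hh' hφ
    · obtain ⟨h₁, hh₁, C₁, hΦ⟩ := Roumieu.exists_hasGSBound hp Φ
      -- A common parameter for the windows and for Φ; in the Roumieu case F is bounded with respect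
      -- to every h, so the further loss does no harm.
      obtain ⟨k, hk⟩ : ∃ k, k = max h₀ h₁ := ⟨_, rfl⟩
      have hk0 : 0 < k := hk ▸ lt_max_of_lt_left hh₀
      have hl := one_pos.trans_le (one_le_loss hs' hσ')
      have hg' := hg.mono hs' hh₀ (hk ▸ le_max_left h₀ h₁ : h₀ ≤ k) le_rfl (hg.nonneg hs' hh₀)
      have hγ' := hγ.mono hσ' hh₀ (hk ▸ le_max_left h₀ h₁ : h₀ ≤ k) le_rfl (hγ.nonneg hσ' hh₀)
      have hΦ' := hΦ.mono hp hh₁ (hk ▸ le_max_right h₀ h₁ : h₁ ≤ k) le_rfl (hΦ.nonneg hp hh₁)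
      obtain ⟨K, -, hK⟩ := Roumieu.exists_norm_apply_le hp F
        (h := loss (fun _ : Fin d => s) (fun _ => σ) * k) (by positivity)
      obtain ⟨M, -, hM⟩ := piece_bound hs' hσ' hk0 hgs hγs Φ.2.1 hg' hγ' hΦ'
      refine (apply_eq_of_mem_quasiPeriodic e hs' hσ' hk0 hgs hγs hg' hγ' hg1 hγ1 hF hK (fun Ψ a => ?_) hΦ'
        (fun k κ => Roumieu.exists_coe_eq hp (contDiff_piece hgs hγs Φ.2.1 k κ) (by positivity) (hM k κ).1)
        (fun k κ => Roumieu.exists_coe_eq hp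
          (contDiff_windowed hgs hγs (Φ.2.1.comp (contDiff_id.add contDiff_const)) k)
          (by positivity) (hM k κ).2) (fun z => ?_)).symm
      · obtain ⟨h₂, hh₂, C₂, hΨ⟩ := Roumieu.exists_hasGSBound hp Ψ
        obtain ⟨A, hA⟩ := Roumieu.exists_coe_eq hp (Ψ.2.1.comp (contDiff_id.add contDiff_const))
          (by positivity) (hΨ.comp_add hp hh₂ a)
        exact ⟨A, fun z => congrFun hA z⟩
      · rw [hR, hS]
        rfl

theorem Beurling.exists_right_inverse (hs : 0 < s) (hσ : 0 < σ)
    {S : Beurling₂ d d s σ σ s →L[ℂ] Beurling₁ d s σ} (hS : ∀ Φ, ⇑(S Φ) = zakAdj (Zak.lattice e) Φ) :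
    ∃ R : Beurling₁ d s σ →L[ℂ] Beurling₂ d d s σ σ s, (∀ φ, S (R φ) = φ) ∧
      ∀ F ∈ Zak.quasiPeriodic e (Beurling₂ d d s σ σ s), ∀ Φ, F (R (S Φ)) = F Φ := by
  have hs' : ∀ _ : Fin d, 0 < s := fun _ => hs
  have hσ' : ∀ _ : Fin d, 0 < σ := fun _ => hσ
  have hp := sumElim_pos hs' hσ'
  by_cases hX : ∀ φ : Beurling₁ d s σ, φ = 0
  · refine ⟨0, fun φ => (hX _).trans (hX φ).symm, fun F _ Φ => congrArg F ?_⟩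
    refine DFunLike.coe_injective (funext fun z => ?_)
    obtain ⟨φ, hφ⟩ := Beurling.exists_coe_eq (b := stdBasis d) (σ := fun _ => σ) hs'
      (Φ.2.1.comp (contDiff_id.prodMk (contDiff_const (c := z.2)))) fun h hh => by
        obtain ⟨C, hC⟩ := Beurling.exists_hasGSBound hp Φ hh
        exact ⟨C, hC.slice_left hs' hσ' hh Φ.2.1 z.2⟩
    have h1 := congrFun hφ z.1
    rw [hX φ] at h1
    exact h1
  · push Not at hX
    obtain ⟨f, hf⟩ := hX
    obtain ⟨g, γ, hgs, hγs, hg1, hγ1, hw⟩ := exists_windows_beurling e hs hσ f.2.1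
      (fun h0 => hf (DFunLike.coe_injective h0)) fun h hh => Beurling.exists_hasGSBound hs' f hh
    obtain ⟨R, hR⟩ := Beurling.exists_zakAdjInv e hs' hσ' hgs hγs (fun h hh => (hw h hh).1)
      fun h hh => (hw h hh).2
    refine ⟨R, fun φ => ?_, fun F hF Φ => ?_⟩
    · obtain ⟨C', hφ⟩ := Beurling.exists_hasGSBound hs' φ one_pos
      obtain ⟨-, Cγ, hγ⟩ := hw 1 one_pos
      exact apply_apply_eq_self e hs' hσ' hγs hg1 hγ1 one_pos hγ hS hR one_pos hφ
    · have hl := one_pos.trans_le (one_le_loss hs' hσ')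
      -- For membership in the Beurling space, the pieces need bounds for every h, whereas F is
      -- bounded with respect to one particular h only. The latter determines the k used for the
      -- summation below.
      have hpw (h : ℝ) (hh : 0 < h) : ∃ M, ∀ (k κ : EuclideanSpace ℝ (Fin d)),
          HasGSBound (stdBasis₂ d) (Sum.elim (fun _ => s) fun _ => σ) (Sum.elim (fun _ => σ) fun _ => s) h
            (M * (decay k * decay κ)) (piece g γ Φ k κ) ∧
          HasGSBound (stdBasis₂ d) (Sum.elim (fun _ => s) fun _ => σ) (Sum.elim (fun _ => σ) fun _ => s) h
            (M * (decay k * decay κ)) (windowed g γ (fun z => Φ (z + (k, κ))) k) := by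
        have hk : 0 < h / loss (fun _ : Fin d => s) (fun _ => σ) := by positivity
        obtain ⟨⟨Cg, hg⟩, Cγ, hγ⟩ := hw _ hk
        obtain ⟨C, hΦ⟩ := Beurling.exists_hasGSBound hp Φ hk
        obtain ⟨M, -, hM⟩ := piece_bound hs' hσ' hk hgs hγs Φ.2.1 hg hγ hΦ
        rw [mul_div_cancel₀ _ hl.ne'] at hM
        exact ⟨M, hM⟩
      obtain ⟨h, hh, K, -, hK⟩ := Beurling.exists_norm_apply_le hp F
      obtain ⟨k, hk⟩ : ∃ k, k = h / loss (fun _ : Fin d => s) (fun _ => σ) := ⟨_, rfl⟩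
      have hk0 : 0 < k := hk ▸ by positivity
      have hkh : loss (fun _ : Fin d => s) (fun _ => σ) * k = h := by rw [hk, mul_div_cancel₀ _ hl.ne']
      rw [← hkh] at hK
      obtain ⟨⟨Cg, hg⟩, Cγ, hγ⟩ := hw k hk0
      obtain ⟨C, hΦ⟩ := Beurling.exists_hasGSBound hp Φ hk0
      refine (apply_eq_of_mem_quasiPeriodic e hs' hσ' hk0 hgs hγs hg hγ hg1 hγ1 hF hK (fun Ψ a => ?_) hΦ
        (fun k κ => Beurling.exists_coe_eq hp (contDiff_piece hgs hγs Φ.2.1 k κ) fun h hh => ?_)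
        (fun k κ => Beurling.exists_coe_eq hp
          (contDiff_windowed hgs hγs (Φ.2.1.comp (contDiff_id.add contDiff_const)) k) fun h hh => ?_)
        (fun z => ?_)).symm
      · obtain ⟨A, hA⟩ := Beurling.exists_coe_eq hp (Ψ.2.1.comp (contDiff_id.add (contDiff_const (c := a))))
          fun h hh => by
            obtain ⟨C₂, hΨ⟩ := Beurling.exists_hasGSBound hp Ψ (half_pos hh)
            have := hΨ.comp_add hp (half_pos hh) a
            rw [mul_div_cancel₀ _ two_ne_zero] at this
            exact ⟨_, this⟩
        exact ⟨A, fun z => congrFun hA z⟩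
      · obtain ⟨M, hM⟩ := hpw h hh
        exact ⟨_, (hM k κ).1⟩
      · obtain ⟨M, hM⟩ := hpw h hh
        exact ⟨_, (hM k κ).2⟩
      · rw [hR, hS]
        rfl

/-- The transpose of `zakAdj` is the only continuous extension of the Zak transform. -/
theorem isGivenBy_zak_and_unique {X₁ X₂ : Type*} [AddCommGroup X₁] [Module ℂ X₁] [TopologicalSpace X₁]
    [AddCommGroup X₂] [Module ℂ X₂] [TopologicalSpace X₂] [IsTopologicalAddGroup X₂] [ContinuousSMul ℂ X₂]
    [FunLike X₁ (EuclideanSpace ℝ (Fin d)) ℂ]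
    [FunLike X₂ (EuclideanSpace ℝ (Fin d) × EuclideanSpace ℝ (Fin d)) ℂ]
    [SmoothSpace X₂ (EuclideanSpace ℝ (Fin d) × EuclideanSpace ℝ (Fin d))]
    (hX₂ : ∀ Φ : X₂, ∃ D, 0 ≤ D ∧ ∀ x ξ, ‖Φ (x, ξ)‖ ≤ D * (decay x * decay x * decay ξ))
    {S : X₂ → X₁} (hS : ∀ Φ, ⇑(S Φ) = zakAdj (Zak.lattice e) Φ)
    {ℓ : 𝓢(EuclideanSpace ℝ (Fin d), ℂ) → StrongDual ℂ X₁} (hℓ : ∀ f φ, ℓ f φ = ∫ x, f x * φ x)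
    (hd : DenseRange ℓ) (Z : StrongDual ℂ X₁ ≃L[ℂ] Zak.quasiPeriodic e X₂)
    (hZ : ∀ u Φ, (Z u : StrongDual ℂ X₂) Φ = u (S Φ)) :
    (∀ f, IsGivenBy (Z (ℓ f) : StrongDual ℂ X₂) (Zak.zak e f)) ∧
    ∀ T : StrongDual ℂ X₁ → StrongDual ℂ X₂, Continuous T → (∀ f, IsGivenBy (T (ℓ f)) (Zak.zak e f)) →
      ∀ u, T u = Z u := by
  have h1 (f) : IsGivenBy (Z (ℓ f) : StrongDual ℂ X₂) (Zak.zak e f) := fun Φ => by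
    obtain ⟨D, hD0, hD⟩ := hX₂ Φ
    obtain ⟨h1, h2⟩ := integral_zak_mul e (SmoothSpace.contDiff Φ).continuous hD0 hD f
    exact ⟨h1, by rw [hZ, hℓ, hS, h2]⟩
  refine ⟨h1, fun T hT hTf u => ?_⟩
  have h2 := hd.equalizer hT (continuous_subtype_val.comp Z.continuous) (funext fun f => by
    ext Φ
    exact (hTf f Φ).2.trans (h1 f Φ).2.symm)
  exact congrFun h2 u

end zak

end GelfandShilov

end

theorem theorem3p3 (d : ℕ) (s σ : ℝ) (hs : 0 < s) (hσ : 0 < σ)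
    (e : Module.Basis (Fin d) ℝ (EuclideanSpace ℝ (Fin d))) :
    (∃ Z : StrongDual ℂ (GelfandShilov.Roumieu₁ d s σ) ≃L[ℂ]
        Zak.quasiPeriodic e (GelfandShilov.Roumieu₂ d d s σ σ s),
      (∀ f : 𝓢(EuclideanSpace ℝ (Fin d), ℂ), GelfandShilov.IsGivenBy
        (Z (GelfandShilov.Roumieu₁.ofSchwartz d s σ f) :
          StrongDual ℂ (GelfandShilov.Roumieu₂ d d s σ σ s)) (Zak.zak e f)) ∧
      ∀ T : StrongDual ℂ (GelfandShilov.Roumieu₁ d s σ) →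
          StrongDual ℂ (GelfandShilov.Roumieu₂ d d s σ σ s),
        Continuous T →
        (∀ f : 𝓢(EuclideanSpace ℝ (Fin d), ℂ), GelfandShilov.IsGivenBy
          (T (GelfandShilov.Roumieu₁.ofSchwartz d s σ f)) (Zak.zak e f)) →
        ∀ u, T u = Z u) ∧
    (∃ Z : StrongDual ℂ (GelfandShilov.Beurling₁ d s σ) ≃L[ℂ]
        Zak.quasiPeriodic e (GelfandShilov.Beurling₂ d d s σ σ s),
      (∀ f : 𝓢(EuclideanSpace ℝ (Fin d), ℂ), GelfandShilov.IsGivenBy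
        (Z (GelfandShilov.Beurling₁.ofSchwartz d s σ f) :
          StrongDual ℂ (GelfandShilov.Beurling₂ d d s σ σ s)) (Zak.zak e f)) ∧
      ∀ T : StrongDual ℂ (GelfandShilov.Beurling₁ d s σ) →
          StrongDual ℂ (GelfandShilov.Beurling₂ d d s σ σ s),
        Continuous T →
        (∀ f : 𝓢(EuclideanSpace ℝ (Fin d), ℂ), GelfandShilov.IsGivenBy
          (T (GelfandShilov.Beurling₁.ofSchwartz d s σ f)) (Zak.zak e f)) →
        ∀ u, T u = Z u) := by
  have hs' : ∀ _ : Fin d, 0 < s := fun _ => hs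
  have hσ' : ∀ _ : Fin d, 0 < σ := fun _ => hσ
  have hp := GelfandShilov.sumElim_pos hs' hσ'
  constructor
  · obtain ⟨S, hS⟩ := GelfandShilov.Roumieu.exists_zakAdj e hs' hσ'
    obtain ⟨R, hSR, hRS⟩ := GelfandShilov.Roumieu.exists_right_inverse e hs hσ hS
    obtain ⟨Z, hZ⟩ := GelfandShilov.exists_equiv_quasiPeriodic e S hS R hSR hRS
    refine ⟨Z, GelfandShilov.isGivenBy_zak_and_unique e (fun Φ => ?_) hS (fun _ _ => rfl)
      (GelfandShilov.Roumieu.denseRange_ofSchwartz hs') Z hZ⟩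
    obtain ⟨h, hh, C, hC⟩ := GelfandShilov.Roumieu.exists_hasGSBound hp Φ
    exact hC.exists_norm_le_decay_sq_mul hs' hσ' hh
  · obtain ⟨S, hS⟩ := GelfandShilov.Beurling.exists_zakAdj e hs' hσ'
    obtain ⟨R, hSR, hRS⟩ := GelfandShilov.Beurling.exists_right_inverse e hs hσ hS
    obtain ⟨Z, hZ⟩ := GelfandShilov.exists_equiv_quasiPeriodic e S hS R hSR hRS
    refine ⟨Z, GelfandShilov.isGivenBy_zak_and_unique e (fun Φ => ?_) hS (fun _ _ => rfl)
      (GelfandShilov.Beurling.denseRange_ofSchwartz hs') Z hZ⟩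
    obtain ⟨C, hC⟩ := GelfandShilov.Beurling.exists_hasGSBound hp Φ one_pos
    exact hC.exists_norm_le_decay_sq_mul hs' hσ' one_pos
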